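/- \textbf{Setting.} Let $E$ be a finite set with a neighbourhood structure $(S_x)_{x\in E}$, and let $q_0$ be a transition matrix on $E$ that proposes exactly the neighbours: $q_0(x,S_x)=1$, and $q_0(x,y)>0$ for all $y\in S_x\setminus\{x\}$. Assume that $q_0$ is irreducible ($\sum_n q_0^{(n)}(x,y)=\infty$ for all $x,y$) and reversible with respect to a probability measure $\mu_0$ on $E$ that charges every point of a subset $E'\subset E$. For each $x\in E$ let $P_\Omega(x)$ be a probability measure on a space of random inputs, and let $U(x,\cdot)$ be a measurable cost such that for some $M>0$: $0\le U(x,\omega)\le M$ for all $\omega$ if $x\in E'$, and $U(x,\omega)=+\infty$ for all $\omega$ if $x\notin E'$. Put $J(x)=\mathbb E_{\omega\sim P_\Omega(x)}U(x,\omega)$, $J^\star=\min_E J$, $\chi_\eta=\{x\in E: J(x)\le J^\star+\eta\}$. A path from $x$ to $y$ is a finite sequence $x=x_0,\dots,x_n=y$ with $x_{i+1}\in S_{x_i}$; put $$H_{x,y}=\min_{p:\,x\to y}\ \max_{z\in p}J(z),\qquad m^\star=\max_{x,y\in E}\{H_{x,y}-\max(J(x),J(y))\}$$ (pairs with $J(x)=\infty$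 or $J(y)=\infty$ count as $0$). Assume $m^\star<\infty$, i.e. any two points of $E'$ can be joined by a path inside $E'$ (automatic if $E'=E$). \textbf{Algorithm (noisy simulated annealing, NSA).} For parameters $\alpha,b,d>0$ let $\beta_t=b\log(1+td)$ and $n_t=(1+td)^\alpha$. Start from $T_0=0$ and $\tilde\chi_0\in E'$ with an arbitrary law on $E'$. Given the past up to step $k$, let $T_{k+1}=T_k+\xi_{k+1}$ with $\xi_{k+1}$ an independent exponential variable of parameter $1$; given $T_{k+1}$, let $N_{T_{k+1}}-1$ be Poisson with parameter $n_{T_{k+1}}$; draw a candidate $y$ from $q_0(\tilde\chi_k,\cdot)$ and compute the means $\hat J(\tilde\chi_k)$, $\hat J(y)$ of $N_{T_{k+1}}$ independent evaluations of $U(\tilde\chi_k,\cdot)$ and of $U(y,\cdot)$, respectively; with probability $e^{-\beta_{T_{k+1}}(\hat J(y)-\hat J(\tilde\chi_k))_+}$ (where $e^{-\infty}=0$) set $\tilde\chi_{k+1}=y$, and otherwise set $\tilde\chi_{k+1}=\tilde\chi_k$. Let $\tilde X_t=\tilde\chi_k$ for $T_k\le t<T_{k+1}$. The number of cost evaluations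 up to time $T$ is $N^T_{call}=\sum_{k\ge1}\mathbf 1_{T_k<T}N_{T_k}$. \textbf{Corollary.} Let $\varepsilon,\gamma,d>0$ and take $\alpha=2(1+\gamma)$ and $b=\frac1{m^\star+\varepsilon}$. There are constants $\Gamma_\gamma,\Gamma_2>0$, independent of the law of $\tilde\chi_0$ on $E'$, such that for every such initial law: (1) for all large enough $t$ and all $\eta>0$, $$\Pr(\tilde X_t\notin\chi_\eta)\le\Gamma_\gamma\Gamma_2(1+td)^{(m^\star b-1-b\eta)/2}+\Gamma_2(1+td)^{-b\eta};$$ (2) for every $\delta\in(0,1)$, with $$T^\star=\frac1d\left(\Big(\frac{2\Gamma_\gamma}{\delta}\Big)^{\frac{m^\star+\varepsilon}{\varepsilon}}-1\right)\ge0,$$ one has $\Pr(\tilde X_t\in\chi_\varepsilon)\ge1-\delta$ for all $t\ge T^\star$, and $$\mathbb E\big(N_{call}^{T^\star}\big)\le\frac1d\left(\frac{2\Gamma_\gamma}{\delta}\right)^{\frac{m^\star+\varepsilon}{\varepsilon}(3+2\gamma)}.$$ -/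

import Mathlib

open MeasureTheory ProbabilityTheory
open scoped ENNReal NNReal

noncomputable section

/-- The general setting of noisy simulated annealing on a finite search space `E`.

* `nbr x` is the set of neighbours of `x`, and `q` is the proposal law: a transition
  matrix which, from `x`, proposes exactly the neighbours of `x` (the point `x` itself may or may
  not count as one of its neighbours).  It is irreducible (the Green series
  `∑ n, q⁽ⁿ⁾(x, y)` diverges for all `x`, `y`) and `μ₀`-reversible.
* `noise x` is the law of the random input at `x`, and `U x ω` is the cost observed at `x` with
  input `ω`; it lies in `[0, M]` if `x` is in the feasible set `feasible`, and is infinite if not. -/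
structure NoisyProblem (E Ω : Type*) [Fintype E] [DecidableEq E] [MeasurableSpace Ω] where
  nbr : E → Set E
  q : Matrix E E ℝ
  q_nonneg : ∀ x y, 0 ≤ q x y
  q_sum : ∀ x, ∑ y, q x y = 1
  q_supp : ∀ x y, 0 < q x y → y ∈ nbr x
  q_pos : ∀ x y, y ∈ nbr x → y ≠ x → 0 < q x y
  q_irreducible : ∀ x y, ¬ Summable fun n : ℕ => (q ^ n) x y
  feasible : Set E
  μ₀ : E → ℝ
  μ₀_nonneg : ∀ x, 0 ≤ μ₀ x
  μ₀_sum : ∑ x, μ₀ x = 1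
  μ₀_pos : ∀ x ∈ feasible, 0 < μ₀ x
  q_reversible : ∀ x y, μ₀ x * q x y = μ₀ y * q y x
  noise : E → Measure Ω
  noise_prob : ∀ x, IsProbabilityMeasure (noise x)
  U : E → Ω → ℝ≥0∞
  U_meas : ∀ x, Measurable (U x)
  M : ℝ
  M_pos : 0 < M
  U_le : ∀ x ∈ feasible, ∀ ω, U x ω ≤ ENNReal.ofReal M
  U_top : ∀ x, x ∉ feasible → ∀ ω, U x ω = ⊤

/-- Inverse temperature `b log (1 + t d)` (nonnegative for `t, b, d ≥ 0`, the only relevant case). -/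
def invTemp (b d t : ℝ) : ℝ≥0 := Real.toNNReal (b * Real.log (1 + t * d))

/-- Sampling intensity `(1 + t d) ^ α` (nonnegative for `t, d ≥ 0`, the only relevant case). -/
def intensity (α d t : ℝ) : ℝ≥0 := Real.toNNReal ((1 + t * d) ^ α)

/-- Metropolis acceptance probability `exp (-β z)` for an estimated cost increase `z ≥ 0`,
with `exp (-∞) = 0`. -/
def metropolis (β : ℝ≥0) (z : ℝ≥0∞) : ℝ≥0∞ :=
  if z = ⊤ then 0 else ENNReal.ofReal (Real.exp (-((β : ℝ) * z.toReal)))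

theorem metropolis_le_one (β : ℝ≥0) (z : ℝ≥0∞) : metropolis β z ≤ 1 := by
  unfold metropolis
  split_ifs
  · exact zero_le_one
  · rw [ENNReal.ofReal_le_one, Real.exp_le_one_iff]
    have : 0 ≤ (β : ℝ) * z.toReal := mul_nonneg β.2 ENNReal.toReal_nonneg
    linarith

theorem measurable_metropolis : Measurable fun p : ℝ≥0 × ℝ≥0∞ => metropolis p.1 p.2 := by
  unfold metropolis
  refine Measurable.ite (measurableSet_eq_fun measurable_snd measurable_const) measurable_const ?_
  fun_prop

theorem measurable_invTemp (b d : ℝ) : Measurable (invTemp b d) := by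
  unfold invTemp
  fun_prop

theorem measurable_intensity (α d : ℝ) : Measurable (intensity α d) := by
  unfold intensity
  fun_prop

/-- The Poisson law as a Markov kernel in its parameter. -/
def poissonParamKernel : Kernel ℝ≥0 ℕ where
  toFun := poissonMeasure
  measurable' := by
    refine Measure.measurable_of_measurable_coe _ fun s hs => ?_
    simp only [poissonMeasure, Measure.sum_apply _ hs, Measure.smul_apply, smul_eq_mul]
    fun_prop

instance : IsMarkovKernel poissonParamKernel :=
  ⟨fun r => inferInstanceAs (IsProbabilityMeasure (poissonMeasure r))⟩

instance : IsProbabilityMeasure (expMeasure 1) := isProbabilityMeasure_expMeasure one_pos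

namespace NoisyProblem

variable {E Ω : Type*} [Fintype E] [DecidableEq E] [MeasurableSpace Ω]

attribute [instance] NoisyProblem.noise_prob

/-- The expected cost `J(x) = 𝔼 U(x, ω)`. -/
def J (P : NoisyProblem E Ω) (x : E) : ℝ≥0∞ := ∫⁻ ω, P.U x ω ∂(P.noise x)

/-- The `ε`-optimal points. -/
def optSet (P : NoisyProblem E Ω) (ε : ℝ) : Set E :=
  {x | P.J x ≤ (⨅ y, P.J y) + ENNReal.ofReal ε}

/-- `p` is a path `x = x₀, x₁, …, xₙ = y` with each `xᵢ₊₁` a neighbour of `xᵢ`. -/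
def IsPath (P : NoisyProblem E Ω) (x y : E) (p : List E) : Prop :=
  p.head? = some x ∧ p.getLast? = some y ∧ p.IsChain fun u v => v ∈ P.nbr u

/-- Elevation `H_{x,y}` of the cheapest path from `x` to `y`. -/
def elevation (P : NoisyProblem E Ω) (x y : E) : ℝ≥0∞ :=
  ⨅ (p : List E) (_ : P.IsPath x y p), ⨆ z ∈ p, P.J z

/-- `m⋆ = max_{x,y} (H_{x,y} - max (J x) (J y))`.  Pairs containing a point of infinite cost
contribute `∞ - ∞ = 0`, so only pairs of feasible points matter. -/
def mStar (P : NoisyProblem E Ω) : ℝ≥0∞ :=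
  ⨆ (x : E) (y : E), P.elevation x y - max (P.J x) (P.J y)

/-- Monte Carlo estimate of the cost at `x` from a sample of size `N`. -/
def estimate (P : NoisyProblem E Ω) (x : E) {N : ℕ} (w : Fin N → Ω) : ℝ≥0∞ :=
  (∑ i, P.U x (w i)) / (N : ℝ≥0∞)

/-- Probability that a proposed move from `x` to `y` is accepted when the inverse temperature is
`β` and both costs are estimated from independent samples of size `N`.  The truncated
subtraction of `ℝ≥0∞` is the positive part of the estimated increase. -/
def acceptProb (P : NoisyProblem E Ω) (x y : E) (β : ℝ≥0) (N : ℕ) : ℝ≥0∞ :=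
  ∫⁻ w : (Fin N → Ω) × (Fin N → Ω), metropolis β (P.estimate y w.2 - P.estimate x w.1)
    ∂((Measure.pi fun _ => P.noise x).prod (Measure.pi fun _ => P.noise y))

theorem acceptProb_le_one (P : NoisyProblem E Ω) (x y : E) (β : ℝ≥0) (N : ℕ) :
    P.acceptProb x y β N ≤ 1 := by
  refine (lintegral_mono fun w => metropolis_le_one _ _).trans ?_
  simp

theorem measurable_estimate (P : NoisyProblem E Ω) (x : E) (N : ℕ) :
    Measurable fun w : Fin N → Ω => P.estimate x w := by
  unfold estimate
  refine Measurable.div_const ?_ _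
  exact Finset.measurable_fun_sum _ fun i _ => (P.U_meas x).comp (measurable_pi_apply i)

theorem measurable_acceptProb (P : NoisyProblem E Ω) (x y : E) (N : ℕ) :
    Measurable fun β => P.acceptProb x y β N := by
  unfold acceptProb
  refine Measurable.lintegral_prod_right
    (f := fun β (w : (Fin N → Ω) × (Fin N → Ω)) =>
      metropolis β (P.estimate y w.2 - P.estimate x w.1)) ?_
  refine measurable_metropolis.comp (measurable_fst.prodMk ?_)
  exact ((P.measurable_estimate y N).comp (measurable_snd.comp measurable_snd)).sub
    ((P.measurable_estimate x N).comp (measurable_fst.comp measurable_snd))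

variable [MeasurableSpace E]

/-- Law of the next solution, from the current solution `x`: a candidate `y` is drawn from
`q x ·`; it is accepted with the above probability, and `x` is kept otherwise. -/
def moveLaw (P : NoisyProblem E Ω) (x : E) (β : ℝ≥0) (N : ℕ) : Measure E :=
  ∑ y, ENNReal.ofReal (P.q x y) •
    (P.acceptProb x y β N • Measure.dirac y + (1 - P.acceptProb x y β N) • Measure.dirac x)

instance isProbabilityMeasure_moveLaw (P : NoisyProblem E Ω) (x : E) (β : ℝ≥0) (N : ℕ) :
    IsProbabilityMeasure (P.moveLaw x β N) := by
  constructor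
  simp only [moveLaw, Measure.coe_finsetSum, Finset.sum_apply, Measure.smul_apply,
    Measure.add_apply, measure_univ, smul_eq_mul, mul_one]
  simp only [add_tsub_cancel_of_le (P.acceptProb_le_one x _ β N), mul_one]
  rw [← ENNReal.ofReal_sum_of_nonneg fun y _ => P.q_nonneg x y, P.q_sum, ENNReal.ofReal_one]

variable [DiscreteMeasurableSpace E]

/-- From (current solution, current time, last sample size): law of the next jump time, obtained
by adding an exponential variable of parameter `1`. -/
def timeKernel (E : Type*) [MeasurableSpace E] : Kernel (E × ℝ × ℕ) ℝ :=
  (Kernel.id ×ₖ Kernel.const (E × ℝ × ℕ) (expMeasure 1)).map fun p => p.1.2.1 + p.2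

instance : IsMarkovKernel (timeKernel E) := by
  unfold timeKernel
  exact Kernel.IsMarkovKernel.map _ (by fun_prop)

/-- Law of the sample size used at the jump time: `1` plus a Poisson variable whose parameter is
the intensity at that time. -/
def sizeKernel (E : Type*) [MeasurableSpace E] (α d : ℝ) : Kernel ((E × ℝ × ℕ) × ℝ) ℕ :=
  (poissonParamKernel.comap (fun p : (E × ℝ × ℕ) × ℝ => intensity α d p.2)
    ((measurable_intensity α d).comp measurable_snd)).map (· + 1)

instance (α d : ℝ) : IsMarkovKernel (sizeKernel E α d) := by
  unfold sizeKernel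
  exact Kernel.IsMarkovKernel.map _ (by fun_prop)

theorem measurable_moveLaw (P : NoisyProblem E Ω) (b d : ℝ) :
    Measurable fun p : (E × ℕ) × ℝ => P.moveLaw p.1.1 (invTemp b d p.2) p.1.2 := by
  refine measurable_from_prod_countable_right fun xN => ?_
  refine Measure.measurable_of_measurable_coe _ fun s _ => ?_
  simp only [moveLaw, Measure.coe_finsetSum, Finset.sum_apply, Measure.smul_apply,
    Measure.add_apply, smul_eq_mul]
  have h : ∀ y, Measurable fun t : ℝ => P.acceptProb xN.1 y (invTemp b d t) xN.2 := fun y =>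
    (P.measurable_acceptProb xN.1 y xN.2).comp (measurable_invTemp b d)
  refine Finset.measurable_fun_sum _ fun y _ => Measurable.const_mul ?_ _
  exact ((h y).mul_const _).add ((measurable_const.sub (h y)).mul_const _)

/-- Law of the next solution given the past, the jump time and the sample size. -/
def moveKernel (P : NoisyProblem E Ω) (b d : ℝ) : Kernel ((E × ℝ × ℕ) × ℝ × ℕ) E where
  toFun p := P.moveLaw p.1.1 (invTemp b d p.2.1) p.2.2
  measurable' := Measurable.comp
    (g := fun p : (E × ℕ) × ℝ => P.moveLaw p.1.1 (invTemp b d p.2) p.1.2)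
    (f := fun p : (E × ℝ × ℕ) × ℝ × ℕ => ((p.1.1, p.2.2), p.2.1))
    (P.measurable_moveLaw b d) (by fun_prop)

instance (P : NoisyProblem E Ω) (b d : ℝ) : IsMarkovKernel (P.moveKernel b d) :=
  ⟨fun p => P.isProbabilityMeasure_moveLaw p.1.1 (invTemp b d p.2.1) p.2.2⟩

/-- One step of the algorithm on triples (solution, jump time, sample size). -/
def stepKernel (P : NoisyProblem E Ω) (b α d : ℝ) : Kernel (E × ℝ × ℕ) (E × ℝ × ℕ) :=
  ((timeKernel E ⊗ₖ sizeKernel E α d) ⊗ₖ P.moveKernel b d).map fun p => (p.2, p.1.1, p.1.2)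

instance (P : NoisyProblem E Ω) (b α d : ℝ) : IsMarkovKernel (P.stepKernel b α d) := by
  unfold stepKernel
  exact Kernel.IsMarkovKernel.map _ (by fun_prop)

/-- Law of the sequence `(χₖ, Tₖ, Nₖ)ₖ` of solutions, jump times and sample sizes, when `χ₀` has
law `ν` and `T₀ = 0` (the entry `N₀ = 0` is a placeholder that is never used). -/
def law (P : NoisyProblem E Ω) (b α d : ℝ) (ν : Measure E) : Measure (ℕ → E × ℝ × ℕ) :=
  Kernel.trajMeasure (X := fun _ : ℕ => E × ℝ × ℕ) (ν.map fun x => (x, 0, 0)) fun n =>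
    (P.stepKernel b α d).comap
      (fun h : (i : Finset.Iic n) → E × ℝ × ℕ => h ⟨n, Finset.mem_Iic.2 le_rfl⟩)
      (measurable_pi_apply _)

end NoisyProblem

/-- The continuous-time process: `χₖ` on `[Tₖ, Tₖ₊₁)`.  (Almost surely the jump times increase to
infinity, so that for `t ≥ 0` the supremum is the unique such `k`.) -/
def nsaProcess {E : Type*} (t : ℝ) (h : ℕ → E × ℝ × ℕ) : E := (h (sSup {k | (h k).2.1 ≤ t})).1

/-- Number of cost evaluations until time `T`, counted by sample sizes: the sum of `N_k` over
`k ≥ 1` with `T_k < T`. -/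
def nCall {E : Type*} (T : ℝ) (h : ℕ → E × ℝ × ℕ) : ℝ≥0∞ :=
  ∑' k : ℕ, if (h (k + 1)).2.1 < T then ((h (k + 1)).2.2 : ℝ≥0∞) else 0

end

/-! Because the waiting times are exponential of rate one, the law of the process solves a linear
ODE, the master equation of a Metropolis chain on the feasible set whose acceptance probabilities
are averaged over the noise and the sample size. The proof follows the quantity `chiSq`, the sum of
`p² / π` for the current law `p` and the Gibbs law `π` at the current temperature.

Three effects drive it. The noiseless chain is reversible for `π`. Joining each pair of points by a
path of elevation at most `m + max (J x) (J y)` gives a Poincaré inequality with constant of order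
`exp (-(β m)) = (1 + t d) ^ (-(m b))` (`exists_poincare`). Cooling moves `π` at speed `β' = b d / (1
+ t d)`. Noise changes each acceptance probability by a relative error only: Hoeffding's lemma and a
Poisson computation bound it by a multiple of `β / √n`, which `α = 2 (1 + γ)` makes `O(1 / (1 + t
d))` (`exists_abs_acceptAt_sub_le`).

So `u = chiSq - 1` satisfies `u' ≤ -c (1 + t d) ^ (-(m b)) u + C / (1 + t d) (u + 1)`. As `m b < 1`,
contraction wins and `u` is eventually at most `A (1 + t d) ^ (m b - 1)`
(`exists_chiSq_sub_one_le`). By Cauchy–Schwarz a set of Gibbs mass at most `w` has probability at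
most `w + √(w u)`. The points that are not `η`-optimal have Gibbs mass `O((1 + t d) ^ (-(b η)))`,
which yields the two terms of the bound.

The ODE comes from a renewal argument. For rate one, the density and the survival function of the
waiting time coincide, so the probability of being at `x` at time `s` is also the rate of jumps from
`x`; this gives the integral equation `occTotal_eq`. The same coincidence computes the expected
number of evaluations as an integral of `n_s + 1`. -/

noncomputable section

/-! ### Dirichlet form and Poincaré inequality of the Metropolis chain. -/

section Metropolis

variable {E : Type*}

/-- Unnormalised Gibbs weight. -/
def gibbs (μ j : E → ℝ) (β : ℝ) (x : E) : ℝ := μ x * Real.exp (-(β * j x))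

/-- Conductance of the Metropolis chain for the unnormalised Gibbs weight. -/
def conductance (μ j : E → ℝ) (q : E → E → ℝ) (β : ℝ) (x y : E) : ℝ :=
  μ x * q x y * Real.exp (-(β * max (j x) (j y)))

/-- Dirichlet form of the Metropolis chain on `F` (not halved). -/
def dirichlet (F : Finset E) (μ j : E → ℝ) (q : E → E → ℝ) (β : ℝ) (f : E → ℝ) : ℝ :=
  ∑ x ∈ F, ∑ y ∈ F, conductance μ j q β x y * (f x - f y) ^ 2

/-- A proposal step inside `F` that stays below level `H`. -/
def StepBelow (F : Finset E) (j : E → ℝ) (q : E → E → ℝ) (H : ℝ) (u v : E) : Prop :=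
  u ∈ F ∧ v ∈ F ∧ 0 < q u v ∧ j u ≤ H ∧ j v ≤ H

variable {F : Finset E} {μ j : E → ℝ} {q : E → E → ℝ}

theorem conductance_nonneg (hμ : ∀ x ∈ F, 0 < μ x) (hq : ∀ x y, 0 ≤ q x y) {β : ℝ} {x y : E}
    (hx : x ∈ F) : 0 ≤ conductance μ j q β x y :=
  mul_nonneg (mul_nonneg (hμ x hx).le (hq x y)) (Real.exp_pos _).le

theorem conductance_comm (hrev : ∀ x y, μ x * q x y = μ y * q y x) (β : ℝ) (x y : E) :
    conductance μ j q β x y = conductance μ j q β y x := by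
  unfold conductance
  rw [hrev, max_comm]

/-- Gibbs weight times Metropolis rate; as the conductance is symmetric, this is detailed balance.
-/
theorem conductance_eq_gibbs_mul (β : ℝ) (x y : E) :
    conductance μ j q β x y
      = gibbs μ j β x * (q x y * Real.exp (-(β * max (j y - j x) 0))) := by
  have h : max (j x) (j y) = j x + max (j y - j x) 0 := by
    rw [max_comm (j y - j x) 0, ← max_add_add_left]; simp
  unfold conductance gibbs
  rw [h, mul_add, neg_add, Real.exp_add]
  ring

theorem dirichlet_nonneg (hμ : ∀ x ∈ F, 0 < μ x) (hq : ∀ x y, 0 ≤ q x y) (β : ℝ) (f : E → ℝ) :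
    0 ≤ dirichlet F μ j q β f :=
  Finset.sum_nonneg fun _ hx => Finset.sum_nonneg fun _ _ =>
    mul_nonneg (conductance_nonneg hμ hq hx) (sq_nonneg _)

/-- The edge `(u, v)` is a single term of the Dirichlet form, and below level `H` its conductance is
at least `μ u * q u v * exp (-β H)`. -/
theorem sq_sub_le_dirichlet_of_stepBelow (hμ : ∀ x ∈ F, 0 < μ x) (hq : ∀ x y, 0 ≤ q x y) {H : ℝ}
    {u v : E} (h : StepBelow F j q H u v) {β : ℝ} (hβ : 0 ≤ β) (f : E → ℝ) :
    (f u - f v) ^ 2 ≤ (μ u * q u v)⁻¹ * (Real.exp (β * H) * dirichlet F μ j q β f) := by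
  obtain ⟨hu, hv, hquv, hju, hjv⟩ := h
  have hpos : 0 < μ u * q u v := mul_pos (hμ u hu) hquv
  have h1 : conductance μ j q β u v * (f u - f v) ^ 2 ≤ dirichlet F μ j q β f := by
    have h2 : conductance μ j q β u v * (f u - f v) ^ 2
        ≤ ∑ y ∈ F, conductance μ j q β u y * (f u - f y) ^ 2 :=
      Finset.single_le_sum (f := fun y => conductance μ j q β u y * (f u - f y) ^ 2)
        (fun y _ => mul_nonneg (conductance_nonneg hμ hq hu) (sq_nonneg _)) hv
    exact h2.trans (Finset.single_le_sum
      (f := fun x => ∑ y ∈ F, conductance μ j q β x y * (f x - f y) ^ 2)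
      (fun x hx => Finset.sum_nonneg fun y _ =>
        mul_nonneg (conductance_nonneg hμ hq hx) (sq_nonneg _)) hu)
  have h3 : 1 ≤ Real.exp (β * H) * Real.exp (-(β * max (j u) (j v))) := by
    rw [← Real.exp_add, Real.one_le_exp_iff]
    have := mul_le_mul_of_nonneg_left (max_le hju hjv) hβ
    linarith
  rw [inv_mul_eq_div, le_div_iff₀ hpos]
  calc (f u - f v) ^ 2 * (μ u * q u v)
      ≤ (f u - f v) ^ 2 * (μ u * q u v) *
          (Real.exp (β * H) * Real.exp (-(β * max (j u) (j v)))) :=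
        le_mul_of_one_le_right (by positivity) h3
    _ = Real.exp (β * H) * (conductance μ j q β u v * (f u - f v) ^ 2) := by
        unfold conductance; ring
    _ ≤ _ := mul_le_mul_of_nonneg_left h1 (Real.exp_pos _).le

theorem exists_sq_sub_le_dirichlet (hμ : ∀ x ∈ F, 0 < μ x) (hq : ∀ x y, 0 ≤ q x y) {H : ℝ}
    {x y : E} (h : Relation.ReflTransGen (StepBelow F j q H) x y) :
    ∃ C : ℝ, 0 ≤ C ∧ ∀ β : ℝ, 0 ≤ β → ∀ f : E → ℝ,
      (f x - f y) ^ 2 ≤ C * (Real.exp (β * H) * dirichlet F μ j q β f) := by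
  induction h with
  | refl =>
    refine ⟨0, le_rfl, fun β _ f => by simp⟩
  | @tail u v _ huv ih =>
    obtain ⟨C, hC, ih⟩ := ih
    have hpos : 0 < μ u * q u v := mul_pos (hμ u huv.1) huv.2.2.1
    -- The constant comes from `(a + b)² ≤ 2 a² + 2 b²`; it depends on the path alone, not on `β` or
    -- `f`.
    refine ⟨2 * C + 2 * (μ u * q u v)⁻¹, by positivity, fun β hβ f => ?_⟩
    have h1 := ih β hβ f
    have h2 := sq_sub_le_dirichlet_of_stepBelow hμ hq huv hβ f
    nlinarith [sq_nonneg ((f x - f u) - (f u - f v))]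

theorem gibbs_pos (hμ : ∀ x ∈ F, 0 < μ x) {x : E} (hx : x ∈ F) (β : ℝ) : 0 < gibbs μ j β x :=
  mul_pos (hμ x hx) (Real.exp_pos _)

/-- The factor `exp (β max)` cancels the exponential of the point of higher cost. Only one Gibbs
weight survives, at most the partition function, so a pair costs `exp (β m)` and no more. -/
theorem gibbs_mul_gibbs_mul_exp_le (hμ : ∀ x ∈ F, 0 < μ x) {x y : E} (hx : x ∈ F) (hy : y ∈ F)
    (m β : ℝ) :
    gibbs μ j β x * gibbs μ j β y * Real.exp (β * (m + max (j x) (j y)))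
      ≤ (∑ z ∈ F, μ z) * Real.exp (β * m) * ∑ z ∈ F, gibbs μ j β z := by
  have key : ∀ u ∈ F, ∀ v ∈ F,
      gibbs μ j β u * gibbs μ j β v * Real.exp (β * (m + j v))
        ≤ (∑ z ∈ F, μ z) * Real.exp (β * m) * ∑ z ∈ F, gibbs μ j β z := by
    intro u hu v hv
    have h1 : gibbs μ j β u * gibbs μ j β v * Real.exp (β * (m + j v))
        = μ v * Real.exp (β * m) * gibbs μ j β u := by
      unfold gibbs
      rw [mul_add, Real.exp_add]
      have : Real.exp (-(β * j v)) * Real.exp (β * j v) = 1 := by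
        rw [← Real.exp_add]; simp
      linear_combination μ u * Real.exp (-(β * j u)) * μ v * Real.exp (β * m) * this
    rw [h1]
    have h2 : μ v ≤ ∑ z ∈ F, μ z := Finset.single_le_sum (fun z hz => (hμ z hz).le) hv
    have h3 : gibbs μ j β u ≤ ∑ z ∈ F, gibbs μ j β z :=
      Finset.single_le_sum (f := gibbs μ j β) (fun z hz => (gibbs_pos hμ hz β).le) hu
    have h4 := (gibbs_pos (j := j) hμ hu β).le
    have h5 := (hμ v hv).le.trans h2
    gcongr
  rcases le_total (j x) (j y) with h | h
  · rw [max_eq_right h]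
    exact key x hx y hy
  · rw [max_eq_left h, mul_comm (gibbs μ j β x)]
    exact key y hy x hx

/-- The variance as a double sum over pairs, which lets the Poincaré inequality be proved pair by
pair. -/
theorem sum_mul_sum_sq_sub_sq_sum (F : Finset E) (w f : E → ℝ) :
    (∑ x ∈ F, w x) * ∑ x ∈ F, w x * f x ^ 2 - (∑ x ∈ F, w x * f x) ^ 2
      = (∑ x ∈ F, ∑ y ∈ F, w x * w y * (f x - f y) ^ 2) / 2 := by
  have h : ∑ x ∈ F, ∑ y ∈ F, w x * w y * (f x - f y) ^ 2
      = ∑ x ∈ F, ∑ y ∈ F, (w x * (w y * f y ^ 2) + (w x * f x ^ 2) * w y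
        - 2 * ((w x * f x) * (w y * f y))) :=
    Finset.sum_congr rfl fun x _ => Finset.sum_congr rfl fun y _ => by ring
  rw [h]
  simp only [Finset.sum_add_distrib, Finset.sum_sub_distrib, ← Finset.mul_sum, ← Finset.sum_mul]
  ring

/-- Poincaré inequality for the Metropolis chain at low temperature. -/
theorem exists_poincare (hμ : ∀ x ∈ F, 0 < μ x) (hq : ∀ x y, 0 ≤ q x y) (m : ℝ)
    (hconn : ∀ x ∈ F, ∀ y ∈ F,
      Relation.ReflTransGen (StepBelow F j q (m + max (j x) (j y))) x y) :
    ∃ c : ℝ, 0 < c ∧ ∀ β : ℝ, 0 ≤ β → ∀ f : E → ℝ,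
      c * Real.exp (-(β * m)) * ((∑ x ∈ F, gibbs μ j β x) * ∑ x ∈ F, gibbs μ j β x * f x ^ 2
        - (∑ x ∈ F, gibbs μ j β x * f x) ^ 2)
      ≤ (∑ x ∈ F, gibbs μ j β x) * dirichlet F μ j q β f := by
  have hC : ∀ x y : E, ∃ C : ℝ, 0 ≤ C ∧ (x ∈ F → y ∈ F → ∀ β : ℝ, 0 ≤ β → ∀ f : E → ℝ,
      (f x - f y) ^ 2 ≤ C * (Real.exp (β * (m + max (j x) (j y))) * dirichlet F μ j q β f)) := by
    intro x y
    by_cases hx : x ∈ F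
    · by_cases hy : y ∈ F
      · obtain ⟨C, hC, h⟩ := exists_sq_sub_le_dirichlet hμ hq (hconn x hx y hy)
        exact ⟨C, hC, fun _ _ => h⟩
      · exact ⟨0, le_rfl, fun _ h => absurd h hy⟩
    · exact ⟨0, le_rfl, fun h => absurd h hx⟩
  choose C hC0 hC using hC
  set S := ∑ x ∈ F, ∑ y ∈ F, C x y with hS
  have hS0 : 0 ≤ S := Finset.sum_nonneg fun x _ => Finset.sum_nonneg fun y _ => hC0 x y
  have hμs : 0 ≤ ∑ z ∈ F, μ z := Finset.sum_nonneg fun z hz => (hμ z hz).le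
  -- The added `1` keeps the constant positive even when `S` vanishes, for instance when `F` is a
  -- single point.
  refine ⟨(1 + S * ∑ z ∈ F, μ z)⁻¹, by positivity, fun β hβ f => ?_⟩
  set Z := ∑ x ∈ F, gibbs μ j β x
  set D := dirichlet F μ j q β f
  have hD : 0 ≤ D := dirichlet_nonneg hμ hq β f
  have hZ : 0 ≤ Z := Finset.sum_nonneg fun x hx => (gibbs_pos hμ hx β).le
  have hpair : ∀ x ∈ F, ∀ y ∈ F, gibbs μ j β x * gibbs μ j β y * (f x - f y) ^ 2
      ≤ C x y * ((∑ z ∈ F, μ z) * Real.exp (β * m) * Z * D) := by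
    intro x hx y hy
    have h1 := hC x y hx hy β hβ f
    have h2 := gibbs_mul_gibbs_mul_exp_le (j := j) hμ hx hy m β
    have h3 := (gibbs_pos (j := j) hμ hx β).le
    have h4 := (gibbs_pos (j := j) hμ hy β).le
    calc gibbs μ j β x * gibbs μ j β y * (f x - f y) ^ 2
        ≤ gibbs μ j β x * gibbs μ j β y *
            (C x y * (Real.exp (β * (m + max (j x) (j y))) * D)) := by gcongr
      _ = C x y * (gibbs μ j β x * gibbs μ j β y * Real.exp (β * (m + max (j x) (j y))) * D) := by
          ring
      _ ≤ _ := by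
          have := hC0 x y
          gcongr
  have hsum : ∑ x ∈ F, ∑ y ∈ F, gibbs μ j β x * gibbs μ j β y * (f x - f y) ^ 2
      ≤ S * ((∑ z ∈ F, μ z) * Real.exp (β * m) * Z * D) := by
    rw [hS, Finset.sum_mul]
    refine Finset.sum_le_sum fun x hx => ?_
    rw [Finset.sum_mul]
    exact Finset.sum_le_sum fun y hy => hpair x hx y hy
  rw [sum_mul_sum_sq_sub_sq_sum, mul_assoc, inv_mul_eq_div, div_le_iff₀ (by positivity),
    Real.exp_neg, inv_mul_eq_div, div_le_iff₀ (Real.exp_pos _)]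
  have h1 : 0 ≤ Z * D := mul_nonneg hZ hD
  have h2 : 0 ≤ S * (∑ z ∈ F, μ z) * Real.exp (β * m) * (Z * D) := by positivity
  have h3 : 0 ≤ Z * D * Real.exp (β * m) := by positivity
  linarith [hsum]

/-- The generator of a perturbed Metropolis chain is dissipative up to the relative error. -/
theorem two_mul_sum_generator_le (hμ : ∀ x ∈ F, 0 < μ x) (hq : ∀ x y, 0 ≤ q x y)
    (hrev : ∀ x y, μ x * q x y = μ y * q y x) (hq1 : ∀ x ∈ F, ∑ y ∈ F, q x y ≤ 1)
    {β r : ℝ} (hβ : 0 ≤ β) (hr : 0 ≤ r) {a : E → E → ℝ}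
    (ha : ∀ x ∈ F, ∀ y ∈ F, |a x y - Real.exp (-(β * max (j y - j x) 0))|
      ≤ r * Real.exp (-(β * max (j y - j x) 0))) (f : E → ℝ) :
    2 * ∑ x ∈ F, ∑ y ∈ F, gibbs μ j β x * f x * (q x y * a x y) * (f y - f x)
      ≤ -dirichlet F μ j q β f + 4 * r * ∑ x ∈ F, gibbs μ j β x * f x ^ 2 := by
  set c := conductance μ j q β with hc
  have hterm : ∀ x ∈ F, ∀ y ∈ F, 2 * (gibbs μ j β x * f x * (q x y * a x y) * (f y - f x))
      ≤ 2 * (c x y * f x * (f y - f x)) + r * (c x y * (3 * f x ^ 2 + f y ^ 2)) := by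
    intro x hx y hy
    set e := Real.exp (-(β * max (j y - j x) 0))
    have hg := (gibbs_pos (j := j) hμ hx β).le
    have h1 : 2 * (gibbs μ j β x * f x * (q x y * a x y) * (f y - f x))
        = 2 * (c x y * f x * (f y - f x))
          + gibbs μ j β x * q x y * ((a x y - e) * (2 * (f x * (f y - f x)))) := by
      rw [hc, conductance_eq_gibbs_mul β]; ring
    -- Here `2 |f x (f y - f x)| ≤ 3 f x² + f y²`; once the symmetric conductance has exchanged `x`
    -- and `y`, this produces the factor `4 = 3 + 1`.
    have h2 : (a x y - e) * (2 * (f x * (f y - f x))) ≤ r * e * (3 * f x ^ 2 + f y ^ 2) := by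
      refine (le_abs_self _).trans ?_
      rw [abs_mul]
      refine mul_le_mul (ha x hx y hy) ?_ (abs_nonneg _) (mul_nonneg hr (Real.exp_pos _).le)
      rw [abs_le]
      constructor <;> nlinarith [sq_nonneg (f x + f y), sq_nonneg (f x - f y)]
    have h3 := mul_le_mul_of_nonneg_left h2 (mul_nonneg hg (hq x y))
    have h4 : r * (c x y * (3 * f x ^ 2 + f y ^ 2))
        = gibbs μ j β x * q x y * (r * e * (3 * f x ^ 2 + f y ^ 2)) := by
      rw [hc, conductance_eq_gibbs_mul β]; ring
    linarith
  have hswap : ∀ g : E → ℝ, ∑ x ∈ F, ∑ y ∈ F, c x y * g y = ∑ x ∈ F, ∑ y ∈ F, c x y * g x := by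
    intro g
    rw [Finset.sum_comm]
    exact Finset.sum_congr rfl fun x _ => Finset.sum_congr rfl fun y _ => by
      rw [hc, conductance_comm hrev]
  have hsq : ∑ x ∈ F, ∑ y ∈ F, c x y * f x ^ 2 ≤ ∑ x ∈ F, gibbs μ j β x * f x ^ 2 := by
    refine Finset.sum_le_sum fun x hx => ?_
    rw [← Finset.sum_mul]
    refine mul_le_mul_of_nonneg_right ?_ (sq_nonneg _)
    have hg := (gibbs_pos (j := j) hμ hx β).le
    calc ∑ y ∈ F, c x y ≤ ∑ y ∈ F, gibbs μ j β x * q x y := by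
          refine Finset.sum_le_sum fun y _ => ?_
          rw [hc, conductance_eq_gibbs_mul β]
          refine mul_le_mul_of_nonneg_left (mul_le_of_le_one_right (hq x y) ?_) hg
          rw [Real.exp_le_one_iff]
          have : 0 ≤ β * max (j y - j x) 0 := mul_nonneg hβ (le_max_right _ _)
          linarith
      _ ≤ gibbs μ j β x := by
          rw [← Finset.mul_sum]
          exact mul_le_of_le_one_right hg (hq1 x hx)
  have h1 : ∑ x ∈ F, ∑ y ∈ F, 2 * (c x y * f x * (f y - f x)) = -dirichlet F μ j q β f := by
    have h2 : ∑ x ∈ F, ∑ y ∈ F, 2 * (c x y * f x * (f y - f x))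
        = -dirichlet F μ j q β f
          + (∑ x ∈ F, ∑ y ∈ F, c x y * f y ^ 2 - ∑ x ∈ F, ∑ y ∈ F, c x y * f x ^ 2) := by
      unfold dirichlet
      simp only [← Finset.sum_neg_distrib, ← Finset.sum_sub_distrib, ← Finset.sum_add_distrib]
      exact Finset.sum_congr rfl fun x _ => Finset.sum_congr rfl fun y _ => by rw [hc]; ring
    rw [h2, hswap fun y => f y ^ 2]
    ring
  have h2 : ∑ x ∈ F, ∑ y ∈ F, r * (c x y * (3 * f x ^ 2 + f y ^ 2))
      = 4 * r * ∑ x ∈ F, ∑ y ∈ F, c x y * f x ^ 2 := by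
    have h3 : ∑ x ∈ F, ∑ y ∈ F, r * (c x y * (3 * f x ^ 2 + f y ^ 2))
        = 3 * r * (∑ x ∈ F, ∑ y ∈ F, c x y * f x ^ 2)
          + r * ∑ x ∈ F, ∑ y ∈ F, c x y * f y ^ 2 := by
      simp only [Finset.mul_sum, ← Finset.sum_add_distrib]
      exact Finset.sum_congr rfl fun x _ => Finset.sum_congr rfl fun y _ => by ring
    rw [h3, hswap fun y => f y ^ 2]
    ring
  calc 2 * ∑ x ∈ F, ∑ y ∈ F, gibbs μ j β x * f x * (q x y * a x y) * (f y - f x)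
      = ∑ x ∈ F, ∑ y ∈ F, 2 * (gibbs μ j β x * f x * (q x y * a x y) * (f y - f x)) := by
        simp only [Finset.mul_sum]
    _ ≤ ∑ x ∈ F, ∑ y ∈ F, (2 * (c x y * f x * (f y - f x))
          + r * (c x y * (3 * f x ^ 2 + f y ^ 2))) :=
        Finset.sum_le_sum fun x hx => Finset.sum_le_sum fun y hy => hterm x hx y hy
    _ = -dirichlet F μ j q β f + 4 * r * ∑ x ∈ F, ∑ y ∈ F, c x y * f x ^ 2 := by
        simp only [Finset.sum_add_distrib]
        rw [h1, h2]
    _ ≤ _ := by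
        have : 0 ≤ 4 * r := by positivity
        linarith [mul_le_mul_of_nonneg_left hsq this]

end Metropolis

/-! ### Evolution of the chi-square functional under the master equation. -/

section ChiSq

variable {E : Type*} {F : Finset E} {μ j : E → ℝ} {q : E → E → ℝ}

/-- `∑ p² / π` for the normalised Gibbs law `π` at inverse temperature `β`. -/
def chiSq (F : Finset E) (μ j : E → ℝ) (β : ℝ) (p : E → ℝ) : ℝ :=
  (∑ x ∈ F, gibbs μ j β x) * ∑ x ∈ F, p x ^ 2 / gibbs μ j β x

theorem sum_gibbs_pos (hF : F.Nonempty) (hμ : ∀ x ∈ F, 0 < μ x) (β : ℝ) :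
    0 < ∑ x ∈ F, gibbs μ j β x :=
  Finset.sum_pos (fun _ hx => gibbs_pos hμ hx β) hF

/-- Duality between the forward (master) operator acting on `p` and the generator acting on `f`. -/
theorem sum_mul_master (F : Finset E) (p f : E → ℝ) (G : E → E → ℝ) :
    ∑ x ∈ F, f x * ∑ y ∈ F, (p y * G y x - p x * G x y)
      = ∑ x ∈ F, ∑ y ∈ F, p x * G x y * (f y - f x) := by
  have h : ∑ x ∈ F, ∑ y ∈ F, p x * G x y * f y = ∑ x ∈ F, ∑ y ∈ F, p y * G y x * f x :=
    Finset.sum_comm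
  simp only [mul_sub, Finset.sum_sub_distrib, h, Finset.mul_sum]
  congr 1 <;> exact Finset.sum_congr rfl fun x _ => Finset.sum_congr rfl fun y _ => by ring

/-- At fixed temperature, take `f` to be the density of `p` with respect to the Gibbs law. By
duality the rate of change of `chiSq` becomes twice the generator tested on `f`; its Dirichlet part
is controlled by the Poincaré inequality, the perturbation by `r`. -/
theorem chiSq_dissipation (hF : F.Nonempty) (hμ : ∀ x ∈ F, 0 < μ x) (hq : ∀ x y, 0 ≤ q x y)
    (hrev : ∀ x y, μ x * q x y = μ y * q y x) (hq1 : ∀ x ∈ F, ∑ y ∈ F, q x y ≤ 1)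
    {β r κ : ℝ} (hβ : 0 ≤ β) (hr : 0 ≤ r) {a : E → E → ℝ}
    (ha : ∀ x ∈ F, ∀ y ∈ F, |a x y - Real.exp (-(β * max (j y - j x) 0))|
      ≤ r * Real.exp (-(β * max (j y - j x) 0)))
    (hpoinc : ∀ f : E → ℝ, κ * ((∑ x ∈ F, gibbs μ j β x) * ∑ x ∈ F, gibbs μ j β x * f x ^ 2
        - (∑ x ∈ F, gibbs μ j β x * f x) ^ 2)
      ≤ (∑ x ∈ F, gibbs μ j β x) * dirichlet F μ j q β f)
    {p : E → ℝ} (hp1 : ∑ x ∈ F, p x = 1) :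
    (∑ x ∈ F, gibbs μ j β x) * ∑ x ∈ F, 2 * p x *
        (∑ y ∈ F, (p y * (q y x * a y x) - p x * (q x y * a x y))) / gibbs μ j β x
      ≤ -κ * (chiSq F μ j β p - 1) + 4 * r * chiSq F μ j β p := by
  set Z := ∑ x ∈ F, gibbs μ j β x with hZdef
  have hZ : 0 < Z := sum_gibbs_pos hF hμ β
  set f : E → ℝ := fun x => Z * p x / gibbs μ j β x with hf
  have hgf : ∀ x ∈ F, gibbs μ j β x * f x = Z * p x := fun x hx => by
    have := (gibbs_pos (j := j) hμ hx β).ne'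
    simp only [hf]; field_simp
  have h1 : ∑ x ∈ F, gibbs μ j β x * f x = Z := by
    rw [Finset.sum_congr rfl hgf, ← Finset.mul_sum, hp1, mul_one]
  have h2 : ∑ x ∈ F, gibbs μ j β x * f x ^ 2 = Z * chiSq F μ j β p := by
    unfold chiSq
    rw [← hZdef, ← mul_assoc, Finset.mul_sum]
    refine Finset.sum_congr rfl fun x hx => ?_
    have := (gibbs_pos (j := j) hμ hx β).ne'
    simp only [hf]; field_simp
  have h3 : Z * (Z * ∑ x ∈ F, 2 * p x *
        (∑ y ∈ F, (p y * (q y x * a y x) - p x * (q x y * a x y))) / gibbs μ j β x)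
      = 2 * ∑ x ∈ F, ∑ y ∈ F, gibbs μ j β x * f x * (q x y * a x y) * (f y - f x) := by
    have h4 : ∑ x ∈ F, ∑ y ∈ F, gibbs μ j β x * f x * (q x y * a x y) * (f y - f x)
        = Z * ∑ x ∈ F, ∑ y ∈ F, p x * (q x y * a x y) * (f y - f x) := by
      rw [Finset.mul_sum]
      refine Finset.sum_congr rfl fun x hx => ?_
      rw [Finset.mul_sum]
      exact Finset.sum_congr rfl fun y _ => by rw [hgf x hx]; ring
    rw [h4, ← sum_mul_master F p f fun x y => q x y * a x y, Finset.mul_sum, mul_left_comm]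
    congr 1
    rw [Finset.mul_sum]
    exact Finset.sum_congr rfl fun x _ => by simp only [hf]; ring
  have h5 := two_mul_sum_generator_le hμ hq hrev hq1 hβ hr ha f
  have h6 := hpoinc f
  rw [h1, h2] at h6
  rw [h2, ← h3] at h5
  have h7 : κ * Z * (chiSq F μ j β p - 1) ≤ dirichlet F μ j q β f := by
    refine le_of_mul_le_mul_left ?_ hZ
    calc _ = κ * (Z * (Z * chiSq F μ j β p) - Z ^ 2) := by ring
      _ ≤ _ := h6
  refine le_of_mul_le_mul_left ?_ hZ
  linarith

theorem hasDerivAt_invTemp {b d t : ℝ} (h : 0 < 1 + t * d) :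
    HasDerivAt (fun t => b * Real.log (1 + t * d)) (b * d / (1 + t * d)) t := by
  have h1 : HasDerivAt (fun t : ℝ => 1 + t * d) d t := by
    simpa using ((hasDerivAt_id t).mul_const d).const_add 1
  simpa [mul_div_assoc] using (h1.log h.ne').const_mul b

/-- The product rule separates the dynamics (`p'`) from cooling, which acts once through the
partition function and once through the weights in the denominators. -/
theorem hasDerivAt_chiSq (hμ : ∀ x ∈ F, 0 < μ x) {β : ℝ → ℝ} {β' t : ℝ}
    (hβ : HasDerivAt β β' t) {p : ℝ → E → ℝ} {p' : E → ℝ}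
    (hp : ∀ x ∈ F, HasDerivAt (fun t => p t x) (p' x) t) :
    HasDerivAt (fun t => chiSq F μ j (β t) (p t))
      (-(β' * ∑ x ∈ F, j x * gibbs μ j (β t) x) * (∑ x ∈ F, p t x ^ 2 / gibbs μ j (β t) x)
        + (∑ x ∈ F, gibbs μ j (β t) x) * (∑ x ∈ F, 2 * p t x * p' x / gibbs μ j (β t) x
          + β' * ∑ x ∈ F, j x * (p t x ^ 2 / gibbs μ j (β t) x))) t := by
  unfold chiSq
  have hg : ∀ x, HasDerivAt (fun t => gibbs μ j (β t) x) (-(β' * (j x * gibbs μ j (β t) x))) t := by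
    intro x
    have := (((hβ.mul_const (j x)).neg).exp).const_mul (μ x)
    refine this.congr_deriv ?_
    simp only [gibbs, Pi.neg_apply]; ring
  have h1 : HasDerivAt (fun t => ∑ x ∈ F, gibbs μ j (β t) x)
      (-(β' * ∑ x ∈ F, j x * gibbs μ j (β t) x)) t := by
    refine (HasDerivAt.fun_sum fun x _ => hg x).congr_deriv ?_
    rw [Finset.mul_sum, Finset.sum_neg_distrib]
  have h2 : HasDerivAt (fun t => ∑ x ∈ F, p t x ^ 2 / gibbs μ j (β t) x)
      (∑ x ∈ F, 2 * p t x * p' x / gibbs μ j (β t) x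
          + β' * ∑ x ∈ F, j x * (p t x ^ 2 / gibbs μ j (β t) x)) t := by
    rw [Finset.mul_sum, ← Finset.sum_add_distrib]
    refine HasDerivAt.fun_sum fun x hx => ?_
    have hgx := (gibbs_pos (j := j) hμ hx (β t)).ne'
    refine (((hp x hx).fun_pow 2).fun_div (hg x) hgx).congr_deriv ?_
    field_simp
    ring
  exact h1.fun_mul h2

/-- A barrier argument: `A (1 + t d) ^ (s - 1)` is a strict supersolution. Contraction at rate `(1 +
t d) ^ (-s)` against a source of size `1 / (1 + t d)` balances exactly at this power. -/
theorem le_mul_rpow_of_deriv_le {c C d s A t₂ : ℝ} {u u' : ℝ → ℝ} (hd : 0 < d) (ht₂ : 0 ≤ t₂)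
    (hA : 0 < A)
    (hu : ∀ t ≥ t₂, HasDerivAt u (u' t) t)
    (hu' : ∀ t ≥ t₂, u' t ≤ -(c * (1 + t * d) ^ (-s)) * u t + C / (1 + t * d) * (u t + 1))
    (hinit : u t₂ ≤ A * (1 + t₂ * d) ^ (s - 1))
    (hbig : ∀ t ≥ t₂, (C + (1 - s) * d) * (1 + t * d) ^ (s - 1) ≤ c / 2)
    (hAc : 2 * C < A * c) :
    ∀ t ≥ t₂, u t ≤ A * (1 + t * d) ^ (s - 1) := by
  intro T hT
  have hpos : ∀ t ≥ t₂, 0 < 1 + t * d := fun t ht => by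
    have := mul_nonneg (ht₂.trans ht) hd.le
    linarith
  have hB : ∀ t ≥ t₂, HasDerivAt (fun t => A * (1 + t * d) ^ (s - 1))
      (A * (d * (s - 1) * (1 + t * d) ^ (s - 1 - 1))) t := by
    intro t ht
    have h1 : HasDerivAt (fun t : ℝ => 1 + t * d) d t := by
      simpa using ((hasDerivAt_id t).mul_const d).const_add 1
    exact (h1.rpow_const (Or.inl (hpos t ht).ne')).const_mul A
  refine image_le_of_deriv_right_lt_deriv_boundary' (f := u) (f' := u')
    (B := fun t => A * (1 + t * d) ^ (s - 1)) (a := t₂) (b := T)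
    (fun t ht => (hu t ht.1).continuousAt.continuousWithinAt)
    (fun t ht => (hu t ht.1).hasDerivWithinAt) hinit
    (fun t ht => (hB t ht.1).continuousAt.continuousWithinAt)
    (fun t ht => (hB t ht.1).hasDerivWithinAt) ?_ ⟨hT, le_rfl⟩
  -- At a contact point every term carries the factor `1 / x`. Half of `c * A` pays for the terms in
  -- `y` (`hbig`), the other half for the source `C` (`hAc`).
  intro t ht heq
  have hx := hpos t ht.1
  refine (hu' t ht.1).trans_lt ?_
  rw [heq]
  set x := 1 + t * d with hxdef
  set y := x ^ (s - 1) with hy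
  have hy0 : 0 < y := Real.rpow_pos_of_pos hx _
  have h1 : x ^ (-s) * y = 1 / x := by
    rw [hy, ← Real.rpow_add hx, one_div, ← Real.rpow_neg_one]; congr 1; ring
  have h2 : x ^ (s - 1 - 1) = y / x := by
    rw [hy, Real.rpow_sub_one hx.ne' (s - 1)]
  have h3 := hbig t ht.1
  rw [← hxdef, ← hy] at h3
  rw [h2]
  have h4 : -(c * x ^ (-s)) * (A * y) + C / x * (A * y + 1)
      = (-(c * A) + C * A * y + C) / x := by
    have : -(c * x ^ (-s)) * (A * y) = -(c * A) * (x ^ (-s) * y) := by ring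
    rw [this, h1]; field_simp; ring
  have h5 : A * (d * (s - 1) * (y / x)) = (-(A * ((1 - s) * d * y))) / x := by
    field_simp; ring
  rw [h4, h5, div_lt_div_iff_of_pos_right hx]
  nlinarith [mul_le_mul_of_nonneg_left h3 hA.le]

end ChiSq

/-! ### Convergence to the Gibbs law and its consequences for probabilities. -/

section Convergence

variable {E : Type*} {F : Finset E} {μ j : E → ℝ} {q : E → E → ℝ}

/-- Since `p ≤ 1` pointwise, this bound does not depend on `p`; it makes the final constants
independent of the initial law. -/
theorem chiSq_le_of_sum_eq_one (hμ : ∀ x ∈ F, 0 < μ x) {β : ℝ} {p : E → ℝ}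
    (hp0 : ∀ x ∈ F, 0 ≤ p x) (hp1 : ∑ x ∈ F, p x = 1) :
    chiSq F μ j β p ≤ chiSq F μ j β fun _ => 1 := by
  unfold chiSq
  refine mul_le_mul_of_nonneg_left (Finset.sum_le_sum fun x hx => ?_)
    (Finset.sum_nonneg fun x hx => (gibbs_pos hμ hx β).le)
  have hg := gibbs_pos (j := j) hμ hx β
  have h1 : p x ≤ 1 := hp1 ▸ Finset.single_le_sum hp0 hx
  have h0 := hp0 x hx
  gcongr

theorem exp_neg_mul_log {x : ℝ} (hx : 0 < x) (b m : ℝ) :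
    Real.exp (-(b * Real.log x * m)) = x ^ (-(m * b)) := by
  rw [Real.rpow_def_of_pos hx]; congr 1; ring

theorem chiSq_nonneg (hμ : ∀ x ∈ F, 0 < μ x) {β : ℝ} {p : E → ℝ} : 0 ≤ chiSq F μ j β p :=
  mul_nonneg (Finset.sum_nonneg fun _ hx => (gibbs_pos hμ hx β).le)
    (Finset.sum_nonneg fun _ hx => div_nonneg (sq_nonneg _) (gibbs_pos hμ hx β).le)

theorem tendsto_one_add_mul_atTop {d : ℝ} (hd : 0 < d) :
    Filter.Tendsto (fun t : ℝ => 1 + t * d) Filter.atTop Filter.atTop :=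
  Filter.tendsto_atTop_add_const_left _ _ (Filter.tendsto_id.atTop_mul_const hd)

/-- Quantitative convergence to the Gibbs law of solutions of the master equation of a
perturbed annealed Metropolis chain. -/
theorem exists_chiSq_sub_one_le (hF : F.Nonempty) (hμ : ∀ x ∈ F, 0 < μ x)
    (hq : ∀ x y, 0 ≤ q x y) (hrev : ∀ x y, μ x * q x y = μ y * q y x)
    (hq1 : ∀ x ∈ F, ∑ y ∈ F, q x y ≤ 1) {m b d C M t₁ : ℝ}
    (hconn : ∀ x ∈ F, ∀ y ∈ F,
      Relation.ReflTransGen (StepBelow F j q (m + max (j x) (j y))) x y)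
    (hj0 : ∀ x ∈ F, 0 ≤ j x) (hjM : ∀ x ∈ F, j x ≤ M) (hb : 0 < b) (hd : 0 < d)
    (hmb : m * b < 1) (ht₁ : 0 ≤ t₁) (hC : 0 ≤ C) {a : ℝ → E → E → ℝ}
    (ha : ∀ t ≥ t₁, ∀ x ∈ F, ∀ y ∈ F,
      |a t x y - Real.exp (-(b * Real.log (1 + t * d) * max (j y - j x) 0))|
        ≤ C / (1 + t * d) * Real.exp (-(b * Real.log (1 + t * d) * max (j y - j x) 0))) :
    ∃ A t₂ : ℝ, 0 < A ∧ t₁ ≤ t₂ ∧ ∀ p : ℝ → E → ℝ, (∀ t ≥ t₁, ∀ x ∈ F, 0 ≤ p t x) →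
      (∀ t ≥ t₁, ∑ x ∈ F, p t x = 1) →
      (∀ t ≥ t₁, ∀ x ∈ F, HasDerivAt (fun t => p t x)
        (∑ y ∈ F, (p t y * (q y x * a t y x) - p t x * (q x y * a t x y))) t) →
      ∀ t ≥ t₂, chiSq F μ j (b * Real.log (1 + t * d)) (p t) - 1
        ≤ A * (1 + t * d) ^ (m * b - 1) := by
  obtain ⟨c, hc, hpoinc⟩ := exists_poincare (j := j) hμ hq m hconn
  obtain ⟨x₀, hx₀⟩ := hF
  have hM : 0 ≤ M := (hj0 x₀ hx₀).trans (hjM x₀ hx₀)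
  -- `4 * C` is the cost of noise, `b * d * M` that of cooling.
  set C' := 4 * C + b * d * M with hC'
  have hC'0 : 0 ≤ C' := by positivity
  have hlim : Filter.Tendsto (fun t : ℝ => (C' + (1 - m * b) * d) * (1 + t * d) ^ (m * b - 1))
      Filter.atTop (nhds 0) := by
    have h1 : Filter.Tendsto (fun t : ℝ => (1 + t * d) ^ (m * b - 1)) Filter.atTop (nhds 0) := by
      have := (tendsto_rpow_neg_atTop (y := 1 - m * b) (by linarith)).comp
        (tendsto_one_add_mul_atTop hd)
      simpa [Function.comp_def] using this
    simpa using h1.const_mul (C' + (1 - m * b) * d)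
  obtain ⟨t₀, ht₀⟩ := Filter.eventually_atTop.1 (hlim.eventually_le_const (half_pos hc))
  set t₂ := max t₀ t₁
  have ht₂ : 0 ≤ t₂ := ht₁.trans (le_max_right _ _)
  have hx₂ : 0 < 1 + t₂ * d := by positivity
  set V₂ := chiSq F μ j (b * Real.log (1 + t₂ * d)) fun _ => 1
  have hV₂ : 0 ≤ V₂ := chiSq_nonneg hμ
  set y₂ := (1 + t₂ * d) ^ (m * b - 1) with hy₂
  have hy₂0 : 0 < y₂ := Real.rpow_pos_of_pos hx₂ _
  -- The first two summands give `2 C' < A c`; the last one puts the barrier above `chiSq` at time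
  -- `t₂` for every probability vector.
  refine ⟨2 * C' / c + 1 + V₂ / y₂, t₂, by positivity, le_max_right _ _, ?_⟩
  intro p hp0 hp1 hp'
  have hder : ∀ t ≥ t₂, HasDerivAt (fun t => chiSq F μ j (b * Real.log (1 + t * d)) (p t) - 1)
      _ t := fun t ht =>
    (hasDerivAt_chiSq (j := j) hμ
      (hasDerivAt_invTemp (b := b) (d := d) (t := t)
        (by have := mul_nonneg (ht₂.trans ht) hd.le; linarith))
      (hp' t ((le_max_right _ _).trans ht))).sub_const 1
  refine le_mul_rpow_of_deriv_le (c := c) (C := C') hd ht₂ (by positivity) hder ?_ ?_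
    (fun t ht => ht₀ t ((le_max_left _ _).trans ht)) ?_
  · intro t ht
    have htd := mul_nonneg (ht₂.trans ht) hd.le
    have hx : 0 < 1 + t * d := by linarith
    have htt : t₁ ≤ t := (le_max_right _ _).trans ht
    set β := b * Real.log (1 + t * d) with hβdef
    have hβ : 0 ≤ β := mul_nonneg hb.le (Real.log_nonneg (by linarith))
    have hdis := chiSq_dissipation (j := j) ⟨x₀, hx₀⟩ hμ hq hrev hq1 hβ
      (div_nonneg hC hx.le) (ha t htt) (hpoinc β hβ) (hp1 t htt)
    rw [exp_neg_mul_log hx] at hdis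
    have hβ' : 0 ≤ b * d / (1 + t * d) := by positivity
    have hW : 0 ≤ ∑ x ∈ F, p t x ^ 2 / gibbs μ j β x :=
      Finset.sum_nonneg fun x hx => div_nonneg (sq_nonneg _) (gibbs_pos hμ hx β).le
    have hZ : 0 ≤ ∑ x ∈ F, gibbs μ j β x := Finset.sum_nonneg fun x hx => (gibbs_pos hμ hx β).le
    -- The contribution of the decreasing partition function has a favourable sign because costs are
    -- nonnegative, so it is dropped.
    have h1 : 0 ≤ (b * d / (1 + t * d) * ∑ x ∈ F, j x * gibbs μ j β x) *
        ∑ x ∈ F, p t x ^ 2 / gibbs μ j β x :=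
      mul_nonneg (mul_nonneg hβ' (Finset.sum_nonneg fun x hx =>
        mul_nonneg (hj0 x hx) (gibbs_pos hμ hx β).le)) hW
    have h2 : (∑ x ∈ F, gibbs μ j β x) *
          (b * d / (1 + t * d) * ∑ x ∈ F, j x * (p t x ^ 2 / gibbs μ j β x))
        ≤ b * d / (1 + t * d) * M * chiSq F μ j β (p t) := by
      have h3 : ∑ x ∈ F, j x * (p t x ^ 2 / gibbs μ j β x)
          ≤ M * ∑ x ∈ F, p t x ^ 2 / gibbs μ j β x := by
        rw [Finset.mul_sum]
        exact Finset.sum_le_sum fun x hx => mul_le_mul_of_nonneg_right (hjM x hx)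
          (div_nonneg (sq_nonneg _) (gibbs_pos hμ hx β).le)
      calc _ ≤ (∑ x ∈ F, gibbs μ j β x) *
            (b * d / (1 + t * d) * (M * ∑ x ∈ F, p t x ^ 2 / gibbs μ j β x)) := by gcongr
        _ = _ := by unfold chiSq; ring
    have h4 : C' / (1 + t * d) * (chiSq F μ j β (p t) - 1 + 1)
        = 4 * (C / (1 + t * d)) * chiSq F μ j β (p t)
          + b * d / (1 + t * d) * M * chiSq F μ j β (p t) := by
      rw [hC']; ring
    rw [h4, mul_add]
    have h5 : -(c * (1 + t * d) ^ (-(m * b))) * (chiSq F μ j β (p t) - 1)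
        = -(c * (1 + t * d) ^ (-(m * b)) * (chiSq F μ j β (p t) - 1)) := by ring
    rw [neg_mul] at hdis
    rw [h5, neg_mul]
    linarith
  · have h1 := chiSq_le_of_sum_eq_one (j := j) (β := b * Real.log (1 + t₂ * d)) hμ
      (hp0 t₂ (le_max_right _ _)) (hp1 t₂ (le_max_right _ _))
    calc _ ≤ V₂ := by linarith
      _ = V₂ / y₂ * y₂ := by field_simp
      _ ≤ _ := by
        refine mul_le_mul_of_nonneg_right ?_ hy₂0.le
        have : 0 ≤ 2 * C' / c + 1 := by positivity
        linarith
  · calc 2 * C' = 2 * C' / c * c := by field_simp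
      _ < _ := by
        refine mul_lt_mul_of_pos_right ?_ hc
        have : 0 ≤ V₂ / y₂ := by positivity
        linarith

/-- `chiSq - 1` is the sum of `(p - π)² / π`; Cauchy–Schwarz on `B` bounds `p(B) - π(B)` by the root
of `π(B) (chiSq - 1)`. Keeping the factor `π(B)` under the root is what leaves `η` in the first term
of the final bound. -/
theorem sum_subset_le_of_chiSq (hμ : ∀ x ∈ F, 0 < μ x) {β v : ℝ} {p : E → ℝ}
    (hp1 : ∑ x ∈ F, p x = 1) {B : Finset E} (hB : B ⊆ F) {w : ℝ}
    (hw : ∑ x ∈ B, gibbs μ j β x ≤ w * ∑ x ∈ F, gibbs μ j β x)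
    (hv : chiSq F μ j β p - 1 ≤ v) :
    ∑ x ∈ B, p x ≤ w + Real.sqrt (w * v) := by
  set Z := ∑ x ∈ F, gibbs μ j β x with hZdef
  have hF : F.Nonempty := by
    rw [Finset.nonempty_iff_ne_empty]
    rintro rfl
    simp at hp1
  have hZ : 0 < Z := sum_gibbs_pos hF hμ β
  have hg : ∀ x ∈ F, 0 < gibbs μ j β x / Z := fun x hx => div_pos (gibbs_pos hμ hx β) hZ
  have hwB : ∑ x ∈ B, gibbs μ j β x / Z ≤ w := by
    rwa [← Finset.sum_div, div_le_iff₀ hZ]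
  have hgB : 0 ≤ ∑ x ∈ B, gibbs μ j β x / Z := Finset.sum_nonneg fun x hx => (hg x (hB hx)).le
  have hsq : ∑ x ∈ F, (p x - gibbs μ j β x / Z) ^ 2 / (gibbs μ j β x / Z)
      = chiSq F μ j β p - 1 := by
    have h1 : ∀ x ∈ F, (p x - gibbs μ j β x / Z) ^ 2 / (gibbs μ j β x / Z)
        = Z * (p x ^ 2 / gibbs μ j β x) - 2 * p x + gibbs μ j β x / Z := by
      intro x hx
      have := (gibbs_pos (j := j) hμ hx β).ne'
      have := hZ.ne'
      field_simp
      ring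
    rw [Finset.sum_congr rfl h1, Finset.sum_add_distrib, Finset.sum_sub_distrib, ← Finset.mul_sum,
      ← Finset.mul_sum, hp1, ← Finset.sum_div, ← hZdef, div_self hZ.ne', chiSq, ← hZdef]
    ring
  have hterm : ∀ x ∈ F, 0 ≤ (p x - gibbs μ j β x / Z) ^ 2 / (gibbs μ j β x / Z) := fun x hx =>
    div_nonneg (sq_nonneg _) (hg x hx).le
  have hv0 : 0 ≤ v := (hsq ▸ Finset.sum_nonneg hterm : 0 ≤ chiSq F μ j β p - 1).trans hv
  have hCS : (∑ x ∈ B, (p x - gibbs μ j β x / Z)) ^ 2 ≤ w * v := by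
    have h1 : (∑ x ∈ B, (p x - gibbs μ j β x / Z)) ^ 2
        ≤ (∑ x ∈ B, gibbs μ j β x / Z) *
          ∑ x ∈ B, (p x - gibbs μ j β x / Z) ^ 2 / (gibbs μ j β x / Z) := by
      refine Finset.sum_sq_le_sum_mul_sum_of_sq_le_mul B (fun x hx => (hg x (hB hx)).le)
        (fun x hx => hterm x (hB hx)) fun x hx => ?_
      have h2 := (gibbs_pos (j := j) hμ (hB hx) β).ne'
      have h3 := hZ.ne'
      exact le_of_eq (by field_simp)
    have h2 : ∑ x ∈ B, (p x - gibbs μ j β x / Z) ^ 2 / (gibbs μ j β x / Z) ≤ v :=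
      ((Finset.sum_le_sum_of_subset_of_nonneg hB fun x hx _ => hterm x hx).trans_eq hsq).trans hv
    exact h1.trans (mul_le_mul hwB h2 (Finset.sum_nonneg fun x hx => hterm x (hB hx))
      (hgB.trans hwB))
  have h1 := Real.le_sqrt_of_sq_le hCS
  rw [Finset.sum_sub_distrib] at h1
  linarith

/-- Compare the weights on `B` with that of the single point `x₀`, itself at most the partition
function. -/
theorem sum_gibbs_le_of_level (hμ : ∀ x ∈ F, 0 < μ x) {β η : ℝ} (hβ : 0 ≤ β) {x₀ : E}
    (hx₀ : x₀ ∈ F) {B : Finset E} (hB : B ⊆ F) (hBj : ∀ x ∈ B, j x₀ + η ≤ j x) :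
    ∑ x ∈ B, gibbs μ j β x
      ≤ (∑ x ∈ F, μ x) / μ x₀ * Real.exp (-(β * η)) * ∑ x ∈ F, gibbs μ j β x := by
  have h1 : ∑ x ∈ B, gibbs μ j β x ≤ (∑ x ∈ F, μ x) * Real.exp (-(β * (j x₀ + η))) := by
    calc ∑ x ∈ B, gibbs μ j β x ≤ ∑ x ∈ B, μ x * Real.exp (-(β * (j x₀ + η))) := by
          refine Finset.sum_le_sum fun x hx => ?_
          refine mul_le_mul_of_nonneg_left (Real.exp_le_exp.2 (neg_le_neg ?_)) (hμ x (hB hx)).le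
          exact mul_le_mul_of_nonneg_left (hBj x hx) hβ
      _ ≤ ∑ x ∈ F, μ x * Real.exp (-(β * (j x₀ + η))) :=
          Finset.sum_le_sum_of_subset_of_nonneg hB fun x hx _ =>
            mul_nonneg (hμ x hx).le (Real.exp_pos _).le
      _ = _ := by rw [← Finset.sum_mul]
  have h2 : gibbs μ j β x₀ ≤ ∑ x ∈ F, gibbs μ j β x :=
    Finset.single_le_sum (f := gibbs μ j β) (fun x hx => (gibbs_pos hμ hx β).le) hx₀
  have h3 : 0 ≤ ∑ x ∈ F, μ x := Finset.sum_nonneg fun x hx => (hμ x hx).le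
  have h4 := hμ x₀ hx₀
  refine h1.trans ?_
  calc (∑ x ∈ F, μ x) * Real.exp (-(β * (j x₀ + η)))
      = (∑ x ∈ F, μ x) / μ x₀ * Real.exp (-(β * η)) * gibbs μ j β x₀ := by
        unfold gibbs
        rw [mul_add, neg_add, Real.exp_add]
        field_simp
    _ ≤ _ := by gcongr

end Convergence

/-! ### Exponential moments of empirical means. -/

section EmpiricalMean

variable {Ω : Type*} [MeasurableSpace Ω]

/-- Hoeffding bound for the exponential moments of an empirical mean. -/
theorem integral_exp_empirical_mean_le {ν : Measure Ω} [IsProbabilityMeasure ν] {V : Ω → ℝ}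
    (hV : Measurable V) {M : ℝ} (hM : 0 ≤ M) (hb : ∀ ω, V ω ∈ Set.Icc 0 M) {N : ℕ} (hN : 0 < N)
    (s : ℝ) :
    ∫ w : Fin N → Ω, Real.exp (s * ((∑ i, V (w i)) / N - ∫ ω, V ω ∂ν)) ∂(Measure.pi fun _ => ν)
      ≤ Real.exp (s ^ 2 * M ^ 2 / (8 * N)) := by
  have hN' : (0 : ℝ) < N := by exact_mod_cast hN
  have h1 : ∀ w : Fin N → Ω, Real.exp (s * ((∑ i, V (w i)) / N - ∫ ω, V ω ∂ν))
      = ∏ i, Real.exp (s / N * (V (w i) - ∫ ω, V ω ∂ν)) := by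
    intro w
    rw [← Real.exp_sum, ← Finset.mul_sum, Finset.sum_sub_distrib]
    congr 1
    simp only [Finset.sum_const, Finset.card_univ, Fintype.card_fin, nsmul_eq_mul]
    field_simp
  simp_rw [h1]
  rw [integral_fintype_prod_eq_pow (ι := Fin N)
    (fun ω => Real.exp (s / N * (V ω - ∫ ω, V ω ∂ν))), Fintype.card_fin]
  have h2 := (hasSubgaussianMGF_of_mem_Icc (μ := ν) hV.aemeasurable (ae_of_all _ hb)).mgf_le (s / N)
  unfold mgf at h2
  calc _ ≤ _ := pow_le_pow_left₀ (integral_nonneg fun _ => (Real.exp_pos _).le) h2 N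
    _ = _ := by
      rw [← Real.exp_nat_mul]
      congr 1
      have : ((‖M - 0‖₊ / 2 : ℝ≥0) : ℝ) = M / 2 := by
        simp [abs_of_nonneg hM]
      push_cast at this ⊢
      rw [this]
      field_simp
      ring

/-- Removes the absolute value in favour of the moments at `±2z`, with a right side that still
vanishes to second order at `0`, so its mean is of the order of a variance. -/
theorem sq_exp_abs_sub_one_le (z : ℝ) :
    (Real.exp |z| - 1) ^ 2 ≤ Real.exp (2 * z) + Real.exp (2 * -z) - 2 := by
  have h1 : Real.exp z * Real.exp (-z) = 1 := by rw [← Real.exp_add]; simp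
  have h2 : Real.exp (2 * z) = Real.exp z ^ 2 := by rw [← Real.exp_nat_mul]; norm_num
  have h3 : Real.exp (2 * -z) = Real.exp (-z) ^ 2 := by rw [← Real.exp_nat_mul]; norm_num
  rw [h2, h3]
  have h4 : 2 ≤ Real.exp z + Real.exp (-z) := by
    linarith [Real.add_one_le_exp z, Real.add_one_le_exp (-z)]
  rcases abs_cases z with ⟨h, _⟩ | ⟨h, _⟩ <;> rw [h] <;>
    nlinarith [sq_nonneg (Real.exp z - 1), sq_nonneg (Real.exp (-z) - 1)]

/-- Young's inequality `w ≤ θ / 2 + w² / (2 θ)`; optimising `θ` later replaces taking a square root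
of expectations, and commutes with averaging over the sample size. -/
theorem exp_abs_sub_one_le {θ : ℝ} (hθ : 0 < θ) (z : ℝ) :
    Real.exp |z| - 1 ≤ θ / 2 + (Real.exp (2 * z) + Real.exp (2 * -z) - 2) / (2 * θ) := by
  have h := sq_exp_abs_sub_one_le z
  have h2 : Real.exp |z| - 1 ≤ θ / 2 + (Real.exp |z| - 1) ^ 2 / (2 * θ) := by
    rw [← sub_nonneg]
    have : θ / 2 + (Real.exp |z| - 1) ^ 2 / (2 * θ) - (Real.exp |z| - 1)
        = (Real.exp |z| - 1 - θ) ^ 2 / (2 * θ) := by field_simp; ring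
    rw [this]; positivity
  exact h2.trans (by gcongr)

/-- The positive part is 1-Lipschitz. The error is relative to the exact acceptance probability, as
the perturbed Dirichlet form requires; an absolute error could swamp the very small rates at low
temperature. -/
theorem abs_exp_max_sub_le (β A B : ℝ) :
    |Real.exp (-(β * max A 0)) - Real.exp (-(β * max B 0))|
      ≤ Real.exp (-(β * max B 0)) * (Real.exp |β * (A - B)| - 1) := by
  have habs : |β * max A 0 - β * max B 0| ≤ |β * (A - B)| := by
    rw [← mul_sub, abs_mul, abs_mul]
    exact mul_le_mul_of_nonneg_left (abs_max_sub_max_le_abs A B 0) (abs_nonneg _)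
  set D := β * max A 0 - β * max B 0 with hD
  have h1 : Real.exp (-(β * max A 0)) = Real.exp (-(β * max B 0)) * Real.exp (-D) := by
    rw [← Real.exp_add]; congr 1; rw [hD]; ring
  rw [h1, ← mul_sub_one, abs_mul, abs_of_pos (Real.exp_pos _)]
  refine mul_le_mul_of_nonneg_left ?_ (Real.exp_pos _).le
  refine le_trans ?_ (sub_le_sub_right (Real.exp_le_exp.2 habs) 1)
  rw [abs_le]
  constructor
  · have h2 := Real.add_one_le_exp (-D)
    have h3 := Real.add_one_le_exp |D|
    have h4 := le_abs_self D
    linarith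
  · have h2 : Real.exp (-D) ≤ Real.exp |D| := Real.exp_le_exp.2 (neg_le_abs D)
    linarith

end EmpiricalMean

/-! ### Acceptance probability for a fixed sample size. -/

namespace NoisyProblem

variable {E Ω : Type*} [Fintype E] [DecidableEq E] [MeasurableSpace Ω] (P : NoisyProblem E Ω)

theorem toReal_U_mem {x : E} (hx : x ∈ P.feasible) (ω : Ω) :
    (P.U x ω).toReal ∈ Set.Icc 0 P.M :=
  ⟨ENNReal.toReal_nonneg, ENNReal.toReal_le_of_le_ofReal P.M_pos.le (P.U_le x hx ω)⟩

theorem U_ne_top {x : E} (hx : x ∈ P.feasible) (ω : Ω) : P.U x ω ≠ ⊤ :=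
  ne_top_of_le_ne_top ENNReal.ofReal_ne_top (P.U_le x hx ω)

theorem J_le {x : E} (hx : x ∈ P.feasible) : P.J x ≤ ENNReal.ofReal P.M := by
  refine (lintegral_mono fun ω => P.U_le x hx ω).trans ?_
  simp

theorem J_ne_top {x : E} (hx : x ∈ P.feasible) : P.J x ≠ ⊤ :=
  ne_top_of_le_ne_top ENNReal.ofReal_ne_top (P.J_le hx)

theorem J_eq_top {x : E} (hx : x ∉ P.feasible) : P.J x = ⊤ := by
  unfold J
  simp [P.U_top x hx]

theorem toReal_J {x : E} (hx : x ∈ P.feasible) :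
    (P.J x).toReal = ∫ ω, (P.U x ω).toReal ∂(P.noise x) := by
  rw [integral_toReal (P.U_meas x).aemeasurable
    (ae_of_all _ fun ω => (P.U_ne_top hx ω).lt_top)]
  rfl

theorem toReal_estimate {x : E} (hx : x ∈ P.feasible) {N : ℕ} (w : Fin N → Ω) :
    (P.estimate x w).toReal = (∑ i, (P.U x (w i)).toReal) / N := by
  unfold estimate
  rw [ENNReal.toReal_div, ENNReal.toReal_sum fun i _ => P.U_ne_top hx (w i)]
  simp

theorem estimate_ne_top {x : E} (hx : x ∈ P.feasible) {N : ℕ} (hN : 0 < N) (w : Fin N → Ω) :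
    P.estimate x w ≠ ⊤ := by
  unfold estimate
  refine ENNReal.div_ne_top (ENNReal.sum_ne_top.2 fun i _ => P.U_ne_top hx (w i)) ?_
  exact_mod_cast hN.ne'

theorem estimate_eq_top {x : E} (hx : x ∉ P.feasible) {N : ℕ} (hN : 0 < N) (w : Fin N → Ω) :
    P.estimate x w = ⊤ := by
  unfold estimate
  have h : ∑ i, P.U x (w i) = ⊤ := ENNReal.sum_eq_top.2 ⟨⟨0, hN⟩, Finset.mem_univ _, P.U_top x hx _⟩
  rw [h, ENNReal.top_div_of_ne_top (ENNReal.natCast_ne_top N)]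

theorem acceptProb_eq_zero {x y : E} (hx : x ∈ P.feasible) (hy : y ∉ P.feasible) (β : ℝ≥0) {N : ℕ}
    (hN : 0 < N) : P.acceptProb x y β N = 0 := by
  unfold acceptProb
  have h : ∀ w : (Fin N → Ω) × (Fin N → Ω),
      metropolis β (P.estimate y w.2 - P.estimate x w.1) = 0 := fun w => by
    rw [P.estimate_eq_top hy hN, ENNReal.top_sub (P.estimate_ne_top hx hN _), metropolis, if_pos rfl]
  simp [h]

theorem toReal_metropolis_sub {X Y : ℝ≥0∞} (hX : X ≠ ⊤) (hY : Y ≠ ⊤) (β : ℝ≥0) :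
    (metropolis β (Y - X)).toReal = Real.exp (-(β * max (Y.toReal - X.toReal) 0)) := by
  have h1 : Y - X ≠ ⊤ := ENNReal.sub_ne_top hY
  have h2 : (Y - X).toReal = max (Y.toReal - X.toReal) 0 := by
    rcases le_total X Y with h | h
    · rw [ENNReal.toReal_sub_of_le h hY, max_eq_left]
      exact sub_nonneg.2 (ENNReal.toReal_mono hY h)
    · rw [tsub_eq_zero_of_le h, max_eq_right]
      · simp
      · exact sub_nonpos.2 (ENNReal.toReal_mono hX h)
  rw [metropolis, if_neg h1, ENNReal.toReal_ofReal (Real.exp_pos _).le, h2]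

theorem measurable_metropolis_estimate (x y : E) (β : ℝ≥0) (N : ℕ) :
    Measurable fun w : (Fin N → Ω) × (Fin N → Ω) =>
      metropolis β (P.estimate y w.2 - P.estimate x w.1) :=
  measurable_metropolis.comp (measurable_const.prodMk
    (((P.measurable_estimate y N).comp measurable_snd).sub
      ((P.measurable_estimate x N).comp measurable_fst)))

theorem toReal_acceptProb {x y : E} (hx : x ∈ P.feasible) (hy : y ∈ P.feasible) (β : ℝ≥0) {N : ℕ}
    (hN : 0 < N) :
    (P.acceptProb x y β N).toReal
      = ∫ w : (Fin N → Ω) × (Fin N → Ω), Real.exp (-(β *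
          max ((P.estimate y w.2).toReal - (P.estimate x w.1).toReal) 0))
        ∂((Measure.pi fun _ => P.noise x).prod (Measure.pi fun _ => P.noise y)) := by
  unfold acceptProb
  rw [← integral_toReal (P.measurable_metropolis_estimate x y β N).aemeasurable
    (ae_of_all _ fun w => (metropolis_le_one _ _).trans_lt ENNReal.one_lt_top)]
  refine integral_congr_ae (ae_of_all _ fun w => ?_)
  exact toReal_metropolis_sub (P.estimate_ne_top hx hN _) (P.estimate_ne_top hy hN _) β

theorem toReal_estimate_mem {x : E} (hx : x ∈ P.feasible) {N : ℕ} (hN : 0 < N) (w : Fin N → Ω) :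
    (P.estimate x w).toReal ∈ Set.Icc 0 P.M := by
  refine ⟨ENNReal.toReal_nonneg, ?_⟩
  have hN' : (0 : ℝ) < N := by exact_mod_cast hN
  rw [P.toReal_estimate hx, div_le_iff₀ hN']
  refine (Finset.sum_le_sum fun i _ => (P.toReal_U_mem hx (w i)).2).trans ?_
  simp [mul_comm]

theorem toReal_J_mem {x : E} (hx : x ∈ P.feasible) : (P.J x).toReal ∈ Set.Icc 0 P.M :=
  ⟨ENNReal.toReal_nonneg, ENNReal.toReal_le_of_le_ofReal P.M_pos.le (P.J_le hx)⟩

theorem integral_exp_estimate_le {x : E} (hx : x ∈ P.feasible) {N : ℕ} (hN : 0 < N) (s : ℝ) :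
    ∫ w : Fin N → Ω, Real.exp (s * ((P.estimate x w).toReal - (P.J x).toReal))
        ∂(Measure.pi fun _ => P.noise x)
      ≤ Real.exp (s ^ 2 * P.M ^ 2 / (8 * N)) := by
  simp_rw [P.toReal_estimate hx, P.toReal_J hx]
  exact integral_exp_empirical_mean_le (P.U_meas x).ennreal_toReal P.M_pos.le (P.toReal_U_mem hx)
    hN s

/-- Exponential moment of the difference of the two estimation errors. -/
theorem integral_exp_estimate_sub_le {x y : E} (hx : x ∈ P.feasible) (hy : y ∈ P.feasible) {N : ℕ}
    (hN : 0 < N) (s : ℝ) :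
    ∫ w : (Fin N → Ω) × (Fin N → Ω), Real.exp (s *
        (((P.estimate y w.2).toReal - (P.estimate x w.1).toReal)
          - ((P.J y).toReal - (P.J x).toReal)))
        ∂((Measure.pi fun _ => P.noise x).prod (Measure.pi fun _ => P.noise y))
      ≤ Real.exp (s ^ 2 * P.M ^ 2 / (4 * N)) := by
  have h1 : ∀ w : (Fin N → Ω) × (Fin N → Ω), Real.exp (s *
        (((P.estimate y w.2).toReal - (P.estimate x w.1).toReal)
          - ((P.J y).toReal - (P.J x).toReal)))
      = Real.exp (-s * ((P.estimate x w.1).toReal - (P.J x).toReal)) *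
        Real.exp (s * ((P.estimate y w.2).toReal - (P.J y).toReal)) := by
    intro w
    rw [← Real.exp_add]; congr 1; ring
  simp_rw [h1]
  rw [integral_prod_mul (fun w => Real.exp (-s * ((P.estimate x w).toReal - (P.J x).toReal)))
    (fun w => Real.exp (s * ((P.estimate y w).toReal - (P.J y).toReal)))]
  calc _ ≤ Real.exp ((-s) ^ 2 * P.M ^ 2 / (8 * N)) * Real.exp (s ^ 2 * P.M ^ 2 / (8 * N)) :=
        mul_le_mul (P.integral_exp_estimate_le hx hN _) (P.integral_exp_estimate_le hy hN _)
          (integral_nonneg fun _ => (Real.exp_pos _).le) (Real.exp_pos _).le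
    _ = _ := by
      rw [← Real.exp_add]; congr 1; ring

/-- The effect of noise on the acceptance probability is small in relative terms. -/
theorem abs_toReal_acceptProb_sub_le {x y : E} (hx : x ∈ P.feasible) (hy : y ∈ P.feasible)
    (β : ℝ≥0) {N : ℕ} (hN : 0 < N) {θ : ℝ} (hθ : 0 < θ) :
    |(P.acceptProb x y β N).toReal
        - Real.exp (-(β * max ((P.J y).toReal - (P.J x).toReal) 0))|
      ≤ Real.exp (-(β * max ((P.J y).toReal - (P.J x).toReal) 0)) *
        (θ / 2 + (Real.exp ((β : ℝ) ^ 2 * P.M ^ 2 / N) - 1) / θ) := by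
  set ρ := (Measure.pi fun _ : Fin N => P.noise x).prod (Measure.pi fun _ : Fin N => P.noise y)
  set e := Real.exp (-(β * max ((P.J y).toReal - (P.J x).toReal) 0))
  set D : (Fin N → Ω) × (Fin N → Ω) → ℝ := fun w =>
    ((P.estimate y w.2).toReal - (P.estimate x w.1).toReal)
          - ((P.J y).toReal - (P.J x).toReal) with hD
  have hXm : Measurable fun w : (Fin N → Ω) × (Fin N → Ω) => (P.estimate x w.1).toReal :=
    ((P.measurable_estimate x N).comp measurable_fst).ennreal_toReal
  have hYm : Measurable fun w : (Fin N → Ω) × (Fin N → Ω) => (P.estimate y w.2).toReal :=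
    ((P.measurable_estimate y N).comp measurable_snd).ennreal_toReal
  have hDm : Measurable D := (hYm.sub hXm).sub_const _
  have hDb : ∀ w, |D w| ≤ 2 * P.M := fun w => by
    have h1 := P.toReal_estimate_mem hx hN w.1
    have h2 := P.toReal_estimate_mem hy hN w.2
    have h3 := P.toReal_J_mem hx
    have h4 := P.toReal_J_mem hy
    rw [abs_le]
    constructor <;> simp only [hD] <;> linarith [h1.1, h1.2, h2.1, h2.2, h3.1, h3.2, h4.1, h4.2]
  have hint : ∀ s : ℝ, Integrable (fun w => Real.exp (s * D w)) ρ := fun s => by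
    refine Integrable.of_bound (by fun_prop) (Real.exp (|s| * (2 * P.M))) (ae_of_all _ fun w => ?_)
    rw [Real.norm_eq_abs, abs_of_pos (Real.exp_pos _), Real.exp_le_exp]
    refine (le_abs_self _).trans ?_
    rw [abs_mul]
    exact mul_le_mul_of_nonneg_left (hDb w) (abs_nonneg _)
  have hint0 : Integrable (fun w : (Fin N → Ω) × (Fin N → Ω) => Real.exp (-(β *
          max ((P.estimate y w.2).toReal - (P.estimate x w.1).toReal) 0))) ρ := by
    refine Integrable.of_bound (by fun_prop) 1 (ae_of_all _ fun w => ?_)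
    rw [Real.norm_eq_abs, abs_of_pos (Real.exp_pos _), Real.exp_le_one_iff]
    have : 0 ≤ (β : ℝ) * max ((P.estimate y w.2).toReal - (P.estimate x w.1).toReal) 0 :=
      mul_nonneg β.2 (le_max_right _ _)
    linarith
  have hbound : Integrable (fun w => e * (θ / 2 + (Real.exp (2 * β * D w)
      + Real.exp (-(2 * β) * D w) - 2) / (2 * θ))) ρ :=
    ((integrable_const (θ / 2)).add ((((hint (2 * β)).add (hint (-(2 * β)))).sub
      (integrable_const 2)).div_const (2 * θ))).const_mul e
  have hsub : (P.acceptProb x y β N).toReal - e = ∫ w, (Real.exp (-(β *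
          max ((P.estimate y w.2).toReal - (P.estimate x w.1).toReal) 0)) - e) ∂ρ := by
    rw [integral_sub hint0 (integrable_const e), P.toReal_acceptProb hx hy β hN]
    simp [ρ]
  rw [hsub]
  calc |∫ w, (Real.exp (-(β * max ((P.estimate y w.2).toReal
          - (P.estimate x w.1).toReal) 0)) - e) ∂ρ|
      ≤ ∫ w, |Real.exp (-(β * max ((P.estimate y w.2).toReal
          - (P.estimate x w.1).toReal) 0)) - e| ∂ρ := abs_integral_le_integral_abs
    _ ≤ ∫ w, e * (θ / 2 + (Real.exp (2 * β * D w)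
          + Real.exp (-(2 * β) * D w) - 2) / (2 * θ)) ∂ρ := by
        refine integral_mono_of_nonneg (ae_of_all _ fun _ => abs_nonneg _) hbound
          (ae_of_all _ fun w => ?_)
        refine (abs_exp_max_sub_le _ _ _).trans ?_
        refine mul_le_mul_of_nonneg_left ?_ (Real.exp_pos _).le
        have h := exp_abs_sub_one_le hθ (β * D w)
        rw [show 2 * ((β : ℝ) * D w) = 2 * β * D w by ring,
          show 2 * -((β : ℝ) * D w) = -(2 * β) * D w by ring] at h
        exact h
    _ = e * (θ / 2 + ((∫ w, Real.exp (2 * β * D w) ∂ρ)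
          + (∫ w, Real.exp (-(2 * β) * D w) ∂ρ) - 2) / (2 * θ)) := by
        have h1 : ∫ w, (Real.exp (2 * β * D w) + Real.exp (-(2 * β) * D w) - 2) ∂ρ
            = (∫ w, Real.exp (2 * β * D w) ∂ρ) + (∫ w, Real.exp (-(2 * β) * D w) ∂ρ) - 2 := by
          rw [integral_sub (f := fun w => Real.exp (2 * β * D w) + Real.exp (-(2 * β) * D w))
            ((hint _).add (hint _)) (integrable_const 2), integral_add (hint _) (hint _)]
          simp [ρ]
        rw [integral_const_mul, integral_add (f := fun _ => θ / 2)
          (g := fun w => (Real.exp (2 * β * D w) + Real.exp (-(2 * β) * D w) - 2) / (2 * θ))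
          (integrable_const _)
          ((((hint (2 * β)).add (hint (-(2 * β)))).sub (integrable_const 2)).div_const _),
          integral_div _ (fun w => Real.exp (2 * β * D w) + Real.exp (-(2 * β) * D w) - 2), h1]
        simp [ρ]
    _ ≤ _ := by
        refine mul_le_mul_of_nonneg_left ?_ (Real.exp_pos _).le
        have h1 := P.integral_exp_estimate_sub_le hx hy hN (2 * β)
        have h2 := P.integral_exp_estimate_sub_le hx hy hN (-(2 * β))
        -- The moments are taken at `s = ±2β`, which turns the Hoeffding exponent into `β² M² / N`.
        have h3 : (2 * (β : ℝ)) ^ 2 * P.M ^ 2 / (4 * N) = (β : ℝ) ^ 2 * P.M ^ 2 / N := by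
          ring
        rw [neg_sq, h3] at h2
        rw [h3] at h1
        have h4 : (Real.exp ((β : ℝ) ^ 2 * P.M ^ 2 / N) - 1) / θ
            = (Real.exp ((β : ℝ) ^ 2 * P.M ^ 2 / N) + Real.exp ((β : ℝ) ^ 2 * P.M ^ 2 / N) - 2)
              / (2 * θ) := by field_simp; ring
        rw [h4]
        gcongr

end NoisyProblem

/-! ### Exponential of an inverse Poisson variable. -/

section Poisson

open scoped Nat

theorem factorial_add_le (j k : ℕ) : (j + k)! ≤ j ! * ((j + 1) ^ k * k !) := by
  induction k with
  | zero => simp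
  | succ k ih =>
    rw [← add_assoc, Nat.factorial_succ, Nat.factorial_succ k, pow_succ]
    calc (j + k + 1) * (j + k)! ≤ ((j + 1) * (k + 1)) * (j ! * ((j + 1) ^ k * k !)) :=
          Nat.mul_le_mul (by nlinarith) ih
      _ = _ := by ring

/-- Termwise, `1 / ((j + 1) ^ k k!) ≤ j! / (j + k)!`. The right side is shaped so that the Poisson
weight at `j` times the `k`-th term is `(X / n) ^ k` times the Poisson weight at `j + k`. -/
theorem ofReal_exp_div_le {X : ℝ} (hX : 0 ≤ X) (j : ℕ) :
    ENNReal.ofReal (Real.exp (X / (j + 1)))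
      ≤ ∑' k : ℕ, ENNReal.ofReal (X ^ k * j ! / (j + k)!) := by
  have h : HasSum (fun k : ℕ => (X / (j + 1)) ^ k / k !) (Real.exp (X / (j + 1))) := by
    rw [Real.exp_eq_exp_ℝ]
    exact NormedSpace.expSeries_div_hasSum_exp _
  rw [← h.tsum_eq, ENNReal.ofReal_tsum_of_nonneg (fun k => by positivity) h.summable]
  refine ENNReal.tsum_le_tsum fun k => ENNReal.ofReal_le_ofReal ?_
  rw [div_pow, div_div, div_le_div_iff₀ (by positivity) (by positivity), mul_assoc]
  refine mul_le_mul_of_nonneg_left ?_ (by positivity)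
  exact_mod_cast factorial_add_le j k

/-- After expanding the exponential and exchanging sums, the `k`-th term is `(X / n) ^ k` times a
Poisson tail, at most one; a geometric series remains. -/
theorem lintegral_exp_div_poisson_le {X : ℝ} {n : ℝ≥0} (hX : 0 ≤ X) (hXn : X < n) :
    ∫⁻ N : ℕ, ENNReal.ofReal (Real.exp (X / (N + 1))) ∂(poissonMeasure n)
      ≤ ENNReal.ofReal (1 - X / n)⁻¹ := by
  have hn : (0 : ℝ) < n := hX.trans_lt hXn
  have hu0 : 0 ≤ X / n := by positivity
  have hu1 : X / n < 1 := (div_lt_one hn).2 hXn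
  have hw : ∑' j : ℕ, ENNReal.ofReal (Real.exp (-n) * n ^ j / j !) = 1 := by
    rw [← ENNReal.ofReal_tsum_of_nonneg (fun j => by positivity)
      (hasSum_one_poissonMeasure n).summable, (hasSum_one_poissonMeasure n).tsum_eq,
      ENNReal.ofReal_one]
  rw [poissonMeasure, lintegral_sum_measure]
  simp only [lintegral_smul_measure, lintegral_dirac, smul_eq_mul]
  calc ∑' j : ℕ, ENNReal.ofReal (Real.exp (-n) * n ^ j / j !) *
        ENNReal.ofReal (Real.exp (X / (j + 1)))
      ≤ ∑' j : ℕ, ∑' k : ℕ, ENNReal.ofReal ((X / n) ^ k) *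
          ENNReal.ofReal (Real.exp (-n) * n ^ (j + k) / (j + k)!) := by
        refine ENNReal.tsum_le_tsum fun j => ?_
        refine (mul_le_mul_right (ofReal_exp_div_le hX j) _).trans_eq ?_
        rw [← ENNReal.tsum_mul_left]
        refine tsum_congr fun k => ?_
        rw [← ENNReal.ofReal_mul (by positivity), ← ENNReal.ofReal_mul (by positivity)]
        congr 1
        rw [pow_add, div_pow]
        field_simp
    _ = ∑' k : ℕ, ENNReal.ofReal ((X / n) ^ k) *
          ∑' j : ℕ, ENNReal.ofReal (Real.exp (-n) * n ^ (j + k) / (j + k)!) := by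
        rw [ENNReal.tsum_comm]
        simp_rw [ENNReal.tsum_mul_left]
    _ ≤ ∑' k : ℕ, ENNReal.ofReal ((X / n) ^ k) * 1 := by
        refine ENNReal.tsum_le_tsum fun k => mul_le_mul_right ?_ _
        rw [← hw]
        exact ENNReal.tsum_comp_le_tsum_of_injective (add_left_injective k)
          fun j => ENNReal.ofReal (Real.exp (-n) * n ^ j / j !)
    _ = _ := by
        simp_rw [mul_one]
        rw [← ENNReal.ofReal_tsum_of_nonneg (fun k => by positivity)
          (summable_geometric_of_lt_one hu0 hu1), tsum_geometric_of_lt_one hu0 hu1]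

theorem integrable_exp_div_poisson {X : ℝ} (hX : 0 ≤ X) (n : ℝ≥0) :
    Integrable (fun N : ℕ => Real.exp (X / (N + 1))) (poissonMeasure n) := by
  refine Integrable.of_bound .of_discrete (Real.exp X) (ae_of_all _ fun N => ?_)
  rw [Real.norm_eq_abs, abs_of_pos (Real.exp_pos _), Real.exp_le_exp]
  exact div_le_self hX (by linarith [(Nat.cast_nonneg N : (0 : ℝ) ≤ N)])

theorem integral_exp_div_poisson_sub_one_le {X : ℝ} {n : ℝ≥0} (hX : 0 ≤ X) (hn : 0 < n)
    (hXn : 2 * X ≤ n) :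
    ∫ N : ℕ, Real.exp (X / (N + 1)) ∂(poissonMeasure n) - 1 ≤ 2 * X / n := by
  have hn' : (0 : ℝ) < n := hn
  have h1 := lintegral_exp_div_poisson_le hX (n := n) (by linarith)
  have hu : X / n ≤ 1 / 2 := by rw [div_le_iff₀ hn']; linarith
  have hu0 : 0 ≤ X / n := by positivity
  rw [← ofReal_integral_eq_lintegral_ofReal (integrable_exp_div_poisson hX n)
    (ae_of_all _ fun _ => (Real.exp_pos _).le),
    ENNReal.ofReal_le_ofReal_iff (inv_nonneg.2 (by linarith))] at h1
  have h2 : (1 - X / n)⁻¹ ≤ 1 + 2 * (X / n) := by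
    rw [inv_eq_one_div, div_le_iff₀ (by linarith)]
    nlinarith
  have h3 : 2 * X / n = 2 * (X / n) := by ring
  linarith

end Poisson

/-! ### Acceptance probability averaged over the random sample size. -/

namespace NoisyProblem

variable {E Ω : Type*} [Fintype E] [DecidableEq E] [MeasurableSpace Ω] (P : NoisyProblem E Ω)

/-- Acceptance probability averaged over the random sample size. -/
def meanAccept (x y : E) (β n : ℝ≥0) : ℝ≥0∞ :=
  ∫⁻ N : ℕ, P.acceptProb x y β (N + 1) ∂(poissonMeasure n)

theorem meanAccept_le_one (x y : E) (β n : ℝ≥0) : P.meanAccept x y β n ≤ 1 := by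
  refine (lintegral_mono fun N => P.acceptProb_le_one x y β (N + 1)).trans ?_
  simp

theorem meanAccept_eq_zero {x y : E} (hx : x ∈ P.feasible) (hy : y ∉ P.feasible) (β n : ℝ≥0) :
    P.meanAccept x y β n = 0 := by
  simp [meanAccept, P.acceptProb_eq_zero hx hy β (Nat.succ_pos _)]

theorem toReal_acceptProb_mem (x y : E) (β : ℝ≥0) (N : ℕ) :
    (P.acceptProb x y β N).toReal ∈ Set.Icc (0 : ℝ) 1 :=
  ⟨ENNReal.toReal_nonneg, ENNReal.toReal_le_of_le_ofReal zero_le_one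
    (by simpa using P.acceptProb_le_one x y β N)⟩

theorem toReal_meanAccept (x y : E) (β n : ℝ≥0) :
    (P.meanAccept x y β n).toReal
      = ∫ N : ℕ, (P.acceptProb x y β (N + 1)).toReal ∂(poissonMeasure n) := by
  unfold meanAccept
  rw [integral_toReal .of_discrete
    (ae_of_all _ fun N => (P.acceptProb_le_one x y β _).trans_lt ENNReal.one_lt_top)]

/-- The excess over `θ / 2` is at most `2 X / (n θ)` with `X = β² M²`; the last hypothesis makes it
at most `θ / 2` too. -/
theorem abs_toReal_meanAccept_sub_le {x y : E} (hx : x ∈ P.feasible) (hy : y ∈ P.feasible)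
    {β n : ℝ≥0} (hn : 0 < n) (hβn : 2 * ((β : ℝ) ^ 2 * P.M ^ 2) ≤ n) {θ : ℝ} (hθ : 0 < θ)
    (hθn : 4 * ((β : ℝ) ^ 2 * P.M ^ 2) ≤ θ ^ 2 * n) :
    |(P.meanAccept x y β n).toReal
        - Real.exp (-(β * max ((P.J y).toReal - (P.J x).toReal) 0))|
      ≤ θ * Real.exp (-(β * max ((P.J y).toReal - (P.J x).toReal) 0)) := by
  set e := Real.exp (-(β * max ((P.J y).toReal - (P.J x).toReal) 0))
  set X := (β : ℝ) ^ 2 * P.M ^ 2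
  have hX : 0 ≤ X := by positivity
  have hint : Integrable (fun N : ℕ => (P.acceptProb x y β (N + 1)).toReal) (poissonMeasure n) :=
    Integrable.of_bound .of_discrete 1 (ae_of_all _ fun N => by
      rw [Real.norm_eq_abs, abs_of_nonneg (P.toReal_acceptProb_mem x y β _).1]
      exact (P.toReal_acceptProb_mem x y β _).2)
  have hsub : (P.meanAccept x y β n).toReal - e
      = ∫ N : ℕ, ((P.acceptProb x y β (N + 1)).toReal - e) ∂(poissonMeasure n) := by
    rw [integral_sub hint (integrable_const e), P.toReal_meanAccept]
    simp
  have hexp := integrable_exp_div_poisson hX n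
  have hn' : (0 : ℝ) < n := hn
  rw [hsub]
  calc |∫ N : ℕ, ((P.acceptProb x y β (N + 1)).toReal - e) ∂(poissonMeasure n)|
      ≤ ∫ N : ℕ, |(P.acceptProb x y β (N + 1)).toReal - e| ∂(poissonMeasure n) :=
        abs_integral_le_integral_abs
    _ ≤ ∫ N : ℕ, e * (θ / 2 + (Real.exp (X / (N + 1)) - 1) / θ) ∂(poissonMeasure n) := by
        refine integral_mono_of_nonneg (ae_of_all _ fun _ => abs_nonneg _)
          (((integrable_const _).add ((hexp.sub (integrable_const 1)).div_const θ)).const_mul e)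
          (ae_of_all _ fun N => ?_)
        simpa using P.abs_toReal_acceptProb_sub_le hx hy β (Nat.succ_pos N) hθ
    _ = e * (θ / 2 + (∫ N : ℕ, Real.exp (X / (N + 1)) ∂(poissonMeasure n) - 1) / θ) := by
        rw [integral_const_mul, integral_add (f := fun _ => θ / 2)
          (g := fun N : ℕ => (Real.exp (X / (N + 1)) - 1) / θ) (integrable_const _)
          ((hexp.sub (integrable_const 1)).div_const θ),
          integral_div _ (fun N : ℕ => Real.exp (X / (N + 1)) - 1),
          integral_sub hexp (integrable_const 1)]
        simp
    _ ≤ θ * e := by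
        rw [mul_comm θ]
        refine mul_le_mul_of_nonneg_left ?_ (Real.exp_pos _).le
        have h1 := integral_exp_div_poisson_sub_one_le hX hn hβn
        have h2 : (∫ N : ℕ, Real.exp (X / (N + 1)) ∂(poissonMeasure n) - 1) / θ ≤ θ / 2 := by
          rw [div_le_iff₀ hθ]
          refine h1.trans ?_
          rw [div_le_iff₀ hn']
          linarith
        linarith

theorem continuous_toReal_acceptProb (x y : E) (N : ℕ) :
    Continuous fun β : ℝ≥0 => (P.acceptProb x y β N).toReal := by
  have h : ∀ β : ℝ≥0, (P.acceptProb x y β N).toReal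
      = ∫ w : (Fin N → Ω) × (Fin N → Ω), (metropolis β (P.estimate y w.2 - P.estimate x w.1)).toReal
        ∂((Measure.pi fun _ => P.noise x).prod (Measure.pi fun _ => P.noise y)) := fun β => by
    unfold acceptProb
    rw [integral_toReal (P.measurable_metropolis_estimate x y β N).aemeasurable
      (ae_of_all _ fun w => (metropolis_le_one _ _).trans_lt ENNReal.one_lt_top)]
  simp_rw [h]
  refine continuous_of_dominated (bound := fun _ => 1)
    (fun β => (P.measurable_metropolis_estimate x y β N).ennreal_toReal.aestronglyMeasurable)
    (fun β => ae_of_all _ fun w => ?_) (integrable_const _) (ae_of_all _ fun w => ?_)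
  · rw [Real.norm_eq_abs, abs_of_nonneg ENNReal.toReal_nonneg]
    exact ENNReal.toReal_le_of_le_ofReal zero_le_one (by simpa using metropolis_le_one _ _)
  · unfold metropolis
    split_ifs
    · exact continuous_const
    · simp_rw [ENNReal.toReal_ofReal (Real.exp_pos _).le]
      fun_prop

/-- Acceptance probability of a proposed move at time `t`, averaged over the sample size. -/
def acceptAt (b α d t : ℝ) (x y : E) : ℝ :=
  (P.meanAccept x y (invTemp b d t) (intensity α d t)).toReal

theorem coe_intensity {α d t : ℝ} (h : 0 ≤ 1 + t * d) :
    (intensity α d t : ℝ) = (1 + t * d) ^ α := by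
  rw [intensity, Real.coe_toNNReal _ (Real.rpow_nonneg h α)]

theorem coe_invTemp {b d t : ℝ} (hb : 0 ≤ b) (h : 1 ≤ 1 + t * d) :
    (invTemp b d t : ℝ) = b * Real.log (1 + t * d) := by
  rw [invTemp, Real.coe_toNNReal _ (mul_nonneg hb (Real.log_nonneg h))]

/-- Weierstrass test on the Poisson series near `t`. Continuity in time makes the density
differentiable at every positive time, not just almost everywhere. -/
theorem continuousAt_acceptAt {b α d : ℝ} (hα : 0 ≤ α) (hd : 0 < d) (x y : E) {t : ℝ}
    (ht : 0 < t) : ContinuousAt (fun t => P.acceptAt b α d t x y) t := by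
  have h0 : ∀ s ∈ Set.Ioo 0 (t + 1), 0 < 1 + s * d := fun s hs => by
    have := mul_pos hs.1 hd; linarith
  have hβ : ContinuousOn (invTemp b d) (Set.Ioo 0 (t + 1)) := by
    unfold invTemp
    refine continuous_real_toNNReal.comp_continuousOn ?_
    refine continuousOn_const.mul (ContinuousOn.log (by fun_prop) fun s hs => (h0 s hs).ne')
  have hn : ContinuousOn (intensity α d) (Set.Ioo 0 (t + 1)) := by
    unfold intensity
    refine continuous_real_toNNReal.comp_continuousOn ?_
    exact ContinuousOn.rpow_const (by fun_prop) fun s hs => Or.inl (h0 s hs).ne'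
  have hsum : (fun t => P.acceptAt b α d t x y) = fun t => ∑' j : ℕ,
      Real.exp (-(intensity α d t)) * (intensity α d t : ℝ) ^ j / (Nat.factorial j) *
        (P.acceptProb x y (invTemp b d t) (j + 1)).toReal := by
    funext s
    rw [acceptAt, P.toReal_meanAccept, integral_poissonMeasure]
    rfl
  have hn' : ContinuousOn (fun s => (intensity α d s : ℝ)) (Set.Ioo 0 (t + 1)) :=
    NNReal.continuous_coe.comp_continuousOn hn
  rw [hsum]
  refine ContinuousOn.continuousAt (s := Set.Ioo 0 (t + 1)) ?_
    (Ioo_mem_nhds ht (lt_add_one t))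
  refine continuousOn_tsum (u := fun j : ℕ => ((1 + (t + 1) * d) ^ α) ^ j / (Nat.factorial j))
    (fun j => ?_) (Real.summable_pow_div_factorial _) fun j s hs => ?_
  · refine ContinuousOn.mul ?_ ((P.continuous_toReal_acceptProb x y (j + 1)).comp_continuousOn hβ)
    refine ContinuousOn.div_const (ContinuousOn.mul ?_ (hn'.pow j)) _
    exact Real.continuous_exp.comp_continuousOn hn'.neg
  · have hs0 := h0 s hs
    have hle : (intensity α d s : ℝ) ≤ (1 + (t + 1) * d) ^ α := by
      rw [coe_intensity hs0.le]
      refine Real.rpow_le_rpow hs0.le ?_ hα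
      have := mul_le_mul_of_nonneg_right hs.2.le hd.le
      linarith
    have hacc := P.toReal_acceptProb_mem x y (invTemp b d s) (j + 1)
    have hexp : Real.exp (-(intensity α d s)) ≤ 1 := by
      rw [Real.exp_le_one_iff]; simp
    rw [Real.norm_eq_abs, abs_of_nonneg (mul_nonneg (by positivity) hacc.1)]
    calc _ ≤ 1 * (intensity α d s : ℝ) ^ j / (Nat.factorial j) * 1 := by
          refine mul_le_mul ?_ hacc.2 hacc.1 (by positivity)
          gcongr
      _ ≤ _ := by
          rw [one_mul, mul_one]
          gcongr

/-- This fixes `α`: with `z = 1 + t d`, `n = z² (z ^ γ)²`, and the factor `(z ^ γ)²` absorbs the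
`log² z` of `β²`, leaving a relative error of order `1 / z`, the same as the cooling speed. -/
theorem exists_abs_acceptAt_sub_le {b α d γ : ℝ} (hb : 0 < b) (hd : 0 < d) (hγ : 0 < γ)
    (hα : α = 2 * (1 + γ)) :
    ∃ t₁ > 0, ∀ t ≥ t₁, ∀ x ∈ P.feasible, ∀ y ∈ P.feasible,
      |P.acceptAt b α d t x y
          - Real.exp (-(b * Real.log (1 + t * d) * max ((P.J y).toReal - (P.J x).toReal) 0))|
        ≤ 2 * b * P.M / (1 + t * d) *
          Real.exp (-(b * Real.log (1 + t * d) * max ((P.J y).toReal - (P.J x).toReal) 0)) := by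
  have hM := P.M_pos
  have hlim := tendsto_one_add_mul_atTop hd
  have h1 : ∀ᶠ t : ℝ in Filter.atTop, Real.log (1 + t * d) ≤ (1 + t * d) ^ γ := by
    have h := ((isLittleO_log_rpow_atTop hγ).bound one_pos)
    filter_upwards [hlim.eventually h, hlim.eventually_ge_atTop 1] with t ht ht1
    rw [Real.norm_eq_abs, Real.norm_eq_abs, one_mul,
      abs_of_nonneg (Real.rpow_nonneg (by linarith) _)] at ht
    exact (le_abs_self _).trans ht
  obtain ⟨t₀, ht₀⟩ := Filter.eventually_atTop.1
    (h1.and (hlim.eventually_ge_atTop (2 * (b * P.M))))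
  refine ⟨max t₀ 1, by positivity, fun t ht x hx y hy => ?_⟩
  obtain ⟨hlog, hbM⟩ := ht₀ t ((le_max_left _ _).trans ht)
  have ht1 : 1 ≤ t := (le_max_right _ _).trans ht
  have htd : 0 < t * d := by positivity
  set z := 1 + t * d with hz
  have hz0 : 0 < z := by linarith
  have hz1 : 1 ≤ z := by linarith
  have hβ := coe_invTemp (b := b) (d := d) (t := t) hb.le hz1
  have hn := coe_intensity (α := α) (d := d) (t := t) hz0.le
  rw [← hz] at hβ hn
  have hL : 0 ≤ Real.log z := Real.log_nonneg hz1
  have hpow : z ^ α = z ^ 2 * (z ^ γ) ^ 2 := by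
    rw [hα, ← Real.rpow_natCast (z ^ γ), ← Real.rpow_mul hz0.le, ← Real.rpow_natCast z,
      ← Real.rpow_add hz0]
    congr 1; push_cast; ring
  have hL2 : (Real.log z) ^ 2 ≤ (z ^ γ) ^ 2 := pow_le_pow_left₀ hL hlog 2
  rw [← hβ]
  -- Applied with `θ = 2 b M / z`.
  refine P.abs_toReal_meanAccept_sub_le hx hy ?_ ?_ (by positivity) ?_
  · rw [← NNReal.coe_pos, hn]; positivity
  · rw [hβ, hn, hpow]
    have h2 : (2 * (b * P.M)) ^ 2 ≤ z ^ 2 := pow_le_pow_left₀ (by positivity) hbM 2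
    have h3 : (2 * (b * P.M)) ^ 2 * Real.log z ^ 2 ≤ z ^ 2 * (z ^ γ) ^ 2 := by gcongr
    have h4 : 0 ≤ (b * P.M * Real.log z) ^ 2 := sq_nonneg _
    linarith
  · rw [hβ, hn, hpow, div_pow]
    have h3 : (2 * b * P.M) ^ 2 / z ^ 2 * (z ^ 2 * (z ^ γ) ^ 2)
        = (2 * b * P.M) ^ 2 * (z ^ γ) ^ 2 := by field_simp
    rw [h3]
    have h4 : (2 * b * P.M) ^ 2 * Real.log z ^ 2 ≤ (2 * b * P.M) ^ 2 * (z ^ γ) ^ 2 := by gcongr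
    linarith

end NoisyProblem

/-! ### Renewal identities for the unit exponential law. -/

section Exponential

theorem measurable_exponentialPDF_one : Measurable (exponentialPDF 1) :=
  (measurable_exponentialPDFReal 1).ennreal_ofReal

theorem exponentialPDF_one_of_nonneg {u : ℝ} (hu : 0 ≤ u) :
    exponentialPDF 1 u = ENNReal.ofReal (Real.exp (-u)) := by
  rw [exponentialPDF_of_nonneg hu]; simp

theorem lintegral_expMeasure_add {g : ℝ → ℝ≥0∞} (hg : Measurable g) (T : ℝ) :
    ∫⁻ u, g (T + u) ∂(expMeasure 1) = ∫⁻ s, exponentialPDF 1 (s - T) * g s := by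
  have h1 : ∫⁻ u, g (T + u) ∂(expMeasure 1) = ∫⁻ u, exponentialPDF 1 u * g (T + u) := by
    rw [expMeasure, gammaMeasure]
    change ∫⁻ u, g (T + u) ∂(volume.withDensity (exponentialPDF 1)) = _
    rw [lintegral_withDensity_eq_lintegral_mul _ measurable_exponentialPDF_one (by fun_prop)]
    rfl
  rw [h1, ← lintegral_add_right_eq_self (fun s => exponentialPDF 1 (s - T) * g s) T]
  simp [add_comm]

/-- Distribution function plus survival function. -/
theorem lintegral_exponentialPDF_Iic_add (r : ℝ) :
    (∫⁻ u in Set.Iic r, exponentialPDF 1 u) + exponentialPDF 1 r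
      = (Set.Ici (0 : ℝ)).indicator 1 r := by
  rw [lintegral_exponentialPDF_eq_antiDeriv one_pos]
  rcases lt_or_ge r 0 with h | h
  · rw [if_neg h.not_ge, exponentialPDF_of_neg h, Set.indicator_of_notMem (by simpa using h)]
    simp
  · rw [if_pos h, exponentialPDF_one_of_nonneg h, Set.indicator_of_mem (by simpa using h),
      ← ENNReal.ofReal_add (by rw [sub_nonneg, Real.exp_le_one_iff]; linarith)
        (Real.exp_pos _).le]
    simp

theorem lintegral_exponentialPDF_sub_Iic_add (r T : ℝ) :
    (∫⁻ s, exponentialPDF 1 (s - T) * (Set.Iic r).indicator 1 s) + exponentialPDF 1 (r - T)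
      = (Set.Ici T).indicator 1 r := by
  have h1 : ∫⁻ s, exponentialPDF 1 (s - T) * (Set.Iic r).indicator 1 s
      = ∫⁻ u in Set.Iic (r - T), exponentialPDF 1 u := by
    rw [← lintegral_add_right_eq_self (fun s => exponentialPDF 1 (s - T) *
      (Set.Iic r).indicator 1 s) T, ← lintegral_indicator measurableSet_Iic]
    refine lintegral_congr fun u => ?_
    by_cases h : u ≤ r - T
    · rw [Set.indicator_of_mem (show u ∈ Set.Iic (r - T) from h),
        Set.indicator_of_mem (show u + T ∈ Set.Iic r by simp; linarith)]
      simp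
    · rw [Set.indicator_of_notMem (show u ∉ Set.Iic (r - T) from h),
        Set.indicator_of_notMem (show u + T ∉ Set.Iic r by simp at h ⊢; linarith)]
      simp
  rw [h1, lintegral_exponentialPDF_Iic_add]
  simp [Set.indicator]

/-- The indicator of nonnegative times solves the renewal equation of the total mass; it is the
invariant bound of the induction in `sum_range_occ_le`. -/
theorem lintegral_exponentialPDF_Ici_add (t : ℝ) :
    (∫⁻ s, exponentialPDF 1 (t - s) * (Set.Ici 0).indicator 1 s) + exponentialPDF 1 t
      = (Set.Ici (0 : ℝ)).indicator 1 t := by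
  rw [← lintegral_exponentialPDF_Iic_add t, ← lintegral_sub_left_eq_self _ t,
    ← lintegral_indicator measurableSet_Iic]
  congr 1
  refine lintegral_congr fun u => ?_
  simp only [Set.indicator, Set.mem_Ici, Set.mem_Iic, sub_sub_cancel, sub_nonneg, Pi.one_apply]
  split_ifs <;> simp

/-- For rate one, the survival function equals the density. The later formulas use the density in
both roles. -/
theorem lintegral_exponentialPDF_Ioi {t T : ℝ} (hT : T ≤ t) :
    ∫⁻ s, exponentialPDF 1 (s - T) * (Set.Ioi t).indicator 1 s = exponentialPDF 1 (t - T) := by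
  have h1 := lintegral_exponentialPDF_sub_Iic_add t T
  rw [Set.indicator_of_mem (show t ∈ Set.Ici T from hT)] at h1
  have h2 : (∫⁻ s, exponentialPDF 1 (s - T) * (Set.Iic t).indicator 1 s)
      + ∫⁻ s, exponentialPDF 1 (s - T) * (Set.Ioi t).indicator 1 s = 1 := by
    rw [← lintegral_add_left]
    · have h3 : ∀ s, exponentialPDF 1 (s - T) * (Set.Iic t).indicator 1 s
          + exponentialPDF 1 (s - T) * (Set.Ioi t).indicator 1 s = exponentialPDF 1 (s - T) := by
        intro s
        rcases le_or_gt s t with h | h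
        · simp [Set.indicator, h, h.not_gt]
        · simp [Set.indicator, h, h.not_ge]
      simp_rw [h3]
      rw [lintegral_sub_right_eq_self (exponentialPDF 1), lintegral_exponentialPDF_eq_one one_pos]
    · exact (measurable_exponentialPDF_one.comp (by fun_prop)).mul
        (measurable_one.indicator measurableSet_Iic)
  have h4 : ∫⁻ s, exponentialPDF 1 (s - T) * (Set.Iic t).indicator 1 s ≠ ⊤ := by
    intro h; rw [h] at h2; simp at h2
  rw [Pi.one_apply, ← h2] at h1
  exact ((ENNReal.add_right_inj h4).1 h1).symm

end Exponential

/-! ### Transition probabilities of one step of the algorithm. -/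

namespace NoisyProblem

variable {E Ω : Type*} [Fintype E] [DecidableEq E] [MeasurableSpace Ω] (P : NoisyProblem E Ω)

/-- One-step transition probabilities at time `s`, averaged over the sample size. -/
def moveProb (b α d s : ℝ) (x y : E) : ℝ≥0∞ :=
  ∑ z, ENNReal.ofReal (P.q x z) *
    (P.meanAccept x z (invTemp b d s) (intensity α d s) * (if z = y then 1 else 0)
      + (1 - P.meanAccept x z (invTemp b d s) (intensity α d s)) * (if x = y then 1 else 0))

theorem sum_moveProb (b α d s : ℝ) (x : E) : ∑ y, P.moveProb b α d s x y = 1 := by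
  unfold moveProb
  rw [Finset.sum_comm]
  simp only [← Finset.mul_sum, Finset.sum_add_distrib, Finset.sum_ite_eq, Finset.mem_univ, if_true,
    mul_one, add_tsub_cancel_of_le (P.meanAccept_le_one x _ _ _)]
  rw [← ENNReal.ofReal_sum_of_nonneg fun y _ => P.q_nonneg x y, P.q_sum, ENNReal.ofReal_one]

theorem moveProb_le_one (b α d s : ℝ) (x y : E) : P.moveProb b α d s x y ≤ 1 :=
  (P.sum_moveProb b α d s x).symm ▸ Finset.single_le_sum
    (f := P.moveProb b α d s x) (fun _ _ => zero_le) (Finset.mem_univ y)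

theorem moveProb_eq_zero {x y : E} (hx : x ∈ P.feasible) (hy : y ∉ P.feasible) (b α d s : ℝ) :
    P.moveProb b α d s x y = 0 := by
  have hxy : x ≠ y := fun h => hy (h ▸ hx)
  refine Finset.sum_eq_zero fun z _ => ?_
  by_cases hz : z = y
  · rw [hz, P.meanAccept_eq_zero hx hy]; simp [hxy]
  · simp [hz, hxy]

theorem lintegral_poissonMeasure (n : ℝ≥0) (g : ℕ → ℝ≥0∞) :
    ∫⁻ N, g N ∂(poissonMeasure n)
      = ∑' j : ℕ, ENNReal.ofReal (Real.exp (-n) * n ^ j / (Nat.factorial j)) * g j := by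
  rw [poissonMeasure, lintegral_sum_measure]
  simp only [lintegral_smul_measure, lintegral_dirac, smul_eq_mul]

theorem measurable_meanAccept (b α d : ℝ) (x y : E) :
    Measurable fun s => P.meanAccept x y (invTemp b d s) (intensity α d s) := by
  unfold meanAccept
  simp_rw [lintegral_poissonMeasure]
  have h1 := measurable_intensity α d
  refine Measurable.tsum fun j => ?_
  refine Measurable.mul (by fun_prop) ?_
  exact (P.measurable_acceptProb x y (j + 1)).comp (measurable_invTemp b d)

theorem measurable_moveProb (b α d : ℝ) (x y : E) :
    Measurable fun s => P.moveProb b α d s x y := by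
  unfold moveProb
  refine Finset.measurable_fun_sum _ fun z _ => Measurable.const_mul ?_ _
  have h := P.measurable_meanAccept b α d x z
  exact (h.mul_const _).add ((measurable_const.sub h).mul_const _)

variable [MeasurableSpace E] [DiscreteMeasurableSpace E]

theorem lintegral_moveLaw_singleton (b α d s : ℝ) (x y : E) :
    ∫⁻ N : ℕ, P.moveLaw x (invTemp b d s) (N + 1) {y} ∂(poissonMeasure (intensity α d s))
      = P.moveProb b α d s x y := by
  have h1 : ∫⁻ N : ℕ, ∑ z, ENNReal.ofReal (P.q x z) *
      (P.acceptProb x z (invTemp b d s) (N + 1) * (if z = y then 1 else 0)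
        + (1 - P.acceptProb x z (invTemp b d s) (N + 1)) * (if x = y then 1 else 0))
      ∂(poissonMeasure (intensity α d s)) = P.moveProb b α d s x y := by
    rw [lintegral_finsetSum _ fun z _ => .of_discrete]
    refine Finset.sum_congr rfl fun z _ => ?_
    rw [lintegral_const_mul _ .of_discrete, lintegral_add_left .of_discrete,
      lintegral_mul_const _ .of_discrete, lintegral_mul_const _ .of_discrete,
      lintegral_sub .of_discrete
        (ne_top_of_le_ne_top ENNReal.one_ne_top (P.meanAccept_le_one x z _ _))
        (ae_of_all _ fun N => P.acceptProb_le_one x z _ _)]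
    simp [meanAccept]
  rw [← h1]
  refine lintegral_congr fun N => ?_
  simp only [moveLaw, Measure.coe_finsetSum, Finset.sum_apply, Measure.smul_apply,
    Measure.add_apply, smul_eq_mul]
  refine Finset.sum_congr rfl fun z _ => ?_
  simp only [Measure.dirac_apply' _ (measurableSet_singleton y), Set.indicator,
    Set.mem_singleton_iff, Pi.one_apply]

/-- Integration against one step of the algorithm. -/
theorem lintegral_stepKernel (b α d : ℝ) (z : E × ℝ × ℕ) {φ : E × ℝ × ℕ → ℝ≥0∞}
    (hφ : Measurable φ) :
    ∫⁻ z', φ z' ∂(P.stepKernel b α d z)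
      = ∫⁻ s, exponentialPDF 1 (s - z.2.1) *
          ∫⁻ N : ℕ, ∫⁻ y, φ (y, s, N + 1) ∂(P.moveLaw z.1 (invTemp b d s) (N + 1))
            ∂(poissonMeasure (intensity α d s)) := by
  have hφ1 : Measurable fun p : (ℝ × ℕ) × E => φ (p.2, p.1.1, p.1.2) := hφ.comp (by fun_prop)
  have hinner : Measurable fun p : ℝ × ℕ =>
      ∫⁻ y, φ (y, p.1, p.2) ∂(P.moveKernel b d (z, p)) := by
    have h := Measurable.lintegral_kernel_prod_right (κ := P.moveKernel b d)
      (f := fun (a : (E × ℝ × ℕ) × ℝ × ℕ) (y : E) => φ (y, a.2.1, a.2.2))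
      (hφ.comp (by fun_prop))
    exact h.comp measurable_prodMk_left
  have hinner2 : Measurable fun s : ℝ => ∫⁻ N, ∫⁻ y, φ (y, s, N) ∂(P.moveKernel b d (z, (s, N)))
      ∂(sizeKernel E α d (z, s)) := by
    have h := Measurable.lintegral_kernel_prod_right
      (κ := (sizeKernel E α d).comap (fun s : ℝ => (z, s)) measurable_prodMk_left)
      (f := fun (s : ℝ) (N : ℕ) => ∫⁻ y, φ (y, s, N) ∂(P.moveKernel b d (z, (s, N)))) hinner
    exact h
  rw [stepKernel, Kernel.lintegral_map _ (by fun_prop) _ hφ, Kernel.lintegral_compProd _ _ _ hφ1,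
    Kernel.lintegral_compProd _ _ _ hinner, timeKernel, Kernel.lintegral_map _ (by fun_prop) _ hinner2]
  have hG : Measurable fun a : (E × ℝ × ℕ) × ℝ => a.1.2.1 + a.2 := by fun_prop
  refine (Kernel.lintegral_id_prod (hinner2.comp hG)
    (Kernel.const (E × ℝ × ℕ) (expMeasure 1)) z).trans ?_
  simp only [Kernel.const_apply, Function.comp_apply]
  rw [lintegral_expMeasure_add hinner2]
  refine lintegral_congr fun s => ?_
  congr 1
  rw [sizeKernel, Kernel.lintegral_map _ (by fun_prop) _ .of_discrete, Kernel.lintegral_comap]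
  rfl

end NoisyProblem

/-! ### Occupation probabilities and the renewal equation. -/

namespace NoisyProblem

variable {E Ω : Type*} [Fintype E] [DecidableEq E] [MeasurableSpace Ω] (P : NoisyProblem E Ω)
  [MeasurableSpace E] [DiscreteMeasurableSpace E] (b α d : ℝ) (ν : Measure E)

theorem map_law_zero :
    (P.law b α d ν).map (fun h => h 0) = ν.map fun x : E => ((x, 0, 0) : E × ℝ × ℕ) := by
  set κ : (n : ℕ) → Kernel ((i : Finset.Iic n) → E × ℝ × ℕ) (E × ℝ × ℕ) := fun n =>
    (P.stepKernel b α d).comap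
      (fun h : (i : Finset.Iic n) → E × ℝ × ℕ => h ⟨n, Finset.mem_Iic.2 le_rfl⟩)
      (measurable_pi_apply _) with hκ
  change (Kernel.trajMeasure (X := fun _ : ℕ => E × ℝ × ℕ)
    (ν.map fun x : E => ((x, 0, 0) : E × ℝ × ℕ)) κ).map (fun h => h 0) = _
  have h1 : (fun h : ℕ → E × ℝ × ℕ => h 0)
      = (fun g : (i : Finset.Iic 0) → E × ℝ × ℕ => g ⟨0, Finset.mem_Iic.2 le_rfl⟩) ∘
        Preorder.frestrictLe 0 := rfl
  rw [h1, ← Measure.map_map (by fun_prop) (by fun_prop), Kernel.trajMeasure,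
    Measure.map_comp _ _ (by fun_prop), Kernel.traj_map_frestrictLe, Kernel.partialTraj_self,
    Measure.id_comp, Measure.map_map (by fun_prop) (by fun_prop)]
  exact Measure.map_id

theorem lintegral_law_zero {φ : E × ℝ × ℕ → ℝ≥0∞} (hφ : Measurable φ) :
    ∫⁻ h, φ (h 0) ∂(P.law b α d ν) = ∫⁻ x, φ (x, 0, 0) ∂ν := by
  rw [← lintegral_map (g := fun h : ℕ → E × ℝ × ℕ => h 0) hφ (by fun_prop), map_law_zero,
    lintegral_map hφ (by fun_prop)]

theorem ae_law_zero : ∀ᵐ h ∂(P.law b α d ν), (h 0).2.1 = 0 := by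
  have hm : MeasurableSet {z : E × ℝ × ℕ | z.2.1 = 0} :=
    measurableSet_eq_fun (by fun_prop) measurable_const
  have h1 : ∀ᵐ z ∂((P.law b α d ν).map fun h => h 0), z.2.1 = 0 := by
    rw [map_law_zero, ae_map_iff (by fun_prop) hm]
    exact ae_of_all _ fun _ => rfl
  exact (ae_map_iff (measurable_pi_apply 0).aemeasurable hm).1 h1

/-- Probability that exactly `k` jumps occurred before time `t` and that the current solution
is `x`, written through the survival function of the next waiting time. -/
def occ (k : ℕ) (t : ℝ) (x : E) : ℝ≥0∞ :=
  ∫⁻ h, (if (h k).1 = x then exponentialPDF 1 (t - (h k).2.1) else 0) ∂(P.law b α d ν)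

theorem measurable_ite_exponentialPDF (x : E) :
    Measurable fun p : ℝ × (E × ℝ × ℕ) =>
      if p.2.1 = x then exponentialPDF 1 (p.1 - p.2.2.1) else 0 :=
  Measurable.ite (measurableSet_eq_fun (by fun_prop) measurable_const)
    (measurable_exponentialPDF_one.comp (by fun_prop)) measurable_const

theorem occ_zero (t : ℝ) (x : E) :
    P.occ b α d ν 0 t x = exponentialPDF 1 t * ν {x} := by
  have hm : Measurable fun z : E × ℝ × ℕ => if z.1 = x then exponentialPDF 1 (t - z.2.1) else 0 :=
    (measurable_ite_exponentialPDF x).comp measurable_prodMk_left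
  rw [occ, P.lintegral_law_zero b α d ν hm]
  simp only [sub_zero]
  rw [← lintegral_indicator_const (measurableSet_singleton x)]
  refine lintegral_congr fun y => ?_
  simp [Set.indicator]

variable [IsProbabilityMeasure ν]

instance isProbabilityMeasure_initial :
    IsProbabilityMeasure (ν.map fun x : E => ((x, 0, 0) : E × ℝ × ℕ)) :=
  Measure.isProbabilityMeasure_map (by fun_prop)

instance isProbabilityMeasure_law : IsProbabilityMeasure (P.law b α d ν) := by
  unfold law
  infer_instance

/-- The Markov property, in the only form needed: the joint law of two consecutive states. -/
theorem lintegral_law_succ {k : ℕ} {Φ : (E × ℝ × ℕ) × (E × ℝ × ℕ) → ℝ≥0∞} (hΦ : Measurable Φ) :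
    ∫⁻ h, Φ (h k, h (k + 1)) ∂(P.law b α d ν)
      = ∫⁻ h, ∫⁻ z, Φ (h k, z) ∂(P.stepKernel b α d (h k)) ∂(P.law b α d ν) := by
  set κ : (n : ℕ) → Kernel ((i : Finset.Iic n) → E × ℝ × ℕ) (E × ℝ × ℕ) := fun n =>
    (P.stepKernel b α d).comap
      (fun h : (i : Finset.Iic n) → E × ℝ × ℕ => h ⟨n, Finset.mem_Iic.2 le_rfl⟩)
      (measurable_pi_apply _) with hκ
  have h1 := Kernel.map_frestrictLe_trajMeasure_compProd_eq_map_trajMeasure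
    (X := fun _ : ℕ => E × ℝ × ℕ) (κ := κ) (μ₀ := ν.map fun x : E => ((x, 0, 0) : E × ℝ × ℕ))
    (a := k)
  set f : ((i : Finset.Iic k) → E × ℝ × ℕ) × (E × ℝ × ℕ) → ℝ≥0∞ := fun p =>
    Φ (p.1 ⟨k, Finset.mem_Iic.2 le_rfl⟩, p.2) with hf
  have hfm : Measurable f := hΦ.comp (by fun_prop)
  have h2 := congrArg (fun m => ∫⁻ p, f p ∂m) h1
  rw [Measure.lintegral_compProd hfm, lintegral_map hfm (by fun_prop),
    lintegral_map hfm.lintegral_kernel_prod_right' (by fun_prop)] at h2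
  exact h2.symm

theorem measurable_occ (k : ℕ) (x : E) : Measurable fun t => P.occ b α d ν k t x := by
  unfold occ
  exact Measurable.lintegral_prod_right (f := fun (t : ℝ) (h : ℕ → E × ℝ × ℕ) =>
    if (h k).1 = x then exponentialPDF 1 (t - (h k).2.1) else 0)
    ((measurable_ite_exponentialPDF x).comp
      (g := fun p : ℝ × (E × ℝ × ℕ) => if p.2.1 = x then exponentialPDF 1 (p.1 - p.2.2.1) else 0)
      (f := fun p : ℝ × (ℕ → E × ℝ × ℕ) => (p.1, p.2 k)) (by fun_prop))

/-- Condition on the time `s` of jump `k + 1`. Its density given `T_k` is also the survival function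
in `occ k s`, so the integrand closes up as `occ k s y`; the remaining factor is survival from `s`
to `t`. -/
theorem occ_succ (k : ℕ) (t : ℝ) (x : E) :
    P.occ b α d ν (k + 1) t x
      = ∫⁻ s, exponentialPDF 1 (t - s) * ∑ y, P.occ b α d ν k s y * P.moveProb b α d s y x := by
  have hm : Measurable fun z : E × ℝ × ℕ => if z.1 = x then exponentialPDF 1 (t - z.2.1) else 0 :=
    (measurable_ite_exponentialPDF x).comp measurable_prodMk_left
  have h1 : P.occ b α d ν (k + 1) t x = ∫⁻ h, (∫⁻ s, exponentialPDF 1 (s - (h k).2.1) *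
      (exponentialPDF 1 (t - s) * P.moveProb b α d s (h k).1 x)) ∂(P.law b α d ν) := by
    rw [occ, P.lintegral_law_succ b α d ν (Φ := fun p =>
      if p.2.1 = x then exponentialPDF 1 (t - p.2.2.1) else 0) (hm.comp measurable_snd)]
    refine lintegral_congr fun h => ?_
    rw [P.lintegral_stepKernel b α d (h k) hm]
    refine lintegral_congr fun s => ?_
    rw [← P.lintegral_moveLaw_singleton, ← lintegral_const_mul (exponentialPDF 1 (t - s)) .of_discrete]
    congr 1
    refine lintegral_congr fun N => ?_
    rw [← lintegral_indicator_const (measurableSet_singleton x)]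
    refine lintegral_congr fun y => ?_
    simp [Set.indicator]
  have hmeas : ∀ y, Measurable fun p : ℝ × (ℕ → E × ℝ × ℕ) => exponentialPDF 1 (t - p.1) *
      ((if (p.2 k).1 = y then exponentialPDF 1 (p.1 - (p.2 k).2.1) else 0)
        * P.moveProb b α d p.1 y x) := by
    intro y
    refine (measurable_exponentialPDF_one.comp (by fun_prop)).mul (Measurable.mul ?_ ?_)
    · exact (measurable_ite_exponentialPDF y).comp
        (g := fun p : ℝ × (E × ℝ × ℕ) => if p.2.1 = y then exponentialPDF 1 (p.1 - p.2.2.1) else 0)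
        (f := fun p : ℝ × (ℕ → E × ℝ × ℕ) => (p.1, p.2 k)) (by fun_prop)
    · exact (P.measurable_moveProb b α d y x).comp measurable_fst
  -- Splitting over the value `y` of the current solution lets the transition probability leave the
  -- expectation.
  have h2 : ∀ (h : ℕ → E × ℝ × ℕ) (s : ℝ), exponentialPDF 1 (s - (h k).2.1) *
      (exponentialPDF 1 (t - s) * P.moveProb b α d s (h k).1 x)
      = ∑ y, exponentialPDF 1 (t - s) *
        ((if (h k).1 = y then exponentialPDF 1 (s - (h k).2.1) else 0)
          * P.moveProb b α d s y x) := by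
    intro h s
    rw [Finset.sum_eq_single (h k).1]
    · rw [if_pos rfl]; ring
    · intro y _ hy
      rw [if_neg (Ne.symm hy)]; simp
    · simp
  simp_rw [h1, h2]
  rw [lintegral_lintegral_swap]
  · refine lintegral_congr fun s => ?_
    have hms : ∀ y, Measurable fun h : ℕ → E × ℝ × ℕ =>
        if (h k).1 = y then exponentialPDF 1 (s - (h k).2.1) else 0 := fun y =>
      (measurable_ite_exponentialPDF y).comp
        (g := fun p : ℝ × (E × ℝ × ℕ) => if p.2.1 = y then exponentialPDF 1 (p.1 - p.2.2.1) else 0)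
        (f := fun h : ℕ → E × ℝ × ℕ => (s, h k)) (by fun_prop)
    rw [lintegral_finsetSum _ fun y _ => ((hms y).mul_const _).const_mul _, Finset.mul_sum]
    refine Finset.sum_congr rfl fun y _ => ?_
    rw [lintegral_const_mul _ ((hms y).mul_const _), lintegral_mul_const _ (hms y)]
    rfl
  · exact ((Finset.measurable_fun_sum _ fun y _ => hmeas y).comp measurable_swap).aemeasurable

/-- Law of the continuous-time process. -/
def occTotal (t : ℝ) (x : E) : ℝ≥0∞ := ∑' k, P.occ b α d ν k t x

theorem measurable_occTotal (x : E) : Measurable fun t => P.occTotal b α d ν t x :=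
  Measurable.tsum fun k => P.measurable_occ b α d ν k x

theorem occTotal_eq (t : ℝ) (x : E) :
    P.occTotal b α d ν t x = exponentialPDF 1 t * ν {x} + ∫⁻ s, exponentialPDF 1 (t - s) *
      ∑ y, P.occTotal b α d ν s y * P.moveProb b α d s y x := by
  rw [occTotal, tsum_eq_zero_add' ENNReal.summable, occ_zero]
  congr 1
  simp_rw [occ_succ]
  rw [← lintegral_tsum]
  · refine lintegral_congr fun s => ?_
    rw [ENNReal.tsum_mul_left]
    congr 1
    simp_rw [occTotal, ← ENNReal.tsum_mul_right]
    exact Summable.tsum_finsetSum fun _ _ => ENNReal.summable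
  · intro k
    refine ((measurable_exponentialPDF_one.comp (by fun_prop)).mul
      (Finset.measurable_fun_sum _ fun y _ => ?_)).aemeasurable
    exact (P.measurable_occ b α d ν k y).mul (P.measurable_moveProb b α d y x)

/-- Partial sums are subsolutions of the renewal equation solved by the indicator. Only an upper
bound is needed here; total mass one is recovered from the ODE in `sum_density`. -/
theorem sum_range_occ_le (n : ℕ) (t : ℝ) :
    ∑ k ∈ Finset.range n, ∑ x, P.occ b α d ν k t x ≤ (Set.Ici (0 : ℝ)).indicator 1 t := by
  have hν : ∑ x, ν {x} = 1 := by
    rw [sum_measure_singleton, Finset.coe_univ, measure_univ]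
  induction n generalizing t with
  | zero => simp
  | succ n ih =>
    rw [Finset.sum_range_succ']
    have h0 : ∑ x, P.occ b α d ν 0 t x = exponentialPDF 1 t := by
      simp_rw [occ_zero, ← Finset.mul_sum, hν, mul_one]
    have h1 : ∀ k, ∑ x, P.occ b α d ν (k + 1) t x
        = ∫⁻ s, exponentialPDF 1 (t - s) * ∑ y, P.occ b α d ν k s y := by
      intro k
      simp_rw [occ_succ]
      rw [← lintegral_finsetSum]
      · refine lintegral_congr fun s => ?_
        rw [← Finset.mul_sum, Finset.sum_comm]
        simp_rw [← Finset.mul_sum, sum_moveProb, mul_one]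
      · intro x _
        refine (measurable_exponentialPDF_one.comp (by fun_prop)).mul
          (Finset.measurable_fun_sum _ fun y _ => ?_)
        exact (P.measurable_occ b α d ν k y).mul (P.measurable_moveProb b α d y x)
    rw [h0, ← lintegral_exponentialPDF_Ici_add t]
    refine add_le_add_left ?_ _
    simp_rw [h1]
    rw [← lintegral_finsetSum]
    · refine lintegral_mono fun s => ?_
      rw [← Finset.mul_sum]
      exact mul_le_mul_right (ih s) _
    · intro k _
      exact (measurable_exponentialPDF_one.comp (by fun_prop)).mul
        (Finset.measurable_fun_sum _ fun y _ => P.measurable_occ b α d ν k y)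

theorem sum_occTotal_le (t : ℝ) :
    ∑ x, P.occTotal b α d ν t x ≤ (Set.Ici (0 : ℝ)).indicator 1 t := by
  unfold occTotal
  rw [← Summable.tsum_finsetSum fun _ _ => ENNReal.summable]
  exact ENNReal.tsum_le_of_sum_range_le fun n => P.sum_range_occ_le b α d ν n t

theorem occTotal_le_one (t : ℝ) (x : E) : P.occTotal b α d ν t x ≤ 1 :=
  (Finset.single_le_sum (f := P.occTotal b α d ν t) (fun _ _ => zero_le)
    (Finset.mem_univ x)).trans ((P.sum_occTotal_le b α d ν t).trans
      (Set.indicator_le_self _ _ _))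

theorem occTotal_of_neg {t : ℝ} (ht : t < 0) (x : E) : P.occTotal b α d ν t x = 0 := by
  have h := P.sum_occTotal_le b α d ν t
  rw [Set.indicator_of_notMem (by simpa using ht), nonpos_iff_eq_zero, Finset.sum_eq_zero_iff] at h
  exact h x (Finset.mem_univ x)

theorem occ_eq_zero (hν : ν P.feasibleᶜ = 0) {x : E} (hx : x ∉ P.feasible) (k : ℕ) (t : ℝ) :
    P.occ b α d ν k t x = 0 := by
  induction k generalizing t x with
  | zero =>
    rw [occ_zero, measure_mono_null (Set.singleton_subset_iff.2 hx) hν, mul_zero]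
  | succ k ih =>
    rw [occ_succ]
    refine (lintegral_congr fun s => ?_).trans lintegral_zero
    rw [Finset.sum_eq_zero, mul_zero]
    intro y _
    by_cases hy : y ∈ P.feasible
    · rw [P.moveProb_eq_zero hy hx, mul_zero]
    · rw [ih hy, zero_mul]

theorem occTotal_eq_zero (hν : ν P.feasibleᶜ = 0) {x : E} (hx : x ∉ P.feasible) (t : ℝ) :
    P.occTotal b α d ν t x = 0 := by
  simp [occTotal, P.occ_eq_zero b α d ν hν hx]

end NoisyProblem

/-! ### Functionals of the jumps: non-explosion, law of the process, number of evaluations. -/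

namespace NoisyProblem

variable {E Ω : Type*} [Fintype E] [DecidableEq E] [MeasurableSpace Ω] (P : NoisyProblem E Ω)
  [MeasurableSpace E] [DiscreteMeasurableSpace E] (b α d : ℝ) (ν : Measure E)
  [IsProbabilityMeasure ν]

/-- Renewal identity for unit-rate exponential waiting times. -/
theorem lintegral_exponentialPDF_mul_add_lintegral {w : ℝ → ℝ≥0∞} (hw : Measurable w) (T : ℝ) :
    ∫⁻ s, exponentialPDF 1 (s - T) * (w s + ∫⁻ r, (Set.Ici s).indicator w r)
      = ∫⁻ r, (Set.Ici T).indicator w r := by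
  have hpdf : Measurable fun s => exponentialPDF 1 (s - T) :=
    measurable_exponentialPDF_one.comp (by fun_prop)
  have hjoint : Measurable fun p : ℝ × ℝ => (Set.Iic p.2).indicator (1 : ℝ → ℝ≥0∞) p.1 :=
    (measurable_const (a := (1 : ℝ≥0∞))).indicator
      (measurableSet_le measurable_fst measurable_snd)
  have hind : ∀ s r : ℝ, (Set.Ici s).indicator w r = w r * (Set.Iic r).indicator 1 s := by
    intro s r
    by_cases h : s ≤ r <;> simp [Set.indicator, h]
  calc ∫⁻ s, exponentialPDF 1 (s - T) * (w s + ∫⁻ r, (Set.Ici s).indicator w r)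
      = (∫⁻ s, exponentialPDF 1 (s - T) * w s) + ∫⁻ s, ∫⁻ r, w r *
          (exponentialPDF 1 (s - T) * (Set.Iic r).indicator 1 s) := by
        have hpw : Measurable fun s => exponentialPDF 1 (s - T) * w s := hpdf.mul hw
        rw [← lintegral_add_left hpw]
        refine lintegral_congr fun s => ?_
        simp_rw [mul_add, hind]
        congr 1
        rw [← lintegral_const_mul]
        · refine lintegral_congr fun r => by ring
        · exact hw.mul (hjoint.comp measurable_prodMk_left)
    _ = (∫⁻ r, w r * exponentialPDF 1 (r - T)) + ∫⁻ r, w r *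
          ∫⁻ s, exponentialPDF 1 (s - T) * (Set.Iic r).indicator 1 s := by
        congr 1
        · exact lintegral_congr fun s => mul_comm _ _
        · rw [lintegral_lintegral_swap]
          · refine lintegral_congr fun r => ?_
            exact lintegral_const_mul _ (hpdf.mul (hjoint.comp measurable_prodMk_right))
          · exact ((hw.comp measurable_snd).mul
              ((hpdf.comp measurable_fst).mul hjoint)).aemeasurable
    _ = _ := by
        rw [← lintegral_add_left (by exact hw.mul hpdf)]
        refine lintegral_congr fun r => ?_
        rw [← mul_add, add_comm (exponentialPDF 1 (r - T)), lintegral_exponentialPDF_sub_Iic_add]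
        by_cases h : T ≤ r <;> simp [Set.indicator, h]

/-- Expected additive functionals of the jumps are integrals of their intensity. -/
theorem lintegral_tsum_jump_le {w : ℝ → ℝ≥0∞} (hw : Measurable w) {c : E × ℝ × ℕ → ℝ≥0∞}
    (hc : Measurable c)
    (hcw : ∀ z, ∫⁻ z', c z' ∂(P.stepKernel b α d z) = ∫⁻ s, exponentialPDF 1 (s - z.2.1) * w s) :
    ∫⁻ h, ∑' k, c (h (k + 1)) ∂(P.law b α d ν) ≤ ∫⁻ r in Set.Ici 0, w r := by
  -- The expected future total after a jump at time `T`. The renewal identity makes the sum of the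
  -- costs so far and `g` constant in mean, so the expectations telescope; the additive form avoids
  -- subtracting infinities.
  set g : ℝ → ℝ≥0∞ := fun T => ∫⁻ r, (Set.Ici T).indicator w r with hg
  have hgm : Measurable g := by
    refine Measurable.lintegral_prod_right (f := fun T r => (Set.Ici T).indicator w r) ?_
    exact (hw.comp measurable_snd).indicator (measurableSet_le measurable_fst measurable_snd)
  have hgz : Measurable fun z : E × ℝ × ℕ => g z.2.1 := hgm.comp (by fun_prop)
  have hstep : ∀ k, ∫⁻ h, c (h (k + 1)) ∂(P.law b α d ν) + ∫⁻ h, g (h (k + 1)).2.1 ∂(P.law b α d ν)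
      = ∫⁻ h, g (h k).2.1 ∂(P.law b α d ν) := by
    intro k
    rw [P.lintegral_law_succ b α d ν (k := k) (Φ := fun p => c p.2) (hc.comp measurable_snd),
      P.lintegral_law_succ b α d ν (k := k) (Φ := fun p => g p.2.2.1) (hgz.comp measurable_snd),
      ← lintegral_add_left]
    · refine lintegral_congr fun h => ?_
      rw [hcw, P.lintegral_stepKernel b α d _ hgz]
      simp only [lintegral_const, measure_univ, mul_one]
      have hpw : Measurable fun s => exponentialPDF 1 (s - (h k).2.1) * w s :=
        (measurable_exponentialPDF_one.comp (measurable_id.sub_const _)).mul hw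
      rw [← lintegral_add_left hpw]
      simp_rw [← mul_add]
      exact lintegral_exponentialPDF_mul_add_lintegral hw _
    · exact (Measurable.lintegral_kernel (κ := P.stepKernel b α d) hc).comp (measurable_pi_apply k)
  have h0 : ∫⁻ h, g (h 0).2.1 ∂(P.law b α d ν) = ∫⁻ r in Set.Ici 0, w r := by
    rw [P.lintegral_law_zero b α d ν hgz, ← lintegral_indicator measurableSet_Ici]
    simp [hg]
  have hck : ∀ k, Measurable fun h : ℕ → E × ℝ × ℕ => c (h (k + 1)) := fun k =>
    hc.comp (measurable_pi_apply (k + 1))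
  rw [lintegral_tsum fun k => (hck k).aemeasurable]
  refine ENNReal.tsum_le_of_sum_range_le fun n => ?_
  rw [← h0]
  suffices h : ∑ k ∈ Finset.range n, ∫⁻ h, c (h (k + 1)) ∂(P.law b α d ν)
      + ∫⁻ h, g (h n).2.1 ∂(P.law b α d ν) = ∫⁻ h, g (h 0).2.1 ∂(P.law b α d ν) by
    rw [← h]; exact le_self_add
  induction n with
  | zero => simp
  | succ n ih => rw [Finset.sum_range_succ, add_assoc, hstep, ih]

/-- Almost surely the jump times do not accumulate. -/
theorem ae_bddAbove (t : ℝ) : ∀ᵐ h ∂(P.law b α d ν), BddAbove {k : ℕ | (h k).2.1 ≤ t} := by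
  set c : E × ℝ × ℕ → ℝ≥0∞ := fun z => (Set.Iic t).indicator 1 z.2.1 with hc
  have h1 : Measurable ((Set.Iic t).indicator (1 : ℝ → ℝ≥0∞)) :=
    measurable_one.indicator measurableSet_Iic
  have hcm : Measurable c := h1.comp (by fun_prop)
  have h2 := P.lintegral_tsum_jump_le b α d ν h1 hcm fun z => by
    rw [P.lintegral_stepKernel b α d _ hcm]
    simp [hc]
  -- The mean number of jumps in `[0, t]` is at most the length of this interval, hence almost
  -- surely finite.
  have h3 : ∫⁻ h, ∑' k, c (h (k + 1)) ∂(P.law b α d ν) ≠ ⊤ := by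
    refine ne_top_of_le_ne_top ?_ h2
    rw [lintegral_indicator_one measurableSet_Iic,
      Measure.restrict_apply measurableSet_Iic, Set.inter_comm, Set.Ici_inter_Iic]
    simp
  filter_upwards [ae_lt_top (Measurable.tsum fun k =>
    hcm.comp (measurable_pi_apply (k + 1))) h3] with h hh
  have hfin : {k : ℕ | (1 : ℝ≥0∞) ≤ c (h (k + 1))}.Finite :=
    ENNReal.finite_const_le_of_tsum_ne_top hh.ne one_ne_zero
  obtain ⟨n, hn⟩ := hfin.bddAbove
  refine ⟨n + 1, fun k hk => ?_⟩
  rcases k with _ | k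
  · omega
  · have : k ≤ n := hn (show (1 : ℝ≥0∞) ≤ c (h (k + 1)) by
      have hk' : (h (k + 1)).2.1 ≤ t := hk
      simp [hc, Set.indicator, hk'])
    omega

/-- Given `T_k ≤ t`, no further jump before `t` has the probability of survival for a time `t -
T_k`, which is the density integrated in `occ`. -/
theorem law_jump_le (k : ℕ) (t : ℝ) (x : E) :
    P.law b α d ν {h | (h k).1 = x ∧ (h k).2.1 ≤ t ∧ t < (h (k + 1)).2.1}
      ≤ P.occ b α d ν k t x := by
  have hS : MeasurableSet {p : (E × ℝ × ℕ) × (E × ℝ × ℕ) | p.1.1 = x ∧ p.1.2.1 ≤ t ∧ t < p.2.2.1} := by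
    simp only [Set.ofPred_and]
    exact (measurableSet_eq_fun (by fun_prop) measurable_const).inter
      ((measurableSet_le (by fun_prop) measurable_const).inter
        (measurableSet_lt measurable_const (by fun_prop)))
  have h1 := P.lintegral_law_succ b α d ν (k := k) (Φ := Set.indicator
    {p : (E × ℝ × ℕ) × (E × ℝ × ℕ) | p.1.1 = x ∧ p.1.2.1 ≤ t ∧ t < p.2.2.1} 1)
    (measurable_one.indicator hS)
  have h2 : ∫⁻ h, Set.indicator {p : (E × ℝ × ℕ) × (E × ℝ × ℕ) |
      p.1.1 = x ∧ p.1.2.1 ≤ t ∧ t < p.2.2.1} 1 (h k, h (k + 1)) ∂(P.law b α d ν)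
      = P.law b α d ν {h | (h k).1 = x ∧ (h k).2.1 ≤ t ∧ t < (h (k + 1)).2.1} := by
    rw [← lintegral_indicator_one]
    · rfl
    · exact hS.preimage (f := fun h : ℕ → E × ℝ × ℕ => (h k, h (k + 1))) (by fun_prop)
  rw [← h2, h1]
  refine lintegral_mono fun h => ?_
  by_cases hx : (h k).1 = x
  · by_cases ht : (h k).2.1 ≤ t
    · have hm : Measurable fun z : E × ℝ × ℕ => (Set.Ioi t).indicator (1 : ℝ → ℝ≥0∞) z.2.1 :=
        (measurable_one.indicator measurableSet_Ioi).comp (by fun_prop)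
      rw [if_pos hx, ← lintegral_exponentialPDF_Ioi ht]
      have h3 := P.lintegral_stepKernel b α d (h k) hm
      simp only [lintegral_const, measure_univ, mul_one] at h3
      rw [← h3]
      refine lintegral_mono fun z => ?_
      simp [Set.indicator, hx, ht]
    · simp [Set.indicator, ht]
  · simp [Set.indicator, hx]

/-- The probability that the process is in `B` at time `t` is bounded by the total occupation. -/
theorem law_nsaProcess_mem_le {t : ℝ} (ht : 0 ≤ t) (B : Finset E) :
    P.law b α d ν {h | nsaProcess t h ∈ B} ≤ ∑ x ∈ B, P.occTotal b α d ν t x := by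
  have h1 : P.law b α d ν {h | nsaProcess t h ∈ B} ≤ P.law b α d ν (⋃ x ∈ B, ⋃ k : ℕ,
      {h | (h k).1 = x ∧ (h k).2.1 ≤ t ∧ t < (h (k + 1)).2.1}) := by
    refine measure_mono_ae ?_
    filter_upwards [P.ae_bddAbove b α d ν t, P.ae_law_zero b α d ν] with h hb h0 hB
    have hmem : sSup {k : ℕ | (h k).2.1 ≤ t} ∈ {k : ℕ | (h k).2.1 ≤ t} :=
      Nat.sSup_mem ⟨0, by simpa [h0] using ht⟩ hb
    have hnext : t < (h (sSup {k : ℕ | (h k).2.1 ≤ t} + 1)).2.1 := by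
      by_contra hcon
      have := le_csSup hb (show sSup {k : ℕ | (h k).2.1 ≤ t} + 1 ∈ {k : ℕ | (h k).2.1 ≤ t} from
        not_lt.1 hcon)
      omega
    exact Set.mem_iUnion₂.2 ⟨_, hB, Set.mem_iUnion.2 ⟨_, rfl, hmem, hnext⟩⟩
  refine h1.trans ((measure_biUnion_finset_le _ _).trans (Finset.sum_le_sum fun x _ => ?_))
  exact (measure_iUnion_le _).trans (ENNReal.tsum_le_tsum fun k => P.law_jump_le b α d ν k t x)

theorem lintegral_cast_poissonMeasure (n : ℝ≥0) :
    ∫⁻ N : ℕ, (N : ℝ≥0∞) ∂(poissonMeasure n) = n := by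
  rw [lintegral_poissonMeasure, tsum_eq_zero_add' ENNReal.summable]
  have h1 : ∀ j : ℕ, ENNReal.ofReal (Real.exp (-n) * n ^ (j + 1) / (Nat.factorial (j + 1)))
      * ((j + 1 : ℕ) : ℝ≥0∞)
      = n * ENNReal.ofReal (Real.exp (-n) * n ^ j / (Nat.factorial j)) := by
    intro j
    rw [← ENNReal.ofReal_natCast, ← ENNReal.ofReal_coe_nnreal, ← ENNReal.ofReal_mul (by positivity),
      ← ENNReal.ofReal_mul (by positivity), Nat.factorial_succ]
    congr 1
    push_cast
    field_simp
    ring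
  simp_rw [h1]
  rw [ENNReal.tsum_mul_left, ← ENNReal.ofReal_tsum_of_nonneg (fun j => by positivity)
      (hasSum_one_poissonMeasure n).summable, (hasSum_one_poissonMeasure n).tsum_eq]
  simp

/-- Jumps occur at unit rate, and a jump at time `s` costs `n_s + 1` samples in mean. -/
theorem lintegral_nCall_le (T : ℝ) :
    ∫⁻ h, nCall T h ∂(P.law b α d ν)
      ≤ ∫⁻ s in Set.Ici 0, (Set.Iio T).indicator (fun s => (intensity α d s : ℝ≥0∞) + 1) s := by
  have hint : Measurable fun s => ((intensity α d s : ℝ≥0∞) + 1) := by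
    have := measurable_intensity α d
    fun_prop
  have hcm : Measurable fun z : E × ℝ × ℕ => if z.2.1 < T then (z.2.2 : ℝ≥0∞) else 0 :=
    Measurable.ite (measurableSet_lt (by fun_prop) measurable_const)
      ((measurable_of_countable (fun n : ℕ => (n : ℝ≥0∞))).comp (by fun_prop)) measurable_const
  unfold nCall
  refine P.lintegral_tsum_jump_le b α d ν (hint.indicator measurableSet_Iio) hcm fun z => ?_
  rw [P.lintegral_stepKernel b α d _ hcm]
  refine lintegral_congr fun s => ?_
  congr 1
  by_cases hs : s < T
  · simp only [hs, if_true, lintegral_const, measure_univ, mul_one, Set.indicator, Set.mem_Iio]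
    push_cast
    rw [lintegral_add_right _ measurable_const, lintegral_cast_poissonMeasure]
    simp
  · simp [hs]

end NoisyProblem

/-- Since `(1 + s d) ^ α ≥ 1` and `α ≥ 1`, the extra `1` is absorbed by `(α + 1) (1 + s d) ^ α`,
which has the explicit primitive `(1 + s d) ^ (α + 1) / d`. -/
theorem lintegral_intensity_le {α d T : ℝ} (hα : 2 ≤ α) (hd : 0 < d) (hT : 0 ≤ T) :
    ∫⁻ s in Set.Ici 0, (Set.Iio T).indicator (fun s => (intensity α d s : ℝ≥0∞) + 1) s
      ≤ ENNReal.ofReal (1 / d * (1 + T * d) ^ (α + 1)) := by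
  set f' : ℝ → ℝ := fun s => (α + 1) * (1 + s * d) ^ α with hf'
  have hpos : ∀ s, 0 ≤ s → 0 < 1 + s * d := fun s hs => by positivity
  have hcont : ContinuousOn f' (Set.Icc 0 T) := by
    refine continuousOn_const.mul (ContinuousOn.rpow_const (by fun_prop) fun s hs => ?_)
    exact Or.inl (hpos s hs.1).ne'
  have hint : IntervalIntegrable f' volume 0 T :=
    (hcont.mono (by rw [Set.uIcc_of_le hT])).intervalIntegrable
  have hFTC : ∫ s in (0 : ℝ)..T, f' s = 1 / d * (1 + T * d) ^ (α + 1) - 1 / d := by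
    have h : ∀ s ∈ Set.uIcc 0 T, HasDerivAt (fun s => 1 / d * (1 + s * d) ^ (α + 1)) (f' s) s := by
      intro s hs
      rw [Set.uIcc_of_le hT] at hs
      have h1 : HasDerivAt (fun t : ℝ => 1 + t * d) d s := by
        simpa using ((hasDerivAt_id s).mul_const d).const_add 1
      refine ((h1.rpow_const (p := α + 1) (Or.inl (hpos s hs.1).ne')).const_mul (1 / d)).congr_deriv
        ?_
      rw [hf', add_sub_cancel_right]
      field_simp
    rw [intervalIntegral.integral_eq_sub_of_hasDerivAt h hint]
    simp
  calc ∫⁻ s in Set.Ici 0, (Set.Iio T).indicator (fun s => (intensity α d s : ℝ≥0∞) + 1) s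
      = ∫⁻ s in Set.Ico 0 T, ((intensity α d s : ℝ≥0∞) + 1) := by
        rw [lintegral_indicator measurableSet_Iio, Measure.restrict_restrict measurableSet_Iio,
          Set.inter_comm, Set.Ici_inter_Iio]
    _ ≤ ∫⁻ s in Set.Ico 0 T, ENNReal.ofReal (f' s) := by
        refine setLIntegral_mono' measurableSet_Ico fun s hs => ?_
        have hs0 := hpos s hs.1
        have hone : 1 ≤ (1 + s * d) ^ α :=
          Real.one_le_rpow (by have := mul_nonneg hs.1 hd.le; linarith) (by linarith)
        rw [← ENNReal.ofReal_coe_nnreal, NoisyProblem.coe_intensity hs0.le, ← ENNReal.ofReal_one,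
          ← ENNReal.ofReal_add (by positivity) zero_le_one]
        refine ENNReal.ofReal_le_ofReal ?_
        simp only [hf']
        nlinarith
    _ = ENNReal.ofReal (∫ s in (0 : ℝ)..T, f' s) := by
        rw [intervalIntegral.integral_of_le hT, ofReal_integral_eq_lintegral_ofReal hint.1,
          Measure.restrict_congr_set Ico_ae_eq_Ioc]
        rw [Filter.EventuallyLE, ae_restrict_iff' measurableSet_Ioc]
        refine ae_of_all _ fun s hs => ?_
        have := hpos s hs.1.le
        simp only [hf', Pi.zero_apply]
        positivity
    _ ≤ _ := by
        refine ENNReal.ofReal_le_ofReal ?_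
        rw [hFTC]
        have : 0 < 1 / d := by positivity
        linarith

/-! ### The master equation. -/

namespace NoisyProblem

variable {E Ω : Type*} [Fintype E] [DecidableEq E] [MeasurableSpace Ω] (P : NoisyProblem E Ω)

theorem toReal_moveProb (b α d s : ℝ) (x y : E) :
    (P.moveProb b α d s x y).toReal = ∑ z, P.q x z *
      (P.acceptAt b α d s x z * (if z = y then 1 else 0)
        + (1 - P.acceptAt b α d s x z) * (if x = y then 1 else 0)) := by
  have h1 : ∀ z, P.meanAccept x z (invTemp b d s) (intensity α d s) ≠ ⊤ := fun z =>
    ne_top_of_le_ne_top ENNReal.one_ne_top (P.meanAccept_le_one x z _ _)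
  have h2 : ∀ z, (P.meanAccept x z (invTemp b d s) (intensity α d s) * (if z = y then 1 else 0)
      + (1 - P.meanAccept x z (invTemp b d s) (intensity α d s)) * (if x = y then 1 else 0)) ≠ ⊤ := by
    intro z
    refine ENNReal.add_ne_top.2 ⟨ENNReal.mul_ne_top (h1 z) ?_,
      ENNReal.mul_ne_top (ENNReal.sub_ne_top ENNReal.one_ne_top) ?_⟩ <;> split_ifs <;> simp
  unfold moveProb
  rw [ENNReal.toReal_sum fun z _ => ENNReal.mul_ne_top ENNReal.ofReal_ne_top (h2 z)]
  refine Finset.sum_congr rfl fun z _ => ?_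
  rw [ENNReal.toReal_mul, ENNReal.toReal_ofReal (P.q_nonneg x z), ENNReal.toReal_add,
    ENNReal.toReal_mul, ENNReal.toReal_mul,
    ENNReal.toReal_sub_of_le (P.meanAccept_le_one x z _ _) ENNReal.one_ne_top]
  · unfold acceptAt
    split_ifs <;> simp
  · exact ENNReal.mul_ne_top (h1 z) (by split_ifs <;> simp)
  · exact ENNReal.mul_ne_top (ENNReal.sub_ne_top ENNReal.one_ne_top) (by split_ifs <;> simp)

theorem toReal_moveProb' (b α d s : ℝ) (x y : E) :
    (P.moveProb b α d s x y).toReal = P.q x y * P.acceptAt b α d s x y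
      + (if x = y then 1 - ∑ z, P.q x z * P.acceptAt b α d s x z else 0) := by
  rw [toReal_moveProb]
  simp only [mul_add, Finset.sum_add_distrib, mul_ite, mul_one, mul_zero, Finset.sum_ite_eq',
    Finset.mem_univ, if_true]
  congr 1
  split_ifs
  · simp only [mul_sub, mul_one, Finset.sum_sub_distrib, P.q_sum]
  · simp

theorem continuousAt_toReal_moveProb {b α d : ℝ} (hα : 0 ≤ α) (hd : 0 < d) (x y : E) {t : ℝ}
    (ht : 0 < t) : ContinuousAt (fun s => (P.moveProb b α d s x y).toReal) t := by
  simp_rw [toReal_moveProb]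
  refine tendsto_finsetSum _ fun z _ => ?_
  have h := P.continuousAt_acceptAt (b := b) hα hd x z ht
  exact ((h.mul_const _).add ((continuousAt_const.sub h).mul_const _)).const_mul _

variable [MeasurableSpace E] [DiscreteMeasurableSpace E] (b α d : ℝ) (ν : Measure E)

/-- Law of the continuous-time process, as a real number. -/
def density (t : ℝ) (x : E) : ℝ := (P.occTotal b α d ν t x).toReal

theorem density_nonneg (t : ℝ) (x : E) : 0 ≤ P.density b α d ν t x := ENNReal.toReal_nonneg

variable [IsProbabilityMeasure ν]

/-- Rate at which mass flows into `x` at time `s`. -/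
def inflow (x : E) (s : ℝ) : ℝ :=
  ∑ y, P.density b α d ν s y * (P.moveProb b α d s y x).toReal

theorem occTotal_ne_top (t : ℝ) (x : E) : P.occTotal b α d ν t x ≠ ⊤ :=
  ne_top_of_le_ne_top ENNReal.one_ne_top (P.occTotal_le_one b α d ν t x)

theorem toReal_inflow (x : E) (s : ℝ) :
    (∑ y, P.occTotal b α d ν s y * P.moveProb b α d s y x).toReal = P.inflow b α d ν x s := by
  rw [ENNReal.toReal_sum fun y _ => ENNReal.mul_ne_top (P.occTotal_ne_top b α d ν s y)
    (ne_top_of_le_ne_top ENNReal.one_ne_top (P.moveProb_le_one b α d s y x))]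
  simp [inflow, density]

theorem inflow_sum_le_one (x : E) (s : ℝ) :
    ∑ y, P.occTotal b α d ν s y * P.moveProb b α d s y x ≤ 1 := by
  refine (Finset.sum_le_sum fun y _ => mul_le_of_le_one_right' (P.moveProb_le_one b α d s y x)).trans
    ((P.sum_occTotal_le b α d ν s).trans (Set.indicator_le_self _ _ _))

theorem inflow_nonneg (x : E) (s : ℝ) : 0 ≤ P.inflow b α d ν x s := by
  rw [← toReal_inflow]; exact ENNReal.toReal_nonneg

theorem inflow_le_one (x : E) (s : ℝ) : P.inflow b α d ν x s ≤ 1 := by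
  rw [← toReal_inflow]
  exact ENNReal.toReal_le_of_le_ofReal zero_le_one
    (by simpa using P.inflow_sum_le_one b α d ν x s)

theorem measurable_inflow (x : E) : Measurable (P.inflow b α d ν x) := by
  unfold inflow density
  exact Finset.measurable_fun_sum _ fun y _ =>
    (P.measurable_occTotal b α d ν y).ennreal_toReal.mul
      (P.measurable_moveProb b α d y x).ennreal_toReal

theorem intervalIntegrable_exp_mul_inflow (x : E) (u v : ℝ) :
    IntervalIntegrable (fun s => Real.exp s * P.inflow b α d ν x s) volume u v := by
  refine (Real.continuous_exp.intervalIntegrable u v).mono_fun'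
    (Real.measurable_exp.mul (P.measurable_inflow b α d ν x)).aestronglyMeasurable
    (ae_of_all _ fun s => ?_)
  change ‖_‖ ≤ _
  rw [Real.norm_eq_abs, abs_of_nonneg (mul_nonneg (Real.exp_pos s).le
    (P.inflow_nonneg b α d ν x s))]
  exact mul_le_of_le_one_right (Real.exp_pos s).le (P.inflow_le_one b α d ν x s)

/-- The renewal equation in Duhamel form, with `exp (-(t - s))` factored so that `t` leaves the
integral and differentiation is immediate. -/
theorem density_eq {t : ℝ} (ht : 0 ≤ t) (x : E) :
    P.density b α d ν t x = Real.exp (-t) *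
      (ν.real {x} + ∫ s in (0 : ℝ)..t, Real.exp s * P.inflow b α d ν x s) := by
  have h1 : ∫⁻ s, exponentialPDF 1 (t - s) *
      ∑ y, P.occTotal b α d ν s y * P.moveProb b α d s y x
      = ∫⁻ s in Set.Ioc 0 t, ENNReal.ofReal (Real.exp (-t) *
          (Real.exp s * P.inflow b α d ν x s)) := by
    rw [Measure.restrict_congr_set Ioc_ae_eq_Icc, ← lintegral_indicator measurableSet_Icc]
    refine lintegral_congr fun s => ?_
    by_cases h0 : 0 ≤ s
    · by_cases hs : s ≤ t
      · rw [Set.indicator_of_mem (show s ∈ Set.Icc 0 t from ⟨h0, hs⟩),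
          exponentialPDF_one_of_nonneg (sub_nonneg.2 hs), ← toReal_inflow, ← mul_assoc,
          ← Real.exp_add, ENNReal.ofReal_mul (Real.exp_pos _).le, ENNReal.ofReal_toReal
          (ne_top_of_le_ne_top ENNReal.one_ne_top (P.inflow_sum_le_one b α d ν x s))]
        congr 3; ring
      · rw [exponentialPDF_of_neg (by linarith), zero_mul,
          Set.indicator_of_notMem fun h => hs h.2]
    · rw [Set.indicator_of_notMem fun h => h0 h.1, Finset.sum_eq_zero, mul_zero]
      intro y _
      rw [P.occTotal_of_neg b α d ν (not_le.1 h0), zero_mul]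
  have hnn : ∀ s, 0 ≤ Real.exp (-t) * (Real.exp s * P.inflow b α d ν x s) := fun s =>
    mul_nonneg (Real.exp_pos _).le (mul_nonneg (Real.exp_pos _).le (P.inflow_nonneg b α d ν x s))
  have hint := (P.intervalIntegrable_exp_mul_inflow b α d ν x 0 t).const_mul (Real.exp (-t))
  rw [← ofReal_integral_eq_lintegral_ofReal hint.1 (ae_of_all _ hnn),
    ← intervalIntegral.integral_of_le ht, intervalIntegral.integral_const_mul] at h1
  rw [density, occTotal_eq, h1, exponentialPDF_one_of_nonneg ht, ENNReal.toReal_add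
    (ENNReal.mul_ne_top ENNReal.ofReal_ne_top (measure_ne_top _ _)) ENNReal.ofReal_ne_top,
    ENNReal.toReal_mul, ENNReal.toReal_ofReal (Real.exp_pos _).le, ENNReal.toReal_ofReal, mul_add]
  · rfl
  · exact mul_nonneg (Real.exp_pos _).le (intervalIntegral.integral_nonneg ht fun s _ =>
      mul_nonneg (Real.exp_pos _).le (P.inflow_nonneg b α d ν x s))

theorem density_zero (x : E) : P.density b α d ν 0 x = ν.real {x} := by
  rw [P.density_eq b α d ν le_rfl]; simp

theorem continuousOn_density (x : E) :
    ContinuousOn (fun t => P.density b α d ν t x) (Set.Ici 0) := by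
  have h : Continuous fun t => Real.exp (-t) *
      (ν.real {x} + ∫ s in (0 : ℝ)..t, Real.exp s * P.inflow b α d ν x s) := by
    have := intervalIntegral.continuous_primitive
      (fun u v => P.intervalIntegrable_exp_mul_inflow b α d ν x u v) 0
    fun_prop
  exact h.continuousOn.congr fun t ht => P.density_eq b α d ν ht x

theorem hasDerivAt_density (hα : 0 ≤ α) (hd : 0 < d) (x : E) {t : ℝ} (ht : 0 < t) :
    HasDerivAt (fun t => P.density b α d ν t x)
      (P.inflow b α d ν x t - P.density b α d ν t x) t := by
  have hcont : ContinuousAt (P.inflow b α d ν x) t :=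
    tendsto_finsetSum _ fun y _ =>
      ((P.continuousOn_density b α d ν y).continuousAt (Ici_mem_nhds ht)).mul
        (P.continuousAt_toReal_moveProb hα hd y x ht)
  have h1 : HasDerivAt (fun t => ∫ s in (0 : ℝ)..t, Real.exp s * P.inflow b α d ν x s)
      (Real.exp t * P.inflow b α d ν x t) t :=
    intervalIntegral.integral_hasDerivAt_right
      (P.intervalIntegrable_exp_mul_inflow b α d ν x 0 t)
      ((Real.measurable_exp.mul
        (P.measurable_inflow b α d ν x)).stronglyMeasurable.stronglyMeasurableAtFilter)
      (Real.continuous_exp.continuousAt.mul hcont)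
  have h2 : HasDerivAt (fun t : ℝ => Real.exp (-t)) (-Real.exp (-t)) t := by
    simpa using (hasDerivAt_neg t).exp
  have h3 := h2.fun_mul (h1.const_add (ν.real {x}))
  have h4 : (fun t => P.density b α d ν t x) =ᶠ[nhds t] fun t => Real.exp (-t) *
      (ν.real {x} + ∫ s in (0 : ℝ)..t, Real.exp s * P.inflow b α d ν x s) := by
    filter_upwards [Ici_mem_nhds ht] with s hs using P.density_eq b α d ν hs x
  refine (h3.congr_of_eventuallyEq h4).congr_deriv ?_
  rw [P.density_eq b α d ν ht.le]
  have h5 : Real.exp (-t) * Real.exp t = 1 := by rw [← Real.exp_add]; simp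
  linear_combination P.inflow b α d ν x t * h5

variable {F : Finset E}

theorem density_eq_zero (hF : ∀ x, x ∈ F ↔ x ∈ P.feasible) (hν : ν P.feasibleᶜ = 0)
    {x : E} (hx : x ∉ F) (t : ℝ) : P.density b α d ν t x = 0 := by
  rw [density, P.occTotal_eq_zero b α d ν hν (fun h => hx ((hF x).2 h)), ENNReal.toReal_zero]

/-- Master equation of the algorithm on the feasible set. -/
theorem hasDerivAt_density_master (hF : ∀ x, x ∈ F ↔ x ∈ P.feasible) (hν : ν P.feasibleᶜ = 0)
    (hα : 0 ≤ α) (hd : 0 < d) {x : E} (hx : x ∈ F) {t : ℝ}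
    (ht : 0 < t) :
    HasDerivAt (fun t => P.density b α d ν t x)
      (∑ y ∈ F, (P.density b α d ν t y * (P.q y x * P.acceptAt b α d t y x)
        - P.density b α d ν t x * (P.q x y * P.acceptAt b α d t x y))) t := by
  refine (P.hasDerivAt_density b α d ν hα hd x ht).congr_deriv ?_
  have hsub : ∀ g : E → ℝ, (∀ y ∉ F, g y = 0) → ∑ y ∈ F, g y = ∑ y, g y := fun g hg =>
    Finset.sum_subset (Finset.subset_univ F) fun y _ hy => hg y hy
  -- Both sums extend to all of `E`: infeasible points carry no mass, and moves to them are never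
  -- accepted. The holding probability then cancels against the loss term.
  rw [Finset.sum_sub_distrib, ← Finset.mul_sum, hsub, hsub]
  · unfold inflow
    simp only [toReal_moveProb', mul_add, Finset.sum_add_distrib, mul_ite, mul_zero,
      Finset.sum_ite_eq', Finset.mem_univ, if_true]
    ring
  · intro y hy
    rw [acceptAt, P.meanAccept_eq_zero ((hF x).1 hx) fun h => hy ((hF y).2 h)]
    simp
  · intro y hy
    rw [P.density_eq_zero b α d ν hF hν hy, zero_mul]

/-- Flows within `F` cancel in pairs, so the mass has zero derivative for `t > 0`; continuity at `0`
and the mean value theorem carry over the initial mass. -/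
theorem sum_density (hF : ∀ x, x ∈ F ↔ x ∈ P.feasible) (hν : ν P.feasibleᶜ = 0)
    (hα : 0 ≤ α) (hd : 0 < d) {t : ℝ} (ht : 0 < t) :
    ∑ x ∈ F, P.density b α d ν t x = 1 := by
  have h0 : ∑ x ∈ F, P.density b α d ν 0 x = 1 := by
    rw [Finset.sum_subset (Finset.subset_univ F)
      fun y _ hy => P.density_eq_zero b α d ν hF hν hy 0]
    simp_rw [density_zero]
    rw [sum_measureReal_singleton, Finset.coe_univ, probReal_univ]
  obtain ⟨s, hs, h⟩ := exists_hasDerivAt_eq_slope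
    (fun t => ∑ x ∈ F, P.density b α d ν t x)
    (fun t => ∑ x ∈ F, ∑ y ∈ F, (P.density b α d ν t y * (P.q y x * P.acceptAt b α d t y x)
        - P.density b α d ν t x * (P.q x y * P.acceptAt b α d t x y))) ht
    (continuousOn_finsetSum _ fun x _ => (P.continuousOn_density b α d ν x).mono
      Set.Icc_subset_Ici_self)
    (fun s hs => HasDerivAt.fun_sum fun x hx =>
      P.hasDerivAt_density_master b α d ν hF hν hα hd hx hs.1)
  have h1 := sum_mul_master F (P.density b α d ν s) (fun _ => 1)
    fun x y => P.q x y * P.acceptAt b α d s x y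
  simp only [one_mul, sub_self, mul_zero, Finset.sum_const_zero] at h1
  rw [h1, eq_comm, div_eq_zero_iff, or_iff_left (by linarith), h0] at h
  linarith

end NoisyProblem

/-! ### Paths of controlled elevation and the failure bound. -/

namespace NoisyProblem

variable {E Ω : Type*} [Fintype E] [DecidableEq E] [MeasurableSpace Ω] (P : NoisyProblem E Ω)

/-- The elevation is an infimum over infinitely many lists, but `J` takes finitely many values, so
beating the next value above `H` means staying below `H`. -/
theorem exists_path_below {x y : E} {H : ℝ≥0∞} (hH : H ≠ ⊤) (h : P.elevation x y ≤ H) :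
    ∃ p, P.IsPath x y p ∧ ∀ z ∈ p, P.J z ≤ H := by
  classical
  set H' := (Finset.univ.filter fun z => H < P.J z).inf P.J with hH'
  have hlt : H < H' := by
    rw [hH', Finset.lt_inf_iff hH.lt_top]
    exact fun z hz => (Finset.mem_filter.1 hz).2
  have h1 := h.trans_lt hlt
  unfold elevation at h1
  obtain ⟨p, h1⟩ := iInf_lt_iff.1 h1
  obtain ⟨hp, h1⟩ := iInf_lt_iff.1 h1
  refine ⟨p, hp, fun z hz => ?_⟩
  by_contra hcon
  have h2 : H' ≤ P.J z :=
    Finset.inf_le (Finset.mem_filter.2 ⟨Finset.mem_univ z, not_le.1 hcon⟩)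
  exact (h2.trans (le_iSup₂ (f := fun z _ => P.J z) z hz)).not_gt h1

theorem reflTransGen_of_isPath {F : Finset E} {j : E → ℝ} {H : ℝ} {x y : E} {p : List E}
    (hp : P.IsPath x y p) (hz : ∀ z ∈ p, z ∈ F ∧ j z ≤ H) :
    Relation.ReflTransGen (StepBelow F j P.q H) x y := by
  induction p generalizing x with
  | nil => simp [IsPath] at hp
  | cons a l ih =>
    obtain ⟨h1, h2, h3⟩ := hp
    simp only [List.head?_cons, Option.some.injEq] at h1
    subst h1
    rcases l with _ | ⟨c, l⟩
    · simp only [List.getLast?_singleton, Option.some.injEq] at h2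
      rw [h2]
    · rw [List.isChain_cons_cons] at h3
      have htail := ih (x := c) ⟨rfl, by rw [List.getLast?_cons_cons] at h2; exact h2, h3.2⟩
        fun z hzl => hz z (List.mem_cons_of_mem _ hzl)
      -- A repeated point is skipped: positivity of the proposal is only known for a neighbour
      -- distinct from the current point.
      by_cases hac : a = c
      · rw [hac]; exact htail
      · have ha := hz a List.mem_cons_self
        have hc := hz c (List.mem_cons_of_mem _ List.mem_cons_self)
        exact Relation.ReflTransGen.head
          ⟨ha.1, hc.1, P.q_pos a c h3.1 (Ne.symm hac), ha.2, hc.2⟩ htail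

/-- Feasible points are joined by paths whose elevation is controlled by `mStar`. -/
theorem reflTransGen_stepBelow {F : Finset E} (hF : ∀ x, x ∈ F ↔ x ∈ P.feasible) {m : ℝ}
    (hm0 : 0 ≤ m) (hm : P.mStar = ENNReal.ofReal m) {x y : E} (hx : x ∈ F) (hy : y ∈ F) :
    Relation.ReflTransGen (StepBelow F (fun z => (P.J z).toReal) P.q
      (m + max (P.J x).toReal (P.J y).toReal)) x y := by
  have hJx := P.J_ne_top ((hF x).1 hx)
  have hJy := P.J_ne_top ((hF y).1 hy)
  have hmax : max (P.J x) (P.J y) ≠ ⊤ := (max_lt hJx.lt_top hJy.lt_top).ne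
  have hH : ENNReal.ofReal m + max (P.J x) (P.J y) ≠ ⊤ :=
    ENNReal.add_ne_top.2 ⟨ENNReal.ofReal_ne_top, hmax⟩
  have h1 : P.elevation x y ≤ ENNReal.ofReal m + max (P.J x) (P.J y) := by
    rw [← tsub_le_iff_right, ← hm]
    exact le_iSup₂ (f := fun x y => P.elevation x y - max (P.J x) (P.J y)) x y
  obtain ⟨p, hp, hz⟩ := P.exists_path_below hH h1
  refine P.reflTransGen_of_isPath hp fun z hzp => ⟨(hF z).2 ?_, ?_⟩
  · by_contra hcon
    exact (ne_top_of_le_ne_top hH (hz z hzp)) (P.J_eq_top hcon)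
  · have h2 := ENNReal.toReal_mono hH (hz z hzp)
    rwa [ENNReal.toReal_add ENNReal.ofReal_ne_top hmax, ENNReal.toReal_ofReal hm0,
      ENNReal.toReal_max hJx hJy] at h2

variable [MeasurableSpace E] [DiscreteMeasurableSpace E]

theorem law_real_notMem_optSet_le (b α d : ℝ) (ν : Measure E) [IsProbabilityMeasure ν]
    {F : Finset E} (hF : ∀ x, x ∈ F ↔ x ∈ P.feasible) (hν : ν P.feasibleᶜ = 0) {x₀ : E}
    (hx₀ : x₀ ∈ F) {t η w v β : ℝ} (ht : 0 < t) (hα : 0 ≤ α) (hd : 0 < d) (hη : 0 ≤ η) (hβ : 0 ≤ β)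
    (hmin : ∀ x, P.J x₀ ≤ P.J x)
    (hw : w = (∑ x ∈ F, P.μ₀ x) / P.μ₀ x₀ * Real.exp (-(β * η)))
    (hv : chiSq F P.μ₀ (fun z => (P.J z).toReal) β (P.density b α d ν t) - 1 ≤ v) :
    (P.law b α d ν).real {h | nsaProcess t h ∉ P.optSet η} ≤ w + Real.sqrt (w * v) := by
  classical
  have hμ : ∀ x ∈ F, 0 < P.μ₀ x := fun x hx => P.μ₀_pos x ((hF x).1 hx)
  set B := Finset.univ.filter fun x => x ∉ P.optSet η with hB
  set B' := F.filter fun x => x ∉ P.optSet η with hB'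
  have h1 := P.law_nsaProcess_mem_le b α d ν ht.le B
  have hset : {h : ℕ → E × ℝ × ℕ | nsaProcess t h ∈ B} = {h | nsaProcess t h ∉ P.optSet η} := by
    ext h; simp [hB]
  rw [hset] at h1
  have h2 : (P.law b α d ν).real {h | nsaProcess t h ∉ P.optSet η}
      ≤ ∑ x ∈ B, P.density b α d ν t x := by
    have h3 := ENNReal.toReal_mono
      (ENNReal.sum_ne_top.2 fun x _ => P.occTotal_ne_top b α d ν t x) h1
    rwa [ENNReal.toReal_sum fun x _ => P.occTotal_ne_top b α d ν t x] at h3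
  have h3 : ∑ x ∈ B, P.density b α d ν t x = ∑ x ∈ B', P.density b α d ν t x := by
    refine (Finset.sum_subset (fun x hx => ?_) fun x hxB hx => ?_).symm
    · exact Finset.mem_filter.2 ⟨Finset.mem_univ x, (Finset.mem_filter.1 hx).2⟩
    · refine P.density_eq_zero b α d ν hF hν (fun hxF => hx ?_) t
      exact Finset.mem_filter.2 ⟨hxF, (Finset.mem_filter.1 hxB).2⟩
  rw [h3] at h2
  refine h2.trans (sum_subset_le_of_chiSq (j := fun z => (P.J z).toReal) (β := β) hμ
    (P.sum_density b α d ν hF hν hα hd ht) (Finset.filter_subset _ _) ?_ hv)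
  rw [hw]
  refine sum_gibbs_le_of_level hμ hβ hx₀ (Finset.filter_subset _ _) fun x hx => ?_
  obtain ⟨hxF, hxo⟩ := Finset.mem_filter.1 hx
  have hinf : ⨅ y, P.J y = P.J x₀ := le_antisymm (iInf_le _ _) (le_iInf hmin)
  simp only [optSet, Set.mem_ofPred_eq, not_le, hinf] at hxo
  have h4 := ENNReal.toReal_mono (P.J_ne_top ((hF x).1 hxF)) hxo.le
  rwa [ENNReal.toReal_add (P.J_ne_top ((hF x₀).1 hx₀)) ENNReal.ofReal_ne_top,
    ENNReal.toReal_ofReal hη] at h4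

/-- Uniform bound on the failure probability of the algorithm at large times. -/
theorem exists_failure_bound {m b α d γ : ℝ} (hm : P.mStar = ENNReal.ofReal m) (hm0 : 0 ≤ m)
    (hb : 0 < b) (hmb : m * b < 1) (hd : 0 < d) (hγ : 0 < γ) (hα : α = 2 * (1 + γ))
    (hne : P.feasible.Nonempty) :
    ∃ A Γ₂ t₂ : ℝ, 0 < A ∧ 0 < Γ₂ ∧ 0 < t₂ ∧
      ∀ ν : Measure E, IsProbabilityMeasure ν → ν P.feasibleᶜ = 0 → ∀ t ≥ t₂, ∀ η > 0,
        (P.law b α d ν).real {h | nsaProcess t h ∉ P.optSet η}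
          ≤ Γ₂ * (1 + t * d) ^ (-(b * η))
            + Real.sqrt (Γ₂ * A) * (1 + t * d) ^ ((m * b - 1 - b * η) / 2) := by
  classical
  set F : Finset E := Finset.univ.filter fun x => x ∈ P.feasible with hFdef
  have hF : ∀ x, x ∈ F ↔ x ∈ P.feasible := fun x => by simp [hFdef]
  have hFne : F.Nonempty := hne.imp fun x hx => (hF x).2 hx
  have hμ : ∀ x ∈ F, 0 < P.μ₀ x := fun x hx => P.μ₀_pos x ((hF x).1 hx)
  have hα0 : 0 ≤ α := by linarith
  have hM := P.M_pos
  obtain ⟨x₀, hx₀, hmin⟩ := Finset.exists_min_image F P.J hFne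
  have hmin' : ∀ x, P.J x₀ ≤ P.J x := fun x => by
    by_cases hx : x ∈ P.feasible
    · exact hmin x ((hF x).2 hx)
    · rw [P.J_eq_top hx]; exact le_top
  obtain ⟨t₁, ht₁, hacc⟩ := P.exists_abs_acceptAt_sub_le hb hd hγ hα
  obtain ⟨A, t₂, hA, ht₂, hchi⟩ := exists_chiSq_sub_one_le (F := F) (μ := P.μ₀)
    (j := fun z => (P.J z).toReal) (q := P.q) (m := m) (b := b) (d := d) (C := 2 * b * P.M)
    (M := P.M) (t₁ := t₁) (a := fun t => P.acceptAt b α d t) hFne hμ P.q_nonneg P.q_reversible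
    (fun x _ => (Finset.sum_le_sum_of_subset_of_nonneg (Finset.subset_univ F)
      fun y _ _ => P.q_nonneg x y).trans_eq (P.q_sum x))
    (fun x hx y hy => P.reflTransGen_stepBelow hF hm0 hm hx hy)
    (fun x hx => (P.toReal_J_mem ((hF x).1 hx)).1) (fun x hx => (P.toReal_J_mem ((hF x).1 hx)).2)
    hb hd hmb ht₁.le (by positivity)
    fun t ht x hx y hy => hacc t ht x ((hF x).1 hx) y ((hF y).1 hy)
  have hΓ₂ : 0 < (∑ x ∈ F, P.μ₀ x) / P.μ₀ x₀ := div_pos (Finset.sum_pos hμ hFne) (hμ x₀ hx₀)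
  refine ⟨A, (∑ x ∈ F, P.μ₀ x) / P.μ₀ x₀, t₂, hA, hΓ₂, ht₁.trans_le ht₂, ?_⟩
  intro ν hνp hν t ht η hη
  have ht0 : 0 < t := (ht₁.trans_le ht₂).trans_le ht
  have htd : 0 < t * d := mul_pos ht0 hd
  have hx : 0 < 1 + t * d := by linarith
  have hbound := hchi (P.density b α d ν) (fun t _ x _ => P.density_nonneg b α d ν t x)
    (fun t ht => P.sum_density b α d ν hF hν hα0 hd (ht₁.trans_le ht))
    (fun t ht x hx => P.hasDerivAt_density_master b α d ν hF hν hα0 hd hx (ht₁.trans_le ht)) t ht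
  have h1 := P.law_real_notMem_optSet_le b α d ν hF hν hx₀ ht0 hα0 hd hη.le
    (mul_nonneg hb.le (Real.log_nonneg (by linarith : 1 ≤ 1 + t * d))) hmin' rfl hbound
  rw [exp_neg_mul_log hx, mul_comm η b] at h1
  refine h1.trans_eq ?_
  congr 1
  -- Under the root, `w * v` is `Γ₂ A (1 + t d) ^ (m b - 1 - b η)`; the root halves the exponent.
  rw [mul_mul_mul_comm, ← Real.rpow_add hx, Real.sqrt_mul (by positivity),
    Real.sqrt_eq_rpow ((1 + t * d) ^ _), ← Real.rpow_mul hx.le]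
  congr 2
  ring

end NoisyProblem

end

/-! ### Choice of the constants and conclusion. -/

theorem mainTheorem3 {E Ω : Type*} [Fintype E] [DecidableEq E] [MeasurableSpace E]
    [DiscreteMeasurableSpace E] [MeasurableSpace Ω] (P : NoisyProblem E Ω) (m b α d γ ε : ℝ)
    (hm : P.mStar = ENNReal.ofReal m) (hm0 : 0 ≤ m)
    (hd : 0 < d) (hγ : 0 < γ) (hε : 0 < ε) (hα : α = 2 * (1 + γ)) (hb : b = 1 / (m + ε)) :
    ∃ Γγ Γ₂ : ℝ, 0 < Γγ ∧ 0 < Γ₂ ∧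
      ∀ ν : Measure E, IsProbabilityMeasure ν → ν P.feasibleᶜ = 0 →
        (∃ t₀ : ℝ, ∀ t ≥ t₀, ∀ η > 0,
          (P.law b α d ν).real {h | nsaProcess t h ∉ P.optSet η} ≤
            Γγ * Γ₂ * (1 + t * d) ^ ((m * b - 1 - b * η) / 2) + Γ₂ * (1 + t * d) ^ (-(b * η))) ∧
        ∀ δ : ℝ, 0 < δ → δ < 1 → ∀ T : ℝ,
          T = 1 / d * ((2 * Γγ / δ) ^ ((m + ε) / ε) - 1) →
            0 ≤ T ∧
            (∀ t ≥ T, 1 - δ ≤ (P.law b α d ν).real {h | nsaProcess t h ∈ P.optSet ε}) ∧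
            ∫⁻ h, nCall T h ∂(P.law b α d ν) ≤
              ENNReal.ofReal (1 / d * (2 * Γγ / δ) ^ ((m + ε) / ε * (3 + 2 * γ))) := by
  rcases P.feasible.eq_empty_or_nonempty with hemp | hne
  -- With no feasible point, no probability measure is carried by the feasible set.
  · refine ⟨1, 1, one_pos, one_pos, fun ν hνp hν => ?_⟩
    rw [hemp, Set.compl_empty, measure_univ] at hν
    exact absurd hν one_ne_zero
  have hmε : 0 < m + ε := by linarith
  have hb0 : 0 < b := by rw [hb]; positivity
  have hmb : m * b = 1 - b * ε := by rw [hb]; field_simp; ring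
  have hbε : 0 < b * ε := mul_pos hb0 hε
  obtain ⟨A, Γ₂, t₂, hA, hΓ₂, ht₂, hbound⟩ :=
    P.exists_failure_bound hm hm0 hb0 (by linarith) hd hγ hα hne
  set s := Real.sqrt (Γ₂ * A) with hs
  have hs0 : 0 ≤ s := Real.sqrt_nonneg _
  -- Each summand has one use: `s ≤ Γγ Γ₂` for the first bound, `Γ₂ + s ≤ Γγ` to get below `δ`, and
  -- `1 + t₂ d ≤ Γγ` to force `t₂ ≤ T`, so that the asymptotic bound already holds at `T`.
  set Γγ := s / Γ₂ + (Γ₂ + s) + (1 + t₂ * d) with hΓ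
  have htd₂ : 0 < t₂ * d := mul_pos ht₂ hd
  have hdiv : 0 ≤ s / Γ₂ := by positivity
  have hΓpos : 0 < Γγ := by linarith
  refine ⟨Γγ, Γ₂, hΓpos, hΓ₂, fun ν hνp hν => ⟨⟨t₂, fun t ht η hη => ?_⟩, ?_⟩⟩
  · have htd : 0 < t * d := mul_pos (ht₂.trans_le ht) hd
    have h1 : s ≤ Γγ * Γ₂ := by
      rw [← div_le_iff₀ hΓ₂]; linarith
    have h2 : 0 ≤ (1 + t * d) ^ ((m * b - 1 - b * η) / 2) := Real.rpow_nonneg (by linarith) _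
    linarith [hbound ν hνp hν t ht η hη, mul_le_mul_of_nonneg_right h1 h2]
  · intro δ hδ0 hδ1 T hT
    set X := 2 * Γγ / δ with hX
    have hX2 : 2 * Γγ ≤ X := by
      rw [hX, le_div_iff₀ hδ0]
      exact mul_le_of_le_one_right (by linarith) hδ1.le
    have hX1 : 1 ≤ X := by linarith
    have hX0 : 0 < X := by linarith
    have hexp : 1 ≤ (m + ε) / ε := by rw [le_div_iff₀ hε]; linarith
    have hXe : X ≤ X ^ ((m + ε) / ε) := by
      simpa using Real.rpow_le_rpow_of_exponent_le hX1 hexp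
    have h1T : 1 + T * d = X ^ ((m + ε) / ε) := by rw [hT]; field_simp; ring
    have htT : t₂ ≤ T := by
      refine le_of_mul_le_mul_right ?_ hd
      linarith
    have hT0 : 0 ≤ T := ht₂.le.trans htT
    refine ⟨hT0, fun t ht => ?_, ?_⟩
    · have h1 := hbound ν hνp hν t (htT.trans ht) ε hε
      -- As `m b - 1 = -(b ε)`, the two terms have the same decay exactly at `η = ε`.
      have hexp2 : (m * b - 1 - b * ε) / 2 = -(b * ε) := by rw [hmb]; ring
      rw [hexp2, ← add_mul] at h1
      have hxt : X ^ ((m + ε) / ε) ≤ 1 + t * d := by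
        rw [← h1T]
        linarith [mul_le_mul_of_nonneg_right ht hd.le]
      have h2 : (1 + t * d) ^ (-(b * ε)) ≤ δ / (2 * Γγ) := by
        calc (1 + t * d) ^ (-(b * ε)) ≤ (X ^ ((m + ε) / ε)) ^ (-(b * ε)) :=
              Real.rpow_le_rpow_of_nonpos (by positivity) hxt (by linarith)
          _ = X ^ (-1 : ℝ) := by
              rw [← Real.rpow_mul hX0.le, hb]
              congr 1
              field_simp
          _ = δ / (2 * Γγ) := by rw [Real.rpow_neg_one, hX, inv_div]
      have h3 : (P.law b α d ν).real {h | nsaProcess t h ∉ P.optSet ε} ≤ δ := by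
        refine h1.trans ((mul_le_mul_of_nonneg_left h2 (by linarith)).trans ?_)
        rw [mul_div_assoc', div_le_iff₀ (by linarith), mul_comm]
        exact mul_le_mul_of_nonneg_left (by linarith) hδ0.le
      -- Passing to the complement by subadditivity needs no measurability of the event.
      have h4 := measureReal_union_le (μ := P.law b α d ν)
        {h | nsaProcess t h ∈ P.optSet ε} {h | nsaProcess t h ∉ P.optSet ε}
      have h5 : {h : ℕ → E × ℝ × ℕ | nsaProcess t h ∈ P.optSet ε} ∪
          {h | nsaProcess t h ∉ P.optSet ε} = Set.univ := by
        ext h; simp [em]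
      rw [h5, probReal_univ] at h4
      linarith
    · refine (P.lintegral_nCall_le b α d ν T).trans
        ((lintegral_intensity_le (by linarith) hd hT0).trans_eq ?_)
      rw [h1T, ← Real.rpow_mul hX0.le, hα]
      congr 4
      ring
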